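/- Let $T>0$, $d\ge 0$ an integer and $\alpha\in(1/3,1/2)$. Let $\xi^1,\dots,\xi^d$ be independent space-time white noises on $[0,T]\times S^1$, where $S^1=\mathbf R/\mathbf Z$ is $[0,1]$ with identified end points, and let $\psi=(\psi^1,\dots,\psi^d)$ be the continuous (mild) solution of $\partial_t\psi=\partial_x^2\psi+\xi$, $\psi(0,\cdot)=0$; that is, $\psi$ has a.s. continuous sample sheets on $[0,T]\times[0,1]$ and, for all $(t,x)$, a.s. $$\psi^i(t,x)=\int_0^t\!\int_{S^1}\tilde p_{t-s}(x-y)\,\xi^i(ds,dy),\qquad \tilde p_t(x)=\sum_{n\in\mathbf Z}\frac{1}{\sqrt{4\pi t}}e^{-(x+n)^2/(4t)} .$$ **Rough paths.** Let $\mathcal S=\{0\le x\le y\le 1\}$. For continuous $A$ on $\mathcal S$ put $\|A\|_{H;\gamma}=\sup_{0\le x<y\le1}|A_{x,y}|/(y-x)^\gamma$. An $\alpha$-Hölder rough path is a triple $(v,A^1,A^2)$ with $v\in\mathbf R^d$ and continuous $A^1:\mathcal S\to\mathbf R^d$, $A^2:\mathcal S\to\mathbf R^d\otimes\mathbf R^d$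 such that, for $x\le z\le y$, $A^1_{x,y}=A^1_{x,z}+A^1_{z,y}$, $A^2_{x,y}=A^2_{x,z}+A^2_{z,y}+A^1_{x,z}\otimes A^1_{z,y}$, and $\|A^1\|_{H;\alpha},\|A^2\|_{H;2\alpha}<\infty$; the distance of two of them is $|v-u|+\|A^1-B^1\|_{H;\alpha}+\|A^2-B^2\|_{H;2\alpha}$. The natural lift of a Lipschitz path $a:[0,1]\to\mathbf R^d$ is $\mathcal L_2(a)=\bigl(a_0,\ a_y-a_x,\ \int_x^y(a_z-a_x)\otimes da_z\bigr)$. $G\hat\Omega^H_\alpha(\mathbf R^d)$ is the closure of the set of natural lifts in the space of $\alpha$-Hölder rough paths, and $\mathcal P_\infty G\hat\Omega^H_\alpha(\mathbf R^d)=C([0,T],G\hat\Omega^H_\alpha(\mathbf R^d))$ carries the distance $\sup_t|v_t-u_t|+\sup_t\|A^1_t-B^1_t\|_{H;\alpha}+\sup_t\|A^2_t-B^2_t\|_{H;2\alpha}$. **Lifts.** For each $k$ let $\psi(k)(t,\cdot)$ be the piecewise linear interpolation of $\psi(t,\cdot)$ at the points $i/2^k$, $0\le i\le 2^k$, and let $\Psi(k)_t=\mathcal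 L_2(\psi(k)(t,\cdot))$. A natural spatial lift of $\psi$ is a process $\Psi$ with a.s. sample paths in $\mathcal P_\infty G\hat\Omega^H_\alpha(\mathbf R^d)$ such that a.s., for all $t$ and $x\le y$, $\Psi_t$ has initial value $\psi(t,0)$ and $\Psi^1_t(x,y)=\psi(t,y)-\psi(t,x)$, and such that, for all $t$ and $x\le y$, $\Psi^2_t(x,y)$ is the Stratonovich integral $\int_x^y(\psi(t,z)-\psi(t,x))\otimes\circ\,d_z\psi(t,z)$, i.e. the $L^2$-limit of the sums $\sum_l\bigl(\tfrac12(\psi(t,u_l)+\psi(t,u_{l+1}))-\psi(t,x)\bigr)\otimes(\psi(t,u_{l+1})-\psi(t,u_l))$ along partitions $x=u_0\le\dots\le u_n=y$ as the mesh tends to $0$. **Claim.** A natural spatial lift of $\psi$ exists, and for every natural spatial lift $\Psi$ of $\psi$: 1. almost surely, $\Psi(k)\in\mathcal P_\infty G\hat\Omega^H_\alpha(\mathbf R^d)$ for all $k$, and $\Psi(k)\to\Psi$ in $\mathcal P_\infty G\hat\Omega^H_\alpha(\mathbf R^d)$ as $k\to\infty$; 2. for all $1<p<\infty$, the random variables $$\sup_{0\le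 t\le T}\|\Psi(k)^1_t-\Psi^1_t\|_{H;\alpha}+\sup_{0\le t\le T}\|\Psi(k)^2_t-\Psi^2_t\|_{H;2\alpha}$$ belong to $L^p$ and converge to $0$ in $L^p$ as $k\to\infty$. -/

import Mathlib

open MeasureTheory ProbabilityTheory Set Filter Topology
open scoped ENNReal

noncomputable section

namespace SpatialLift

/-! ### Rough paths over `ℝ^d` with parameter interval `[0,1]` -/

/-- `ℝ^d` with the Euclidean norm. -/
abbrev Vec (d : ℕ) : Type := EuclideanSpace ℝ (Fin d)

/-- `ℝ^d ⊗ ℝ^d` with the Hilbert-Schmidt norm. -/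
abbrev Tens (d : ℕ) : Type := EuclideanSpace ℝ (Fin d × Fin d)

/-- The elementary tensor `u ⊗ v`. -/
def tensor {d : ℕ} (u v : Vec d) : Tens d := WithLp.toLp 2 fun p => u p.1 * v p.2

/-- The simplex `{(x, y) | 0 ≤ x ≤ y ≤ 1}`. -/
def simplex : Set (ℝ × ℝ) := {p | 0 ≤ p.1 ∧ p.1 ≤ p.2 ∧ p.2 ≤ 1}

/-- A triple `(v, A¹, A²)`: an initial value and two functions of `(x, y)`. Only the values on the
simplex are ever used. -/
structure RoughData (d : ℕ) where
  init : Vec d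
  fst : ℝ → ℝ → Vec d
  snd : ℝ → ℝ → Tens d

/-- The `α`-Hölder norm `sup_{0 ≤ x < y ≤ 1} |A x y| / (y - x)^α`, possibly infinite. -/
def holderNorm {E : Type*} [NormedAddCommGroup E] (α : ℝ) (A : ℝ → ℝ → E) : ℝ≥0∞ :=
  ⨆ (x : ℝ) (y : ℝ) (_ : 0 ≤ x ∧ x < y ∧ y ≤ 1), ENNReal.ofReal (‖A x y‖ / (y - x) ^ α)

/-- `A` is an `α`-Hölder rough path (with an initial value): continuous on the simplex,
multiplicative (Chen's identity), and of finite `α`- and `2α`-Hölder norm. -/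
structure IsRoughPath {d : ℕ} (α : ℝ) (A : RoughData d) : Prop where
  continuousOn_fst : ContinuousOn (fun p : ℝ × ℝ => A.fst p.1 p.2) simplex
  continuousOn_snd : ContinuousOn (fun p : ℝ × ℝ => A.snd p.1 p.2) simplex
  chen_fst : ∀ x z y : ℝ, 0 ≤ x → x ≤ z → z ≤ y → y ≤ 1 →
    A.fst x y = A.fst x z + A.fst z y
  chen_snd : ∀ x z y : ℝ, 0 ≤ x → x ≤ z → z ≤ y → y ≤ 1 →
    A.snd x y = A.snd x z + A.snd z y + tensor (A.fst x z) (A.fst z y)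
  holder_fst : holderNorm α A.fst < ⊤
  holder_snd : holderNorm (2 * α) A.snd < ⊤

/-- The `α`-Hölder rough path distance, including the distance of the initial values. -/
def roughDist {d : ℕ} (α : ℝ) (A B : RoughData d) : ℝ≥0∞ :=
  edist A.init B.init
    + holderNorm α (fun x y => A.fst x y - B.fst x y)
    + holderNorm (2 * α) (fun x y => A.snd x y - B.snd x y)

/-- The natural lift of a path `a` that is Lipschitz on `[0,1]`:
`A¹ = a_y - a_x` and `A² = ∫_x^y (a_z - a_x) ⊗ da_z`, where `da_z = a'(z) dz`
since `a` is absolutely continuous. -/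
def naturalLift {d : ℕ} (a : ℝ → Vec d) : RoughData d where
  init := a 0
  fst x y := a y - a x
  snd x y := ∫ z in x..y, tensor (a z - a x) (deriv a z)

/-- Geometric `α`-Hölder rough paths: the closure, among the `α`-Hölder rough paths, of the natural
lifts of Lipschitz paths. -/
def IsGeometricRoughPath {d : ℕ} (α : ℝ) (A : RoughData d) : Prop :=
  IsRoughPath α A ∧
    ∀ ε : ℝ≥0∞, 0 < ε → ∃ a : ℝ → Vec d,
      (∃ K, LipschitzOnWith K a (Icc 0 1)) ∧ roughDist α A (naturalLift a) < ε

/-- Continuous paths `[0,T] → {geometric α-Hölder rough paths}`. -/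
def IsGeometricPath {d : ℕ} (α T : ℝ) (A : ℝ → RoughData d) : Prop :=
  (∀ t ∈ Icc 0 T, IsGeometricRoughPath α (A t)) ∧
    ∀ t ∈ Icc 0 T, Tendsto (fun s => roughDist α (A s) (A t)) (𝓝[Icc 0 T] t) (𝓝 0)

/-- `sup_{0 ≤ t ≤ T} ‖A¹_t - B¹_t‖_{H;α} + sup_{0 ≤ t ≤ T} ‖A²_t - B²_t‖_{H;2α}`. -/
def levelDist {d : ℕ} (α T : ℝ) (A B : ℝ → RoughData d) : ℝ≥0∞ :=
  (⨆ t ∈ Icc 0 T, holderNorm α (fun x y => (A t).fst x y - (B t).fst x y))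
    + ⨆ t ∈ Icc 0 T, holderNorm (2 * α) (fun x y => (A t).snd x y - (B t).snd x y)

/-- The distance on the space of continuous paths over the geometric rough path space. -/
def pathDist {d : ℕ} (α T : ℝ) (A B : ℝ → RoughData d) : ℝ≥0∞ :=
  (⨆ t ∈ Icc 0 T, edist (A t).init (B t).init) + levelDist α T A B

/-! ### The stochastic heat equation on the circle -/

/-- The heat kernel of `ℝ`, that is of `∂_t - ∂_x²`. -/
def heatKernel (t x : ℝ) : ℝ := 1 / √(4 * Real.pi * t) * Real.exp (-x ^ 2 / (4 * t))

/-- The heat kernel of the circle `ℝ/ℤ`. -/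
def circleHeatKernel (t x : ℝ) : ℝ := ∑' n : ℤ, heatKernel t (x + n)

/-- Lebesgue measure on `[0,T] × S¹`, the circle being `[0,1]` with identified end points. -/
def spaceTime (T : ℝ) : Measure (ℝ × ℝ) := volume.restrict (Icc 0 T ×ˢ Icc 0 1)

/-- `ξ¹, …, ξ^d` are independent space-time white noises on `[0,T] × S¹`: a centred
Gaussian family indexed by `{1,…,d} × L²([0,T] × S¹)` with covariance
`E[ξ^i(f) ξ^j(g)] = δ_{ij} ⟨f, g⟩`. -/
structure IsWhiteNoise {Ω : Type*} [MeasurableSpace Ω] (P : Measure Ω) (T : ℝ) {d : ℕ}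
    (ξ : Fin d → Lp ℝ 2 (spaceTime T) → Ω → ℝ) : Prop where
  gaussian : IsGaussianProcess (fun q : Fin d × Lp ℝ 2 (spaceTime T) => ξ q.1 q.2) P
  centred : ∀ i f, ∫ ω, ξ i f ω ∂P = 0
  covariance : ∀ i j f g,
    ∫ ω, ξ i f ω * ξ j g ω ∂P = if i = j then (inner ℝ f g : ℝ) else 0

/-- `ψ` is the (mild) solution of `∂_t ψ = ∂_x² ψ + ξ`, `ψ(0, ·) = 0`, on `[0,T] × S¹`: a process
with a.s. continuous sample sheets such that, for all `(t, x)`,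
`ψ^i(t,x) = ∫_0^t ∫_{S¹} p_{t-s}(x - y) ξ^i(ds, dy)` a.s., with `p` the heat kernel of the circle. -/
structure IsHeatSolution {Ω : Type*} [MeasurableSpace Ω] (P : Measure Ω) (T : ℝ) {d : ℕ}
    (ξ : Fin d → Lp ℝ 2 (spaceTime T) → Ω → ℝ) (ψ : ℝ → ℝ → Ω → Vec d) : Prop where
  continuous : ∀ᵐ ω ∂P, ContinuousOn (fun q : ℝ × ℝ => ψ q.1 q.2 ω) (Icc 0 T ×ˢ Icc 0 1)
  mild : ∀ t ∈ Icc 0 T, ∀ x ∈ Icc (0 : ℝ) 1, ∀ i : Fin d, ∃ f : Lp ℝ 2 (spaceTime T),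
    (f =ᵐ[spaceTime T] fun q : ℝ × ℝ => if q.1 < t then circleHeatKernel (t - q.1) (x - q.2) else 0)
      ∧ (fun ω => ψ t x ω i) =ᵐ[P] ξ i f

/-! ### Dyadic approximation and the natural lift of the solution -/

/-- The piecewise linear interpolation of `a : [0,1] → ℝ^d` at the points `j / 2^k`. -/
def dyadicInterp {d : ℕ} (k : ℕ) (a : ℝ → Vec d) (x : ℝ) : Vec d :=
  let j : ℝ := (⌊2 ^ k * x⌋ : ℤ)
  a (j / 2 ^ k) + (2 ^ k * x - j) • (a ((j + 1) / 2 ^ k) - a (j / 2 ^ k))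

/-- `Ψ(k)`: for each `t`, the natural lift of the `k`-th dyadic interpolation of `ψ(t, ·)`. -/
def dyadicLift {Ω : Type*} {d : ℕ} (ψ : ℝ → ℝ → Ω → Vec d) (k : ℕ) (ω : Ω) (t : ℝ) :
    RoughData d :=
  naturalLift (dyadicInterp k fun x => ψ t x ω)

/-- The symmetric (Stratonovich) Riemann sum for `∫_x^y (a_z - a_x) ⊗ ∘da_z` along
`x = u 0 ≤ u 1 ≤ … ≤ u n`. -/
def stratonovichSum {d : ℕ} (a : ℝ → Vec d) (n : ℕ) (u : ℕ → ℝ) : Tens d :=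
  ∑ l ∈ Finset.range n,
    tensor ((1 / 2 : ℝ) • (a (u l) + a (u (l + 1))) - a (u 0)) (a (u (l + 1)) - a (u l))

/-- `Ψ` is the natural spatial lift of `ψ`: a process with almost all sample paths in the space of
continuous paths over the geometric `α`-Hölder rough path space, whose first level is given by `ψ`,
and whose second level is, for all `t` and `x ≤ y`, the Stratonovich integral
`∫_x^y (ψ(t,z) - ψ(t,x)) ⊗ ∘d_z ψ(t,z)`, i.e. the limit in `L²(P)` of the symmetric Riemann sums
along partitions of `[x,y]` as the mesh tends to `0`. -/
structure IsSpatialLift {Ω : Type*} [MeasurableSpace Ω] (P : Measure Ω) (α T : ℝ) {d : ℕ}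
    (ψ : ℝ → ℝ → Ω → Vec d) (Ψ : Ω → ℝ → RoughData d) : Prop where
  path : ∀ᵐ ω ∂P, IsGeometricPath α T (Ψ ω)
  init_eq : ∀ᵐ ω ∂P, ∀ t ∈ Icc 0 T, (Ψ ω t).init = ψ t 0 ω
  fst_eq : ∀ᵐ ω ∂P, ∀ t ∈ Icc 0 T, ∀ x y, (x, y) ∈ simplex →
    (Ψ ω t).fst x y = ψ t y ω - ψ t x ω
  measurable_snd : ∀ t ∈ Icc 0 T, ∀ x y, (x, y) ∈ simplex →
    AEStronglyMeasurable (fun ω => (Ψ ω t).snd x y) P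
  snd_limit : ∀ t ∈ Icc 0 T, ∀ x y, (x, y) ∈ simplex → ∀ ε : ℝ≥0∞, 0 < ε → ∃ δ : ℝ, 0 < δ ∧
    ∀ (n : ℕ) (u : ℕ → ℝ), Monotone u → u 0 = x → u n = y → (∀ l < n, u (l + 1) - u l < δ) →
      eLpNorm (fun ω => stratonovichSum (fun z => ψ t z ω) n u - (Ψ ω t).snd x y) 2 P < ε

end SpatialLift

end

open SpatialLift

noncomputable section

namespace SpatialLift

/-! ### Fourier expansion of the heat kernel of the circle -/

/-! At a fixed time the solution is a Gaussian path with almost Brownian increments. The cosine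
expansion of the heat kernel (`hasSum_circleHeatKernel`) gives the covariance of ψ(s,y) and ψ(t,x)
as a cosine series (`hasSum_inner_mildKernel`). From it, each component of ψ(t,y) - ψ(t,x) has
variance at most y - x, and the time increments have variance of order (t-s)^(1/4).

The decisive point is convexity: on [0,1] the spatial covariance, as a function of the distance,
agrees with a function whose second derivative is half the heat kernel at time 2t. Hence increments
over disjoint intervals are nonpositively correlated (`inner_mildKernel_sub_nonpos`), while by
periodicity the increments over all dyadic cells of one level sum to zero. A Gram matrix with
nonpositive off-diagonal entries and vanishing row sums is a weighted graph Laplacian, so its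
quadratic form is at most twice its largest diagonal entry times the Euclidean one
(`norm_sum_smul_sq_le_of_inner_nonpos`). In this sense the increments behave like independent ones.

The stochastic content of the second level is the area A² - ½ A¹ ⊗ A¹. It vanishes where the path is
affine, and its sum over a partition is exactly the difference between A² and the Stratonovich sum
(`snd_sub_stratonovichSum`). So the step from Ψ(k)² to Ψ(k+1)² over a dyadic interval of level m ≤ k
is a sum of discrete areas (`snd_dyadicInterp_succ_sub`). Diagonal components of these vanish. An
off-diagonal component is a bilinear form in two independent Gaussian families: conditionally on one
family it is Gaussian, and the Laplacian bound yields 2r-th moments of order 2^(-(k+m)r)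
(`lintegral_bilinear_le`, `lintegral_blockArea_le`). Interpolation with a crude bound of the time
increments adds a small power of the time step.

Summing moments over all dyadic rectangles produces one random constant R, with a finite moment of
any prescribed order, that bounds all increments and areas at dyadic points (`exists_isControlled`).
From there on the argument is pathwise: chaining in time and space gives |Ψ(k+1) - Ψ(k)| ≤ C (R +
R²) 2^(-δk) in both Hölder norms, uniformly in time. The lifts therefore converge geometrically to
`limitLift`, almost surely and in every L^p, and the limit is geometric because the path space is
closed (`isGeometricPath_of_tendsto`).

The limit is a spatial lift because sums of areas over a partition have second moment of the order
of the mesh (`lintegral_limit_sq_le`). Every spatial lift agrees with it: the L² limits determine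
the second level almost surely at each fixed point, and continuity extends this from dyadic points
to all points at once (`IsSpatialLift.indistinguishable`). -/

/-- The `n`-th eigenvalue `(2πn)²` of `-∂_x²` on the circle. -/
def eig (n : ℕ) : ℝ := (2 * Real.pi * n) ^ 2

/-- The multiplicity of the `n`-th eigenvalue of `-∂_x²` on the circle. -/
def mult (n : ℕ) : ℝ := if n = 0 then 1 else 2

lemma eig_zero : eig 0 = 0 := by simp [eig]

lemma eig_nonneg (n : ℕ) : 0 ≤ eig n := sq_nonneg _

lemma sq_le_eig (n : ℕ) : (n : ℝ) ^ 2 ≤ eig n := by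
  unfold eig
  have : (n : ℝ) ≤ 2 * Real.pi * n := by
    have := Real.pi_gt_three
    nlinarith [(Nat.cast_nonneg n : (0 : ℝ) ≤ n)]
  gcongr

lemma one_le_eig {n : ℕ} (hn : n ≠ 0) : 1 ≤ eig n := by
  have h : (1 : ℝ) ≤ n := by exact_mod_cast Nat.one_le_iff_ne_zero.2 hn
  nlinarith [sq_le_eig n]

lemma mult_nonneg (n : ℕ) : 0 ≤ mult n := by unfold mult; split_ifs <;> norm_num

lemma mult_le_two (n : ℕ) : mult n ≤ 2 := by unfold mult; split_ifs <;> norm_num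

lemma summable_exp_neg_eig {t : ℝ} (ht : 0 < t) : Summable fun n : ℕ => Real.exp (-eig n * t) := by
  have h : Summable fun n : ℕ => Real.exp (n * (-t)) :=
    Real.summable_exp_nat_mul_iff.2 (by linarith)
  refine h.of_nonneg_of_le (fun n => (Real.exp_pos _).le) fun n => ?_
  apply Real.exp_le_exp.2
  have h1 : (n : ℝ) ≤ eig n := by
    refine le_trans ?_ (sq_le_eig n)
    rcases Nat.eq_zero_or_pos n with rfl | hn
    · simp
    · have : (1 : ℝ) ≤ n := by exact_mod_cast hn
      nlinarith
  nlinarith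

lemma circleHeatKernel_nonneg (t x : ℝ) : 0 ≤ circleHeatKernel t x :=
  tsum_nonneg fun _ => by unfold heatKernel; positivity

/-- Poisson summation in the form of the Jacobi theta transformation, with parameter 4πt and shift
ix. The terms n and -n then pair up to a cosine, which is where `mult` comes from. -/
lemma hasSum_circleHeatKernel {t : ℝ} (ht : 0 < t) (x : ℝ) :
    HasSum (fun n : ℕ => mult n * (Real.exp (-eig n * t) * Real.cos (2 * Real.pi * n * x)))
      (circleHeatKernel t x) := by
  have hpi := Real.pi_pos
  set F : ℤ → ℂ := fun n => Complex.exp (-(Real.pi : ℂ) * ((4 * Real.pi * t : ℝ) : ℂ) * (n : ℂ) ^ 2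
    + 2 * (Real.pi : ℂ) * (Complex.I * x) * n) with hF
  have hFe : ∀ n : ℤ, F n = Complex.exp (((-(2 * Real.pi * n) ^ 2 * t : ℝ) : ℂ)
      + ((2 * Real.pi * n * x : ℝ) : ℂ) * Complex.I) := by
    intro n
    simp only [hF]
    congr 1
    push_cast
    ring
  have hnorm : ∀ n : ℤ, ‖F n‖ = Real.exp (-(2 * Real.pi * n) ^ 2 * t) := by
    intro n
    rw [hFe, Complex.norm_exp]
    simp [-Complex.ofReal_mul, -Complex.ofReal_neg, -Complex.ofReal_pow]
  have hre : ∀ n : ℤ, (F n).re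
      = Real.exp (-(2 * Real.pi * n) ^ 2 * t) * Real.cos (2 * Real.pi * n * x) := by
    intro n
    rw [hFe, Complex.exp_re]
    simp [-Complex.ofReal_mul, -Complex.ofReal_neg, -Complex.ofReal_pow]
  have hsum : Summable F := by
    apply Summable.of_norm
    apply Summable.of_nat_of_neg
    · refine (summable_exp_neg_eig ht).congr fun n => ?_
      rw [hnorm]; simp [eig]
    · refine (summable_exp_neg_eig ht).congr fun n => ?_
      rw [hnorm]; simp [eig]
  have hkey : ∑' n, F n = ((circleHeatKernel t x : ℝ) : ℂ) := by
    have h := Complex.tsum_exp_neg_quadratic (a := ((4 * Real.pi * t : ℝ) : ℂ))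
      (by rw [Complex.ofReal_re]; positivity) (Complex.I * x)
    rw [hF, h]
    unfold circleHeatKernel
    -- The transformed exponents involve n - x, those of `heatKernel` x + n; a reflection of ℤ
    -- matches them.
    rw [Complex.ofReal_tsum, ← tsum_mul_left, ← (Equiv.neg ℤ).tsum_eq]
    refine tsum_congr fun n => ?_
    unfold heatKernel
    rw [Complex.ofReal_mul (1 / √(4 * Real.pi * t)), Complex.ofReal_exp, Complex.ofReal_div 1,
      Complex.ofReal_one, Real.sqrt_eq_rpow, Complex.ofReal_cpow (by positivity)]
    congr 2
    · norm_num
    · have h1 : (Complex.I * (Complex.I * x)) = -(x : ℂ) := by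
        rw [← mul_assoc, Complex.I_mul_I]; ring
      rw [h1]
      have : (Real.pi : ℂ) ≠ 0 := by exact_mod_cast hpi.ne'
      have : (t : ℂ) ≠ 0 := by exact_mod_cast ht.ne'
      push_cast
      simp only [Equiv.neg_apply, Int.cast_neg]
      field_simp
      ring
  have h1 : HasSum (fun n : ℤ => (F n).re) (circleHeatKernel t x) := by
    have := Complex.hasSum_re hsum.hasSum
    rwa [hkey, Complex.ofReal_re] at this
  -- Folding ℤ onto ℕ counts the term 0 twice; one copy is removed.
  have h2 := h1.nat_add_neg.sub (hasSum_ite_eq (0 : ℕ) (F 0).re)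
  rw [add_sub_cancel_right] at h2
  refine h2.congr_fun fun n => ?_
  have e : (F (-(n : ℤ))).re = (F n).re := by
    rw [hre, hre]
    push_cast
    rw [← Real.cos_neg]
    congr 2 <;> ring
  rw [e]
  have hn : (F n).re = Real.exp (-eig n * t) * Real.cos (2 * Real.pi * n * x) := by
    rw [hre]; simp [eig]
  unfold mult
  split_ifs with h0
  · subst h0
    simp only [Nat.cast_zero] at hn ⊢
    rw [← hn]; ring
  · rw [hn]; ring

lemma integral_cos_sub_int (k : ℤ) (c : ℝ) :
    ∫ z in (0 : ℝ)..1, Real.cos (c - 2 * Real.pi * k * z) = if k = 0 then Real.cos c else 0 := by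
  split_ifs with h
  · simp [h]
  · have : (2 * Real.pi * k : ℝ) ≠ 0 := by
      have := Real.pi_ne_zero
      have : (k : ℝ) ≠ 0 := by exact_mod_cast h
      positivity
    rw [intervalIntegral.integral_comp_sub_mul (fun u => Real.cos u) this, integral_cos]
    have e : c - 2 * Real.pi * k * 1 = c - k * (2 * Real.pi) := by ring
    rw [e, Real.sin_sub_int_mul_two_pi]
    simp

/-- Orthogonality of the cosines over a period. -/
lemma integral_cos_mul_cos (n m : ℕ) (x y : ℝ) :
    ∫ z in (0 : ℝ)..1, mult n * (Real.cos (2 * Real.pi * n * (x - z)) *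
        Real.cos (2 * Real.pi * m * (y - z)))
      = if n = m then Real.cos (2 * Real.pi * m * (x - y)) else 0 := by
  have e : ∀ z : ℝ, mult n * (Real.cos (2 * Real.pi * n * (x - z)) *
        Real.cos (2 * Real.pi * m * (y - z))) = mult n / 2 *
        (Real.cos ((2 * Real.pi * n * x - 2 * Real.pi * m * y) - 2 * Real.pi * ((n : ℤ) - m : ℤ) * z)
        + Real.cos ((2 * Real.pi * n * x + 2 * Real.pi * m * y)
          - 2 * Real.pi * ((n : ℤ) + m : ℤ) * z)) := by
    intro z
    have h1 : (2 * Real.pi * n * x - 2 * Real.pi * m * y) - 2 * Real.pi * ((n : ℤ) - m : ℤ) * z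
      = 2 * Real.pi * n * (x - z) - 2 * Real.pi * m * (y - z) := by push_cast; ring
    have h2 : (2 * Real.pi * n * x + 2 * Real.pi * m * y) - 2 * Real.pi * ((n : ℤ) + m : ℤ) * z
      = 2 * Real.pi * n * (x - z) + 2 * Real.pi * m * (y - z) := by push_cast; ring
    rw [h1, h2, Real.cos_sub, Real.cos_add]
    ring
  simp_rw [e]
  rw [intervalIntegral.integral_const_mul, intervalIntegral.integral_add
    (Continuous.intervalIntegrable (by fun_prop) _ _)
    (Continuous.intervalIntegrable (by fun_prop) _ _), integral_cos_sub_int, integral_cos_sub_int]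
  unfold mult
  by_cases hnm : n = m
  · subst hnm
    by_cases hn : n = 0
    · subst hn; norm_num
    · have : ((n : ℤ) + n) ≠ 0 := by omega
      simp only [sub_self, if_true, if_neg hn, if_neg this]
      rw [mul_sub]; ring
  · have h1 : ((n : ℤ) - m) ≠ 0 := by omega
    have h2 : ((n : ℤ) + m) ≠ 0 := by omega
    simp [hnm, h1, h2]

/-- Integrating a uniformly summable cosine series against a cosine. -/
lemma hasSum_integral_mul {ι : Type*} [Countable ι] {c : ι → ℝ} (hc : Summable c)
    {f : ι → ℝ → ℝ} (hf : ∀ i, Continuous (f i)) (hb : ∀ i z, |f i z| ≤ c i)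
    {g : ℝ → ℝ} (hg : Continuous g) (F : ℝ → ℝ) (hF : ∀ z, HasSum (fun i => f i z) (F z)) :
    HasSum (fun i => ∫ z in (0 : ℝ)..1, f i z * g z) (∫ z in (0 : ℝ)..1, F z * g z) := by
  refine intervalIntegral.hasSum_integral_of_dominated_convergence (fun i z => c i * |g z|)
    (fun i => ((hf i).mul hg).aestronglyMeasurable) (fun i => ?_) ?_ ?_ ?_
  · refine ae_of_all _ fun z _ => ?_
    rw [Real.norm_eq_abs, abs_mul]
    exact mul_le_mul_of_nonneg_right (hb i z) (abs_nonneg _)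
  · exact ae_of_all _ fun z _ => hc.mul_right _
  · simp_rw [tsum_mul_right]
    exact (Continuous.intervalIntegrable (by fun_prop) _ _)
  · exact ae_of_all _ fun z _ => (hF z).mul_right _

lemma continuous_circleHeatKernel {t : ℝ} (ht : 0 < t) : Continuous (circleHeatKernel t) := by
  have h : circleHeatKernel t = fun x => ∑' n : ℕ, mult n * (Real.exp (-eig n * t) *
      Real.cos (2 * Real.pi * n * x)) := funext fun x => (hasSum_circleHeatKernel ht x).tsum_eq.symm
  rw [h]
  refine continuous_tsum (fun n => by fun_prop) ((summable_exp_neg_eig ht).mul_left 2) fun n x => ?_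
  rw [Real.norm_eq_abs, abs_mul, abs_mul, abs_of_nonneg (mult_nonneg n), Real.abs_exp]
  have h1 := Real.abs_cos_le_one (2 * Real.pi * n * x)
  have h2 := Real.exp_pos (-eig n * t)
  have := mul_le_mul_of_nonneg_left h1 h2.le
  have h3 := mult_le_two n
  nlinarith [mult_nonneg n]

lemma abs_circle_term_le (n : ℕ) (t x : ℝ) :
    |mult n * (Real.exp (-eig n * t) * Real.cos (2 * Real.pi * n * x))|
      ≤ 2 * Real.exp (-eig n * t) := by
  rw [abs_mul, abs_mul, abs_of_nonneg (mult_nonneg n), Real.abs_exp]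
  have h1 := Real.abs_cos_le_one (2 * Real.pi * n * x)
  have h2 := Real.exp_pos (-eig n * t)
  have := mul_le_mul_of_nonneg_left h1 h2.le
  have h3 := mult_le_two n
  nlinarith [mult_nonneg n]

/-- The semigroup property of the heat kernel of the circle. -/
lemma integral_circleHeatKernel_mul {s t : ℝ} (hs : 0 < s) (ht : 0 < t) (x y : ℝ) :
    ∫ z in (0 : ℝ)..1, circleHeatKernel s (x - z) * circleHeatKernel t (y - z)
      = circleHeatKernel (s + t) (x - y) := by
  -- One kernel is first integrated against a single mode, where orthogonality leaves one term. Only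
  -- then is the other kernel expanded, so that no double series has to be rearranged.
  have h1 : ∀ m : ℕ, ∫ z in (0 : ℝ)..1, circleHeatKernel s (x - z) *
      Real.cos (2 * Real.pi * m * (y - z))
      = Real.exp (-eig m * s) * Real.cos (2 * Real.pi * m * (x - y)) := by
    intro m
    have h := hasSum_integral_mul ((summable_exp_neg_eig hs).mul_left 2)
      (f := fun n z => mult n * (Real.exp (-eig n * s) *
        Real.cos (2 * Real.pi * n * (x - z)))) (fun i => by fun_prop)
      (fun i z => abs_circle_term_le i s (x - z))
      (g := fun z => Real.cos (2 * Real.pi * m * (y - z))) (by fun_prop) _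
      (fun z => hasSum_circleHeatKernel hs (x - z))
    refine h.unique ?_
    convert hasSum_ite_eq m (Real.exp (-eig m * s) * Real.cos (2 * Real.pi * m * (x - y))) using 2
      with n
    have e : ∀ z : ℝ, mult n * (Real.exp (-eig n * s) * Real.cos (2 * Real.pi * n * (x - z))) *
        Real.cos (2 * Real.pi * m * (y - z)) = Real.exp (-eig n * s) * (mult n *
          (Real.cos (2 * Real.pi * n * (x - z)) * Real.cos (2 * Real.pi * m * (y - z)))) := by
      intro z; ring
    simp_rw [e]
    rw [intervalIntegral.integral_const_mul, integral_cos_mul_cos]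
    split_ifs with hnm
    · rw [hnm]
    · simp
  have h := hasSum_integral_mul ((summable_exp_neg_eig ht).mul_left 2)
      (f := fun n z => mult n * (Real.exp (-eig n * t) *
        Real.cos (2 * Real.pi * n * (y - z)))) (fun i => by fun_prop)
      (fun i z => abs_circle_term_le i t (y - z))
      (g := fun z => circleHeatKernel s (x - z))
      ((continuous_circleHeatKernel hs).comp (by fun_prop)) _
      (fun z => hasSum_circleHeatKernel ht (y - z))
  simp_rw [mul_comm (circleHeatKernel s _)]
  refine h.unique ((hasSum_circleHeatKernel (add_pos hs ht) (x - y)).congr_fun fun n => ?_)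
  have e : ∀ z : ℝ, mult n * (Real.exp (-eig n * t) * Real.cos (2 * Real.pi * n * (y - z))) *
        circleHeatKernel s (x - z) = mult n * Real.exp (-eig n * t) *
          (circleHeatKernel s (x - z) * Real.cos (2 * Real.pi * n * (y - z))) := by
    intro z; ring
  simp_rw [e]
  rw [intervalIntegral.integral_const_mul, h1]
  have : Real.exp (-eig n * (s + t)) = Real.exp (-eig n * t) * Real.exp (-eig n * s) := by
    rw [← Real.exp_add]; congr 1; ring
  rw [this]; ring

/-! ### The geometry of the solution in `L²([0,T] × S¹)` -/

/-- The kernel that represents the solution at `(t, x)`. -/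
def mildKernel (t x : ℝ) (q : ℝ × ℝ) : ℝ :=
  if q.1 < t then circleHeatKernel (t - q.1) (x - q.2) else 0

/-- The covariance of the `n`-th Fourier modes of the solution at times `s ≤ t`. -/
def heatCoef (n : ℕ) (s t : ℝ) : ℝ := ∫ r in (0 : ℝ)..s, Real.exp (-eig n * (t + s - 2 * r))

lemma heatCoef_zero (s t : ℝ) : heatCoef 0 s t = s := by simp [heatCoef, eig_zero]

lemma heatCoef_eq {n : ℕ} (hn : n ≠ 0) (s t : ℝ) :
    heatCoef n s t
      = (Real.exp (-eig n * (t - s)) - Real.exp (-eig n * (t + s))) / (2 * eig n) := by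
  have h0 : 2 * eig n ≠ 0 := by have := one_le_eig hn; positivity
  have e : ∀ r : ℝ, Real.exp (-eig n * (t + s - 2 * r))
      = Real.exp (2 * eig n * r - eig n * (t + s)) := by
    intro r; congr 1; ring
  unfold heatCoef
  simp_rw [e]
  rw [intervalIntegral.integral_comp_mul_sub (fun u => Real.exp u) h0, integral_exp]
  rw [smul_eq_mul, inv_mul_eq_div]
  congr 3 <;> ring

lemma heatCoef_nonneg (n : ℕ) {s : ℝ} (hs : 0 ≤ s) (t : ℝ) : 0 ≤ heatCoef n s t :=
  intervalIntegral.integral_nonneg hs fun _ _ => (Real.exp_pos _).le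

lemma heatCoef_le {n : ℕ} (hn : n ≠ 0) {s t : ℝ} (hst : s ≤ t) :
    heatCoef n s t ≤ 1 / (2 * eig n) := by
  have := one_le_eig hn
  rw [heatCoef_eq hn]
  gcongr
  have h1 : Real.exp (-eig n * (t - s)) ≤ 1 := Real.exp_le_one_iff.2 (by nlinarith)
  have h2 := Real.exp_pos (-eig n * (t + s))
  linarith

lemma summable_inv_eig : Summable fun n : ℕ => 1 / eig n := by
  refine (Real.summable_one_div_nat_pow.2 (by norm_num : 1 < 2)).of_nonneg_of_le
    (fun n => by have := eig_nonneg n; positivity) fun n => ?_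
  rcases eq_or_ne n 0 with rfl | hn
  · simp [eig_zero]
  · have : (0 : ℝ) < n := by exact_mod_cast Nat.pos_of_ne_zero hn
    have := sq_le_eig n
    gcongr

lemma summable_heatCoef {s t : ℝ} (hs : 0 ≤ s) (hst : s ≤ t) :
    Summable fun n => heatCoef n s t := by
  rw [← summable_nat_add_iff 1]
  refine ((summable_nat_add_iff 1).2 summable_inv_eig).of_nonneg_of_le
    (fun n => heatCoef_nonneg _ hs _) fun n => ?_
  refine (heatCoef_le (Nat.succ_ne_zero n) hst).trans ?_
  have := one_le_eig (Nat.succ_ne_zero n)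
  gcongr
  linarith

/-- The covariance of the solution. -/
lemma hasSum_inner_mildKernel {T s t x y : ℝ} (hs : 0 ≤ s) (hst : s ≤ t) (hsT : s ≤ T)
    {f h : Lp ℝ 2 (spaceTime T)} (hf : f =ᵐ[spaceTime T] mildKernel t x)
    (hh : h =ᵐ[spaceTime T] mildKernel s y) :
    HasSum (fun n => mult n * heatCoef n s t * Real.cos (2 * Real.pi * n * (x - y)))
      (inner ℝ f h : ℝ) := by
  -- Integrability is inherited from the inner product of the two given L² classes; the singular
  -- kernel itself need not be estimated.
  have hint : Integrable (fun q => mildKernel t x q * mildKernel s y q) (spaceTime T) := by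
    refine (L2.integrable_inner (𝕜 := ℝ) h f).congr ?_
    filter_upwards [hf, hh] with q h1 h2
    simp [h1, h2]
  have hin : (inner ℝ f h : ℝ) = ∫ q, mildKernel t x q * mildKernel s y q ∂(spaceTime T) := by
    rw [L2.inner_def]
    refine integral_congr_ae ?_
    filter_upwards [hf, hh] with q h1 h2
    simp [h1, h2, mul_comm]
  have h1 : (inner ℝ f h : ℝ) = ∫ r in Ioo (0 : ℝ) s, circleHeatKernel (t + s - 2 * r) (x - y) := by
    rw [hin]
    unfold spaceTime at hint ⊢
    rw [Measure.volume_eq_prod] at hint ⊢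
    rw [setIntegral_prod _ hint]
    have h2 : ∀ r : ℝ, ∫ z in Icc (0 : ℝ) 1, mildKernel t x (r, z) * mildKernel s y (r, z)
        = (Iio s).indicator (fun r => circleHeatKernel (t + s - 2 * r) (x - y)) r := by
      intro r
      unfold mildKernel
      by_cases hr : r < s
      · have hrt : r < t := hr.trans_le hst
        rw [indicator_of_mem (show r ∈ Iio s from hr)]
        simp only [hr, hrt, if_true]
        rw [integral_Icc_eq_integral_Ioc, ← intervalIntegral.integral_of_le zero_le_one,
          integral_circleHeatKernel_mul (by linarith) (by linarith)]
        congr 1; ring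
      · rw [indicator_of_notMem (show r ∉ Iio s from hr)]
        simp [hr]
    simp_rw [h2]
    rw [setIntegral_indicator measurableSet_Iio, ← integral_Ico_eq_integral_Ioo]
    congr 2
    ext r
    simp only [mem_inter_iff, mem_Icc, mem_Iio, mem_Ico]
    constructor
    · rintro ⟨⟨h1, _⟩, h2⟩; exact ⟨h1, h2⟩
    · rintro ⟨h1, h2⟩; exact ⟨⟨h1, by linarith⟩, h2⟩
  set c := fun n : ℕ => Real.cos (2 * Real.pi * n * (x - y)) with hc
  have hIoo : ∀ n (b : ℝ), ∫ r in Ioo (0 : ℝ) s, b * Real.exp (-eig n * (t + s - 2 * r))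
      = b * heatCoef n s t := by
    intro n b
    rw [← integral_Ioc_eq_integral_Ioo, ← intervalIntegral.integral_of_le hs,
      intervalIntegral.integral_const_mul]
    rfl
  -- For s = t the kernel is singular as r → s, so the series has no uniform bound there. The
  -- exchange of sum and integral rests instead on the summability of the integrated terms, at most
  -- 2 `heatCoef n s t`.
  have hmain := hasSum_integral_of_summable_integral_norm (μ := volume.restrict (Ioo (0 : ℝ) s))
    (F := fun n r => mult n * c n * Real.exp (-eig n * (t + s - 2 * r))) (fun n => ?_) ?_
  · simp_rw [hIoo] at hmain
    have h2 : ∫ r in Ioo (0 : ℝ) s, ∑' n, mult n * c n * Real.exp (-eig n * (t + s - 2 * r))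
        = (inner ℝ f h : ℝ) := by
      rw [h1]
      refine setIntegral_congr_fun measurableSet_Ioo fun r hr => ?_
      rw [← (hasSum_circleHeatKernel (t := t + s - 2 * r) (by linarith [hr.2]) (x - y)).tsum_eq]
      exact tsum_congr fun n => by ring
    rw [h2] at hmain
    exact hmain.congr_fun fun n => by ring
  · have : Continuous fun r => mult n * c n * Real.exp (-eig n * (t + s - 2 * r)) := by fun_prop
    exact (this.integrableOn_Icc (a := 0) (b := s)).mono_set Ioo_subset_Icc_self
  · simp_rw [norm_mul, Real.norm_eq_abs, Real.abs_exp, hIoo]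
    refine ((summable_heatCoef hs hst).mul_left 2).of_nonneg_of_le
      (fun n => by have := heatCoef_nonneg n hs t; positivity) fun n => ?_
    have h2 := heatCoef_nonneg n hs t
    have h3 : |c n| ≤ 1 := Real.abs_cos_le_one _
    have h4 : |mult n| ≤ 2 := by rw [abs_of_nonneg (mult_nonneg n)]; exact mult_le_two n
    have : |mult n| * |c n| ≤ 2 * 1 := mul_le_mul h4 h3 (abs_nonneg _) (by norm_num)
    rw [mul_one] at this
    exact mul_le_mul_of_nonneg_right this h2

/-! ### Variances of the increments in space and in time -/

/-- `∑_{n ≥ 1} 2 cos(2πnh)/(2πn)²` on `[0,1]`. -/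
lemma hasSum_cos_div_eig {h : ℝ} (hh : h ∈ Icc (0 : ℝ) 1) :
    HasSum (fun n : ℕ => Real.cos (2 * Real.pi * n * h) / eig n) ((h ^ 2 - h + 1 / 6) / 4) := by
  have key := (hasSum_one_div_nat_pow_mul_cos one_ne_zero hh).mul_left (1 / (2 * Real.pi) ^ 2)
  have hpi := Real.pi_ne_zero
  have e : (1 / (2 * Real.pi) ^ 2) * ((-1 : ℝ) ^ (1 + 1) * (2 * Real.pi) ^ (2 * 1) / 2
      / (Nat.factorial (2 * 1)) * (Polynomial.map (algebraMap ℚ ℝ)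
        (Polynomial.bernoulli (2 * 1))).eval h) = (h ^ 2 - h + 1 / 6) / 4 := by
    have hb : (Polynomial.map (algebraMap ℚ ℝ) (Polynomial.bernoulli (2 * 1))).eval h
        = h ^ 2 - h + 1 / 6 := by
      have h2 : bernoulli 2 = 1 / 6 := by
        rw [bernoulli_eq_bernoulli'_of_ne_one (by norm_num), bernoulli'_two]
      simp [Polynomial.bernoulli, Finset.sum_range_succ, h2, bernoulli_one, bernoulli_zero]
      ring
    rw [hb]
    simp only [mul_one, Nat.factorial]
    field_simp
    norm_num
    ring
  rw [e] at key
  refine key.congr_fun fun n => ?_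
  unfold eig
  -- For n = 0 both sides divide by zero and are 0, so the zero mode drops out.
  rcases eq_or_ne n 0 with rfl | hn
  · simp
  · have : (n : ℝ) ≠ 0 := by exact_mod_cast hn
    field_simp
    ring

lemma hasSum_norm_sub_sq {T t x y : ℝ} (ht : 0 ≤ t) (htT : t ≤ T)
    {f h : Lp ℝ 2 (spaceTime T)} (hf : f =ᵐ[spaceTime T] mildKernel t x)
    (hh : h =ᵐ[spaceTime T] mildKernel t y) :
    HasSum (fun n => mult n * heatCoef n t t * (2 - 2 * Real.cos (2 * Real.pi * n * (x - y))))
      (‖f - h‖ ^ 2) := by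
  have h1 := hasSum_inner_mildKernel ht le_rfl htT hf hf
  have h2 := hasSum_inner_mildKernel ht le_rfl htT hh hh
  have h3 := hasSum_inner_mildKernel ht le_rfl htT hf hh
  rw [norm_sub_sq_real, ← real_inner_self_eq_norm_sq, ← real_inner_self_eq_norm_sq]
  refine ((h1.sub (h3.mul_left 2)).add h2).congr_fun fun n => ?_
  simp only [sub_self, mul_zero, Real.cos_zero]
  ring

/-- The variance of the spatial increments. -/
lemma norm_mildKernel_sub_space {T t x y : ℝ} (ht : 0 ≤ t) (htT : t ≤ T) (hx : 0 ≤ x)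
    (hxy : x ≤ y) (hy : y ≤ 1)
    {f h : Lp ℝ 2 (spaceTime T)} (hf : f =ᵐ[spaceTime T] mildKernel t y)
    (hh : h =ᵐ[spaceTime T] mildKernel t x) : ‖f - h‖ ^ 2 ≤ y - x := by
  have h1 := hasSum_norm_sub_sq ht htT hf hh
  have h2 := ((hasSum_cos_div_eig (h := 0) (by simp)).sub
    (hasSum_cos_div_eig (h := y - x) ⟨by linarith, by linarith⟩)).mul_left 2
  -- Termwise comparison with the stationary coefficients 1/(2 `eig n`); the zero mode does not
  -- contribute to an increment. With ℓ = y - x the stationary sum is (ℓ - ℓ²)/2.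
  have h3 : ‖f - h‖ ^ 2 ≤ 2 * ((0 ^ 2 - 0 + 1 / 6) / 4
      - ((y - x) ^ 2 - (y - x) + 1 / 6) / 4) := by
    refine hasSum_le (fun n => ?_) h1 h2
    have hcos := Real.cos_le_one (2 * Real.pi * n * (y - x))
    rcases eq_or_ne n 0 with rfl | hn
    · simp [eig_zero]
    · have := one_le_eig hn
      have hle := heatCoef_le hn (le_refl t)
      have hc0 := heatCoef_nonneg n ht t
      simp only [mult, if_neg hn, mul_zero, Real.cos_zero]
      calc 2 * heatCoef n t t * (2 - 2 * Real.cos (2 * Real.pi * n * (y - x)))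
          ≤ 2 * (1 / (2 * eig n)) * (2 - 2 * Real.cos (2 * Real.pi * n * (y - x))) := by
            apply mul_le_mul_of_nonneg_right _ (by linarith)
            linarith
        _ = _ := by field_simp
  nlinarith [sq_nonneg (y - x)]

/-- The variance of the temporal increments. -/
lemma exists_norm_mildKernel_sub_time (T : ℝ) : ∃ C : ℝ, 0 ≤ C ∧ ∀ s t x : ℝ, 0 ≤ s → s ≤ t →
    t ≤ T → ∀ f h : Lp ℝ 2 (spaceTime T), f =ᵐ[spaceTime T] mildKernel t x →
    h =ᵐ[spaceTime T] mildKernel s x → ‖f - h‖ ^ 2 ≤ C * (t - s) ^ (1 / 4 : ℝ) := by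
  have hS : Summable fun n : ℕ => 1 / (n : ℝ) ^ (3 / 2 : ℝ) :=
    Real.summable_one_div_nat_rpow.2 (by norm_num)
  -- The power 1/4 is not optimal, but it leaves the coefficients `eig n` ^ (-3/4) ≤ n ^ (-3/2),
  -- which are summable. The summand with |T| absorbs the zero mode, whose contribution is t - s.
  refine ⟨|T| ^ (3 / 4 : ℝ) + 2 * ∑' n : ℕ, 1 / (n : ℝ) ^ (3 / 2 : ℝ), ?_, ?_⟩
  · have : 0 ≤ ∑' n : ℕ, 1 / (n : ℝ) ^ (3 / 2 : ℝ) := tsum_nonneg fun n => by positivity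
    positivity
  intro s t x hs hst htT f h hf hh
  have ht := hs.trans hst
  have h1 := hasSum_inner_mildKernel ht le_rfl htT hf hf
  have h2 := hasSum_inner_mildKernel hs le_rfl (hst.trans htT) hh hh
  have h3 := hasSum_inner_mildKernel hs hst (hst.trans htT) hf hh
  rw [norm_sub_sq_real, ← real_inner_self_eq_norm_sq, ← real_inner_self_eq_norm_sq]
  have h4 := (h1.sub (h3.mul_left 2)).add h2
  have h5 := ((hasSum_ite_eq (0 : ℕ) (|T| ^ (3 / 4 : ℝ))).add (hS.hasSum.mul_left 2)).mul_right
    ((t - s) ^ (1 / 4 : ℝ))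
  refine hasSum_le (fun n => ?_) h4 h5
  have hd : 0 ≤ t - s := by linarith
  simp only [sub_self, mul_zero, Real.cos_zero, mul_one]
  rcases eq_or_ne n 0 with rfl | hn
  · simp only [mult, if_true, heatCoef_zero, Nat.cast_zero]
    have e : t - s = (t - s) ^ (3 / 4 : ℝ) * (t - s) ^ (1 / 4 : ℝ) := by
      rw [← Real.rpow_add_of_nonneg hd (by norm_num) (by norm_num)]; norm_num
    have h6 : (t - s) ^ (3 / 4 : ℝ) ≤ |T| ^ (3 / 4 : ℝ) :=
      Real.rpow_le_rpow hd (by have := le_abs_self T; linarith) (by norm_num)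
    have h7 := mul_le_mul_of_nonneg_right h6 (Real.rpow_nonneg hd (1 / 4 : ℝ))
    norm_num at h7 e ⊢
    linarith
  · have hl := one_le_eig hn
    simp only [mult, if_neg hn, heatCoef_eq hn, zero_add]
    set l := eig n with hldef
    have hz : 0 ≤ l * (t - s) := by positivity
    have hE : 1 - Real.exp (-l * (t - s)) ≤ (l * (t - s)) ^ (1 / 4 : ℝ) := by
      rcases le_total (l * (t - s)) 1 with h6 | h6
      · have h7 := Real.add_one_le_exp (-l * (t - s))
        have h8 : (l * (t - s)) ^ (1 : ℝ) ≤ (l * (t - s)) ^ (1 / 4 : ℝ) :=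
          Real.rpow_le_rpow_of_exponent_ge' hz h6 (by norm_num) (by norm_num)
        rw [Real.rpow_one] at h8
        linarith
      · have := Real.one_le_rpow h6 (by norm_num : (0 : ℝ) ≤ 1 / 4)
        have := Real.exp_pos (-l * (t - s))
        linarith
    have hexp : Real.exp (-l * (t + s)) = Real.exp (-l * t) * Real.exp (-l * s) := by
      rw [← Real.exp_add]; congr 1; ring
    have hexpt : Real.exp (-l * (t + t)) = Real.exp (-l * t) ^ 2 := by
      rw [← Real.exp_nat_mul]; congr 1; push_cast; ring
    have hexps : Real.exp (-l * (s + s)) = Real.exp (-l * s) ^ 2 := by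
      rw [← Real.exp_nat_mul]; congr 1; push_cast; ring
    rw [hexp, hexpt, hexps]
    simp only [sub_self, mul_zero, Real.exp_zero]
    have hpow : (n : ℝ) ^ (3 / 2 : ℝ) ≤ l ^ (3 / 4 : ℝ) := by
      have h6 := Real.rpow_le_rpow (by positivity) (sq_le_eig n) (by norm_num : (0 : ℝ) ≤ 3 / 4)
      rw [← Real.rpow_natCast, ← Real.rpow_mul (by positivity)] at h6
      norm_num at h6 ⊢
      exact h6
    have hl0 : 0 < l := by linarith
    have hlsplit : l = l ^ (3 / 4 : ℝ) * l ^ (1 / 4 : ℝ) := by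
      rw [← Real.rpow_add hl0]; norm_num
    have hn0 : (0 : ℝ) < (n : ℝ) ^ (3 / 2 : ℝ) :=
      Real.rpow_pos_of_pos (by exact_mod_cast Nat.pos_of_ne_zero hn) _
    rw [Real.mul_rpow hl0.le hd] at hE
    have hp0 : 0 < l ^ (1 / 4 : ℝ) := Real.rpow_pos_of_pos hl0 _
    have hq0 : 0 < l ^ (3 / 4 : ℝ) := Real.rpow_pos_of_pos hl0 _
    have hd0 : 0 ≤ (t - s) ^ (1 / 4 : ℝ) := Real.rpow_nonneg hd _
    -- The exponentials involving t + s, 2t and 2s combine to a square with a negative sign, which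
    -- is dropped.
    calc _ = (2 * (1 - Real.exp (-l * (t - s))) - (Real.exp (-l * t) - Real.exp (-l * s)) ^ 2)
          / l := by field_simp; ring
      _ ≤ (2 * (l ^ (1 / 4 : ℝ) * (t - s) ^ (1 / 4 : ℝ))) / l := by
          gcongr
          nlinarith [sq_nonneg (Real.exp (-l * t) - Real.exp (-l * s))]
      _ = 2 * (1 / l ^ (3 / 4 : ℝ)) * (t - s) ^ (1 / 4 : ℝ) := by
          rw [div_eq_iff hl0.ne']
          nth_rewrite 3 [hlsplit]
          field_simp
      _ ≤ _ := by gcongr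

/-! ### Convexity of the covariance and negative correlation of increments -/

/-- The twice integrated cosine series with summable coefficients `c`. -/
def cosSeries (c : ℕ → ℝ) (h : ℝ) : ℝ := ∑' n : ℕ, c n / eig n * Real.cos (2 * Real.pi * n * h)

section CosSeries

variable {c : ℕ → ℝ}

lemma div_eig_nonneg (hc0 : ∀ n, 0 ≤ c n) (n : ℕ) : 0 ≤ c n / eig n :=
  div_nonneg (hc0 n) (eig_nonneg n)

lemma summable_cosSeries (hc0 : ∀ n, 0 ≤ c n) (hcs : Summable c) (h : ℝ) :
    Summable fun n : ℕ => c n / eig n * Real.cos (2 * Real.pi * n * h) := by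
  refine Summable.of_norm_bounded hcs fun n => ?_
  rw [Real.norm_eq_abs, abs_mul, abs_of_nonneg (div_eig_nonneg hc0 n)]
  refine (mul_le_of_le_one_right (div_eig_nonneg hc0 n) (Real.abs_cos_le_one _)).trans ?_
  rcases eq_or_ne n 0 with rfl | hn
  · simp [eig_zero, hc0 0]
  · exact div_le_self (hc0 n) (one_le_eig hn)

/-- A derivative costs one factor 2πn against the denominator (2πn)², so the summable sequence c
still dominates, as termwise differentiation requires. A second derivative uses up the other factor.
-/
lemma norm_cosSeries_deriv_le (hc0 : ∀ n, 0 ≤ c n) (n : ℕ) (h : ℝ) :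
    ‖c n / eig n * (-Real.sin (2 * Real.pi * n * h) * (2 * Real.pi * n))‖ ≤ c n := by
  have hpi := Real.pi_pos
  rw [Real.norm_eq_abs, abs_mul, abs_mul, abs_of_nonneg (div_eig_nonneg hc0 n), abs_neg,
    abs_of_nonneg (by positivity : 0 ≤ 2 * Real.pi * n)]
  have h2 : c n / eig n * (2 * Real.pi * n) ≤ c n := by
    rcases eq_or_ne n 0 with rfl | hn
    · simp [hc0 0]
    · have h1 : 1 ≤ 2 * Real.pi * n := by
        have : (1 : ℝ) ≤ n := by exact_mod_cast Nat.one_le_iff_ne_zero.2 hn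
        nlinarith [Real.pi_gt_three]
      have h2 : eig n = (2 * Real.pi * n) * (2 * Real.pi * n) := by unfold eig; ring
      rw [h2, div_mul_eq_mul_div, mul_div_mul_right _ _ (by positivity)]
      exact div_le_self (hc0 n) h1
  refine le_trans ?_ h2
  apply mul_le_mul_of_nonneg_left _ (div_eig_nonneg hc0 n)
  exact mul_le_of_le_one_left (by positivity) (Real.abs_sin_le_one _)

lemma cosSeries_second_deriv_term (c : ℕ → ℝ) (n : ℕ) (h : ℝ) :
    c n / eig n * (-(Real.cos (2 * Real.pi * n * h) * (2 * Real.pi * n)) * (2 * Real.pi * n))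
      = if n = 0 then 0 else -(c n * Real.cos (2 * Real.pi * n * h)) := by
  split_ifs with hn
  · simp [hn]
  · have h0 : eig n ≠ 0 := by have := one_le_eig hn; positivity
    have e : c n / eig n * (-(Real.cos (2 * Real.pi * n * h) * (2 * Real.pi * n))
      * (2 * Real.pi * n)) = -((c n / eig n * eig n) * Real.cos (2 * Real.pi * n * h)) := by
      unfold eig; ring
    rw [e, div_mul_cancel₀ _ h0]

lemma hasDerivAt_const_mul_real (a y : ℝ) : HasDerivAt (fun y : ℝ => a * y) a y := by
  simpa using (hasDerivAt_id y).const_mul a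

lemma hasDerivAt_cosSeries (hc0 : ∀ n, 0 ≤ c n) (hcs : Summable c) (h : ℝ) :
    HasDerivAt (cosSeries c) (∑' n : ℕ, c n / eig n * (-Real.sin (2 * Real.pi * n * h)
      * (2 * Real.pi * n))) h := by
  have key : ∀ (n : ℕ) (y : ℝ), HasDerivAt (fun y => c n / eig n * Real.cos (2 * Real.pi * n * y))
      (c n / eig n * (-Real.sin (2 * Real.pi * n * y) * (2 * Real.pi * n))) y := fun n y =>
    ((hasDerivAt_const_mul_real (2 * Real.pi * n) y).cos).const_mul _
  exact hasDerivAt_tsum hcs key (norm_cosSeries_deriv_le hc0) (summable_cosSeries hc0 hcs 0) h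

lemma hasDerivAt_deriv_cosSeries (hc0 : ∀ n, 0 ≤ c n) (hcs : Summable c) (h : ℝ) :
    HasDerivAt (fun h => ∑' n : ℕ, c n / eig n * (-Real.sin (2 * Real.pi * n * h)
      * (2 * Real.pi * n))) (∑' n : ℕ, if n = 0 then 0 else
        -(c n * Real.cos (2 * Real.pi * n * h))) h := by
  have key : ∀ (n : ℕ) (y : ℝ), HasDerivAt (fun y => c n / eig n *
      (-Real.sin (2 * Real.pi * n * y) * (2 * Real.pi * n)))
      (if n = 0 then 0 else -(c n * Real.cos (2 * Real.pi * n * y))) y := fun n y => by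
    rw [← cosSeries_second_deriv_term]
    exact (((hasDerivAt_const_mul_real (2 * Real.pi * n) y).sin.neg).mul_const _).const_mul _
  have hb : ∀ (n : ℕ) (y : ℝ),
      ‖(if n = 0 then 0 else -(c n * Real.cos (2 * Real.pi * n * y)) : ℝ)‖ ≤ c n := fun n y => by
    split_ifs
    · simp [hc0 n]
    · rw [norm_neg, norm_mul, Real.norm_eq_abs, Real.norm_eq_abs, abs_of_nonneg (hc0 n)]
      exact mul_le_of_le_one_right (hc0 n) (Real.abs_cos_le_one _)
  exact hasDerivAt_tsum hcs key hb
    (Summable.of_norm_bounded hcs fun n => norm_cosSeries_deriv_le hc0 n 0) h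

end CosSeries

/-- Since `mult` is 2 off the zero mode, the second derivative of the cosine series with exponential
coefficients is, up to a constant, minus half a heat kernel. Thus positivity of the heat kernel
becomes convexity of the covariance. -/
lemma tsum_neg_exp_mul_cos {t : ℝ} (ht : 0 < t) (h : ℝ) :
    (∑' n : ℕ, if n = 0 then 0 else
      -(Real.exp (-eig n * t) * Real.cos (2 * Real.pi * n * h)))
      = (1 - circleHeatKernel t h) / 2 := by
  have h1 : HasSum (fun n : ℕ => ((if n = 0 then 1 else 0)
      - mult n * (Real.exp (-eig n * t) * Real.cos (2 * Real.pi * n * h))) / 2)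
      ((1 - circleHeatKernel t h) / 2) :=
    ((hasSum_ite_eq (0 : ℕ) (1 : ℝ)).sub (hasSum_circleHeatKernel ht h)).div_const 2
  rw [← h1.tsum_eq]
  refine tsum_congr fun n => ?_
  unfold mult
  split_ifs with hn
  · simp [hn, eig_zero]
  · ring

/-- The covariance function `h ↦ E[ψ(t,x) ψ(t,x+h)]` on `[0,1]` extends to a convex function. -/
lemma exists_convex_covariance {t : ℝ} (ht : 0 ≤ t) : ∃ φ : ℝ → ℝ, ConvexOn ℝ univ φ ∧
    ∀ h ∈ Icc (0 : ℝ) 1,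
      HasSum (fun n => mult n * heatCoef n t t * Real.cos (2 * Real.pi * n * h)) (φ h) := by
  rcases ht.eq_or_lt with rfl | ht
  · refine ⟨fun _ => 0, convexOn_const 0 convex_univ, fun h _ => ?_⟩
    simp [heatCoef]
  have hcs : Summable fun n => Real.exp (-eig n * (2 * t)) := summable_exp_neg_eig (by linarith)
  have hc0 : ∀ n, 0 ≤ Real.exp (-eig n * (2 * t)) := fun n => (Real.exp_pos _).le
  -- For n ≠ 0 the coefficient is (1 - exp(-2 `eig n` t)) / `eig n`. The first part sums to a
  -- quadratic polynomial on [0,1], and t is the zero mode. The polynomial is kept outside [0,1]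
  -- because the periodic extension of the covariance cannot be convex unless it is constant.
  refine ⟨fun h => t + (h ^ 2 - h + 1 / 6) / 4 - cosSeries (fun n => Real.exp (-eig n * (2 * t))) h, ?_, ?_⟩
  · refine convexOn_of_hasDerivWithinAt2_nonneg convex_univ ?_
      (f' := fun h => (2 * h - 1) / 4 - ∑' n : ℕ, Real.exp (-eig n * (2 * t)) / eig n
        * (-Real.sin (2 * Real.pi * n * h) * (2 * Real.pi * n)))
      (f'' := fun h => 2 / 4 - ∑' n : ℕ, if n = 0 then 0 else
        -(Real.exp (-eig n * (2 * t)) * Real.cos (2 * Real.pi * n * h))) ?_ ?_ ?_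
    · have : Continuous (cosSeries fun n => Real.exp (-eig n * (2 * t))) :=
        continuous_iff_continuousAt.2 fun h => (hasDerivAt_cosSeries hc0 hcs h).continuousAt
      exact (by fun_prop : Continuous _).continuousOn
    · intro h _
      have h1 : HasDerivAt (fun h : ℝ => t + (h ^ 2 - h + 1 / 6) / 4) ((2 * h - 1) / 4) h := by
        have := (((((hasDerivAt_id h).pow 2).sub (hasDerivAt_id h)).add_const (1 / 6)).div_const
          4).const_add t
        simpa using this
      exact (h1.sub (hasDerivAt_cosSeries hc0 hcs h)).hasDerivWithinAt
    · intro h _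
      have h1 : HasDerivAt (fun h : ℝ => (2 * h - 1) / 4) (2 / 4) h := by
        have := (((hasDerivAt_id h).const_mul 2).sub_const 1).div_const 4
        simpa using this
      exact (h1.sub (hasDerivAt_deriv_cosSeries hc0 hcs h)).hasDerivWithinAt
    · intro h _
      -- The second derivative is 1/2 - (1 - p)/2 = p/2, with p the heat kernel at time 2t.
      rw [tsum_neg_exp_mul_cos (by linarith)]
      have := circleHeatKernel_nonneg (2 * t) h
      linarith
  · intro h hh
    have h1 : HasSum (fun n : ℕ => ((if n = 0 then t else 0)
        + Real.cos (2 * Real.pi * n * h) / eig n)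
        - Real.exp (-eig n * (2 * t)) / eig n * Real.cos (2 * Real.pi * n * h)) _ :=
      ((hasSum_ite_eq (0 : ℕ) t).add (hasSum_cos_div_eig hh)).sub
        (summable_cosSeries hc0 hcs h).hasSum
    refine h1.congr_fun fun n => ?_
    rcases eq_or_ne n 0 with rfl | hn
    · simp [eig_zero, mult, heatCoef_zero]
    · simp only [mult, if_neg hn, heatCoef_eq hn, sub_self, mul_zero, Real.exp_zero, zero_add]
      have : eig n ≠ 0 := by have := one_le_eig hn; positivity
      rw [two_mul t]
      field_simp

/-- Increments of the solution over disjoint intervals are negatively correlated. -/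
lemma inner_mildKernel_sub_nonpos {T t a b c d : ℝ} (ht : 0 ≤ t) (htT : t ≤ T) (ha : 0 ≤ a)
    (hab : a ≤ b) (hbc : b ≤ c) (hcd : c ≤ d) (hd : d ≤ 1) {fa fb fc fd : Lp ℝ 2 (spaceTime T)}
    (hfa : fa =ᵐ[spaceTime T] mildKernel t a) (hfb : fb =ᵐ[spaceTime T] mildKernel t b)
    (hfc : fc =ᵐ[spaceTime T] mildKernel t c) (hfd : fd =ᵐ[spaceTime T] mildKernel t d) :
    (inner ℝ (fb - fa) (fd - fc) : ℝ) ≤ 0 := by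
  obtain ⟨φ, hφ, hsum⟩ := exists_convex_covariance ht
  have key : ∀ {x y : ℝ} {f h : Lp ℝ 2 (spaceTime T)}, x ≤ y → y - x ≤ 1 →
      f =ᵐ[spaceTime T] mildKernel t x → h =ᵐ[spaceTime T] mildKernel t y →
      (inner ℝ f h : ℝ) = φ (y - x) := by
    intro x y f h hxy hyx hf hh
    rw [real_inner_comm]
    exact (hasSum_inner_mildKernel ht le_rfl htT hh hf).unique
      (hsum (y - x) ⟨by linarith, hyx⟩)
  rw [inner_sub_left, inner_sub_right, inner_sub_right, key (by linarith) (by linarith) hfb hfd,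
    key (by linarith) (by linarith) hfb hfc, key (by linarith) (by linarith) hfa hfd,
    key (by linarith) (by linarith) hfa hfc]
  rcases (show c - b ≤ d - a by linarith).eq_or_lt with h | h
  · have h1 : d - b = c - b := by linarith
    have h2 : c - a = d - a := by linarith
    rw [h1, h2]; linarith
  -- Both d - b and c - a lie between p and r, and their sum is p + r. So they are convex
  -- combinations of p and r with exchanged weights, and the two convexity inequalities add up to
  -- the claim.
  · set p := c - b
    set r := d - a
    have hpr : 0 < r - p := by linarith
    have hw : 0 ≤ (b - a) / (r - p) := div_nonneg (by linarith) hpr.le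
    have hw' : 0 ≤ (d - c) / (r - p) := div_nonneg (by linarith) hpr.le
    have hww : (b - a) / (r - p) + (d - c) / (r - p) = 1 := by
      rw [← add_div, div_eq_one_iff_eq hpr.ne']
      simp only [p, r]; ring
    have h1 := hφ.2 (mem_univ p) (mem_univ r) hw hw' hww
    have h2 := hφ.2 (mem_univ p) (mem_univ r) hw' hw (by linarith)
    simp only [smul_eq_mul] at h1 h2
    have e1 : (b - a) / (r - p) * p + (d - c) / (r - p) * r = d - b := by
      field_simp; simp only [p, r]; ring
    have e2 : (d - c) / (r - p) * p + (b - a) / (r - p) * r = c - a := by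
      field_simp; simp only [p, r]; ring
    rw [e1] at h1
    rw [e2] at h2
    have e3 : (b - a) / (r - p) = 1 - (d - c) / (r - p) := by linarith
    rw [e3] at h1 h2
    nlinarith

lemma circleHeatKernel_add_one (t x : ℝ) : circleHeatKernel t (x + 1) = circleHeatKernel t x := by
  unfold circleHeatKernel
  rw [← (Equiv.addRight (1 : ℤ)).tsum_eq (fun n : ℤ => heatKernel t (x + n))]
  refine tsum_congr fun n => ?_
  simp only [Equiv.coe_addRight, Int.cast_add, Int.cast_one]
  congr 1; ring

/-- Consequently the increments over a partition of [0,1] sum to zero, the second ingredient of the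
Laplacian bound beside negative correlation. -/
lemma mildKernel_one (t : ℝ) : mildKernel t 1 = mildKernel t 0 := by
  funext q
  unfold mildKernel
  have : (1 : ℝ) - q.2 = (0 - q.2) + 1 := by ring
  rw [this, circleHeatKernel_add_one]

/-- This lets the chaining in time start from the value zero. -/
lemma mildKernel_zero_ae (T x : ℝ) : mildKernel 0 x =ᵐ[spaceTime T] 0 := by
  unfold spaceTime
  filter_upwards [ae_restrict_mem (measurableSet_Icc.prod measurableSet_Icc)] with q hq
  have : ¬ q.1 < 0 := not_lt.2 hq.1.1
  simp [mildKernel, this]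

/-! ### Gaussian moments -/

/-- The `p`-th absolute moment of the standard normal distribution. -/
def gaussMoment (p : ℕ) : ℝ≥0∞ := ∫⁻ x, ‖x‖ₑ ^ p ∂(gaussianReal 0 1)

lemma gaussMoment_lt_top (p : ℕ) : gaussMoment p < ⊤ := by
  rcases Nat.eq_zero_or_pos p with rfl | hp
  · simp [gaussMoment]
  have h := (memLp_id_gaussianReal (μ := 0) (v := 1) p).eLpNorm_lt_top
  have := (eLpNorm_lt_top_iff_lintegral_rpow_enorm_lt_top (f := (id : ℝ → ℝ))
    (μ := gaussianReal 0 1) (p := (p : ℝ≥0∞)) (by simpa using hp.ne') (by simp)).1 (by simpa using h)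
  simpa [gaussMoment] using this

lemma lintegral_gaussianReal_pow (s : ℝ) (p : ℕ) :
    ∫⁻ x, ‖x‖ₑ ^ p ∂(gaussianReal 0 (s ^ 2).toNNReal) = ‖s‖ₑ ^ p * gaussMoment p := by
  have h := gaussianReal_map_const_mul (μ := 0) (v := 1) s
  rw [mul_zero, mul_one] at h
  have e : (s ^ 2).toNNReal = NNReal.mk (s ^ 2) (sq_nonneg s) :=
    Real.toNNReal_of_nonneg (sq_nonneg s)
  rw [e, ← h, lintegral_map (by fun_prop) (by fun_prop)]
  simp_rw [enorm_mul, mul_pow]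
  rw [lintegral_const_mul _ (by fun_prop)]
  rfl

variable {Ω : Type*} [MeasurableSpace Ω] {P : Measure Ω} {T : ℝ} {d : ℕ}
  {ξ : Fin d → Lp ℝ 2 (spaceTime T) → Ω → ℝ}

namespace IsWhiteNoise

variable (hξ : IsWhiteNoise P T ξ)
include hξ

lemma hasGaussianLaw (i : Fin d) (f : Lp ℝ 2 (spaceTime T)) : HasGaussianLaw (ξ i f) P :=
  hξ.gaussian.hasGaussianLaw_eval (i, f)

lemma aemeasurable (i : Fin d) (f : Lp ℝ 2 (spaceTime T)) : AEMeasurable (ξ i f) P :=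
  (hξ.hasGaussianLaw i f).aemeasurable

lemma memLp_two (i : Fin d) (f : Lp ℝ 2 (spaceTime T)) : MemLp (ξ i f) 2 P :=
  (hξ.hasGaussianLaw i f).memLp_two

lemma map_eq (i : Fin d) (f : Lp ℝ 2 (spaceTime T)) :
    P.map (ξ i f) = gaussianReal 0 (‖f‖ ^ 2).toNNReal := by
  have := hξ.gaussian.isProbabilityMeasure
  have hv : Var[ξ i f; P] = ‖f‖ ^ 2 := by
    rw [variance_eq_sub (hξ.memLp_two i f), hξ.centred]
    have := hξ.covariance i i f f
    simp only [if_true, real_inner_self_eq_norm_sq] at this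
    simp [pow_two, this]
  rw [(hξ.hasGaussianLaw i f).map_eq_gaussianReal, hv, hξ.centred]

lemma lintegral_pow (i : Fin d) (f : Lp ℝ 2 (spaceTime T)) (p : ℕ) :
    ∫⁻ ω, ‖ξ i f ω‖ₑ ^ p ∂P = ‖f‖ₑ ^ p * gaussMoment p := by
  have h := lintegral_gaussianReal_pow ‖f‖ p
  rw [← hξ.map_eq i f, lintegral_map' (by fun_prop) (hξ.aemeasurable i f), enorm_norm] at h
  exact h

lemma integrable_mul (i j : Fin d) (f g : Lp ℝ 2 (spaceTime T)) :
    Integrable (fun ω => ξ i f ω * ξ j g ω) P :=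
  (hξ.memLp_two i f).integrable_mul (hξ.memLp_two j g)

/-- Linear relations in `L²` are inherited by the white noise. -/
lemma linear_relation_ae (i : Fin d) {u v w : Lp ℝ 2 (spaceTime T)} {a b : ℝ}
    (h : u + a • v + b • w = 0) :
    ∀ᵐ ω ∂P, ξ i u ω + a * ξ i v ω + b * ξ i w ω = 0 := by
  have hI := hξ.integrable_mul i i
  have e : ∀ ω, (ξ i u ω + a * ξ i v ω + b * ξ i w ω) ^ 2
      = (ξ i u ω * ξ i u ω + 2 * a * (ξ i u ω * ξ i v ω)) + (2 * b * (ξ i u ω * ξ i w ω)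
        + a ^ 2 * (ξ i v ω * ξ i v ω)) + (2 * a * b * (ξ i v ω * ξ i w ω)
        + b ^ 2 * (ξ i w ω * ξ i w ω)) := fun ω => by ring
  have h1 : Integrable (fun ω => ξ i u ω * ξ i u ω + 2 * a * (ξ i u ω * ξ i v ω)) P :=
    (hI _ _).add ((hI _ _).const_mul _)
  have h2 : Integrable (fun ω => 2 * b * (ξ i u ω * ξ i w ω) + a ^ 2 * (ξ i v ω * ξ i v ω)) P :=
    ((hI _ _).const_mul _).add ((hI _ _).const_mul _)
  have h3 : Integrable (fun ω => 2 * a * b * (ξ i v ω * ξ i w ω)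
      + b ^ 2 * (ξ i w ω * ξ i w ω)) P := ((hI _ _).const_mul _).add ((hI _ _).const_mul _)
  have h12 : Integrable (fun ω => (ξ i u ω * ξ i u ω + 2 * a * (ξ i u ω * ξ i v ω))
      + (2 * b * (ξ i u ω * ξ i w ω) + a ^ 2 * (ξ i v ω * ξ i v ω))) P := h1.add h2
  have hint : Integrable (fun ω => (ξ i u ω + a * ξ i v ω + b * ξ i w ω) ^ 2) P := by
    simp_rw [e]
    exact h12.add h3
  -- Linearity is not part of the definition of the noise. It follows because the second moment of
  -- the combination is the squared norm of the same combination in L², which is zero.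
  have h0 : ∫ ω, (ξ i u ω + a * ξ i v ω + b * ξ i w ω) ^ 2 ∂P = 0 := by
    simp_rw [e]
    rw [integral_add h12 h3, integral_add h1 h2, integral_add (hI _ _) ((hI _ _).const_mul _),
      integral_add ((hI _ _).const_mul _) ((hI _ _).const_mul _),
      integral_add ((hI _ _).const_mul _) ((hI _ _).const_mul _)]
    simp only [integral_const_mul, hξ.covariance, if_true]
    have h5 : (inner ℝ (u + a • v + b • w) (u + a • v + b • w) : ℝ) = 0 := by rw [h]; simp
    simp only [inner_add_left, inner_add_right, real_inner_smul_left, real_inner_smul_right,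
      real_inner_comm u v, real_inner_comm u w, real_inner_comm v w] at h5
    linarith
  have h1 := (integral_eq_zero_iff_of_nonneg (fun ω => sq_nonneg _) hint).1 h0
  filter_upwards [h1] with ω hω
  exact pow_eq_zero_iff (two_ne_zero) |>.1 hω

lemma add_ae (i : Fin d) (f g : Lp ℝ 2 (spaceTime T)) :
    ξ i (f + g) =ᵐ[P] fun ω => ξ i f ω + ξ i g ω := by
  filter_upwards [hξ.linear_relation_ae i (u := f + g) (v := f) (w := g) (a := -1) (b := -1)
    (by module)] with ω hω
  linarith

lemma smul_ae (i : Fin d) (c : ℝ) (f : Lp ℝ 2 (spaceTime T)) :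
    ξ i (c • f) =ᵐ[P] fun ω => c * ξ i f ω := by
  filter_upwards [hξ.linear_relation_ae i (u := c • f) (v := f) (w := f) (a := -c) (b := 0)
    (by module)] with ω hω
  linarith

lemma sub_ae (i : Fin d) (f g : Lp ℝ 2 (spaceTime T)) :
    ξ i (f - g) =ᵐ[P] fun ω => ξ i f ω - ξ i g ω := by
  have h : f - g = f + (-1 : ℝ) • g := by simp [sub_eq_add_neg]
  rw [h]
  filter_upwards [hξ.add_ae i f ((-1 : ℝ) • g), hξ.smul_ae i (-1) g] with ω h1 h2
  rw [h1, h2]; ring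

lemma zero_ae (i : Fin d) : ξ i 0 =ᵐ[P] 0 := by
  have h := hξ.smul_ae i 0 0
  rw [zero_smul] at h
  filter_upwards [h] with ω hω
  simpa using hω

lemma sum_smul_ae {ι : Type*} (i : Fin d) (s : Finset ι) (c : ι → ℝ)
    (f : ι → Lp ℝ 2 (spaceTime T)) :
    ξ i (∑ a ∈ s, c a • f a) =ᵐ[P] fun ω => ∑ a ∈ s, c a * ξ i (f a) ω := by
  classical
  induction s using Finset.induction_on with
  | empty => filter_upwards [hξ.zero_ae i] with ω hω; simpa using hω
  | insert a s ha ih =>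
    rw [Finset.sum_insert ha]
    filter_upwards [hξ.add_ae i (c a • f a) (∑ a ∈ s, c a • f a), hξ.smul_ae i (c a) (f a), ih]
      with ω h1 h2 h3
    rw [h1, h2, h3, Finset.sum_insert ha]

/-- The moments of a weighted sum of squares of Gaussians. -/
lemma lintegral_sum_sq_pow_le {ι : Type*} [Fintype ι] (j : Fin d) (h : ι → Lp ℝ 2 (spaceTime T))
    (b : ι → ℝ) (hb : ∀ a, 0 ≤ b a) {r : ℕ} (hr : r ≠ 0) :
    ∫⁻ ω, ENNReal.ofReal (∑ a, b a * ξ j (h a) ω ^ 2) ^ r ∂P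
      ≤ ENNReal.ofReal (∑ a, b a * ‖h a‖ ^ 2) ^ r * gaussMoment (2 * r) := by
  set s := ∑ a, b a * ‖h a‖ ^ 2 with hs
  have hnn : ∀ a, 0 ≤ b a * ‖h a‖ ^ 2 := fun a => mul_nonneg (hb a) (sq_nonneg _)
  have hs0 : 0 ≤ s := Finset.sum_nonneg fun a _ => hnn a
  have hzero : ∀ᵐ ω ∂P, ∀ a, ‖h a‖ = 0 → ξ j (h a) ω = 0 := by
    rw [ae_all_iff]
    intro a
    by_cases ha : ‖h a‖ = 0
    · rw [norm_eq_zero.1 ha]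
      filter_upwards [hξ.zero_ae j] with ω hω _ using hω
    · exact ae_of_all _ fun ω h => absurd h ha
  have hpt : ∀ᵐ ω ∂P, ENNReal.ofReal (∑ a, b a * ξ j (h a) ω ^ 2) ^ r
      ≤ ∑ a, ENNReal.ofReal (s ^ r * (b a * ‖h a‖ ^ 2 / s) * (1 / ‖h a‖) ^ (2 * r))
        * ‖ξ j (h a) ω‖ₑ ^ (2 * r) := by
    filter_upwards [hzero] with ω hω
    -- Each square is divided by its variance, which leaves the weights b a ‖h a‖² / s of total mass
    -- one (unless s = 0). Jensen's inequality for the power r then reduces everything to single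
    -- Gaussian moments.
    have e1 : ∀ a, b a * ξ j (h a) ω ^ 2
        = s * ((b a * ‖h a‖ ^ 2 / s) * (ξ j (h a) ω ^ 2 / ‖h a‖ ^ 2)) := by
      intro a
      by_cases ha : ‖h a‖ = 0
      · simp [ha, hω a ha]
      · by_cases hsz : s = 0
        · have := (Finset.sum_eq_zero_iff_of_nonneg fun a _ => hnn a).1 hsz a (Finset.mem_univ a)
          have hba : b a = 0 := by
            rcases mul_eq_zero.1 this with h1 | h1
            · exact h1
            · exact absurd (pow_eq_zero_iff two_ne_zero |>.1 h1) ha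
          simp [hba]
        · field_simp
    have hreal : (∑ a, b a * ξ j (h a) ω ^ 2) ^ r
        ≤ ∑ a, s ^ r * (b a * ‖h a‖ ^ 2 / s) * (1 / ‖h a‖) ^ (2 * r)
          * |ξ j (h a) ω| ^ (2 * r) := by
      simp_rw [e1]
      rw [← Finset.mul_sum, mul_pow]
      by_cases hsz : s = 0
      · simp [hsz, hr]
      have hw : ∑ a, b a * ‖h a‖ ^ 2 / s = 1 := by
        rw [← Finset.sum_div]; exact div_self hsz
      have := Real.pow_arith_mean_le_arith_mean_pow Finset.univ
        (fun a => b a * ‖h a‖ ^ 2 / s) (fun a => ξ j (h a) ω ^ 2 / ‖h a‖ ^ 2)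
        (fun a _ => div_nonneg (hnn a) hs0) hw (fun a _ => by positivity) r
      calc _ ≤ s ^ r * ∑ a, b a * ‖h a‖ ^ 2 / s * (ξ j (h a) ω ^ 2 / ‖h a‖ ^ 2) ^ r :=
            mul_le_mul_of_nonneg_left this (pow_nonneg hs0 _)
        _ = _ := by
            rw [Finset.mul_sum]
            refine Finset.sum_congr rfl fun a _ => ?_
            rw [pow_mul, pow_mul, sq_abs, div_pow, div_pow, div_pow, one_pow]
            ring
    rw [← ENNReal.ofReal_pow (Finset.sum_nonneg fun a _ => mul_nonneg (hb a) (sq_nonneg _))]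
    refine (ENNReal.ofReal_le_ofReal hreal).trans ?_
    rw [ENNReal.ofReal_sum_of_nonneg fun a _ => by have := hnn a; positivity]
    refine Finset.sum_le_sum fun a _ => ?_
    rw [ENNReal.ofReal_mul (by have := hnn a; positivity), ENNReal.ofReal_pow (abs_nonneg _),
      ← Real.enorm_eq_ofReal_abs]
  refine (lintegral_mono_ae hpt).trans ?_
  rw [lintegral_finsetSum' _ fun a _ =>
    (((hξ.aemeasurable j (h a)).enorm.pow_const _).const_mul _)]
  simp_rw [fun a => lintegral_const_mul'' (ENNReal.ofReal (s ^ r * (b a * ‖h a‖ ^ 2 / s)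
    * (1 / ‖h a‖) ^ (2 * r))) ((hξ.aemeasurable j (h a)).enorm.pow_const (2 * r)),
    hξ.lintegral_pow]
  simp_rw [← mul_assoc]
  rw [← Finset.sum_mul]
  gcongr
  have e2 : ∀ a, ENNReal.ofReal (s ^ r * (b a * ‖h a‖ ^ 2 / s) * (1 / ‖h a‖) ^ (2 * r))
      * ‖h a‖ₑ ^ (2 * r) ≤ ENNReal.ofReal (s ^ r * (b a * ‖h a‖ ^ 2 / s)) := by
    intro a
    rw [← ofReal_norm, ← ENNReal.ofReal_pow (norm_nonneg _),
      ← ENNReal.ofReal_mul (by have := hnn a; positivity)]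
    apply ENNReal.ofReal_le_ofReal
    have h1 : 0 ≤ s ^ r * (b a * ‖h a‖ ^ 2 / s) := by have := hnn a; positivity
    rw [mul_assoc, ← mul_pow]
    apply mul_le_of_le_one_right h1
    by_cases ha : ‖h a‖ = 0
    · simp [ha, hr]
    · rw [one_div, inv_mul_cancel₀ ha, one_pow]
  refine (Finset.sum_le_sum fun a _ => e2 a).trans ?_
  rw [← ENNReal.ofReal_sum_of_nonneg fun a _ => by have := hnn a; positivity,
    ← ENNReal.ofReal_pow hs0]
  apply ENNReal.ofReal_le_ofReal
  rw [← Finset.mul_sum, ← Finset.sum_div]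
  apply mul_le_of_le_one_right (pow_nonneg hs0 _)
  exact div_self_le_one _

/-- The processes `ξ i` and `ξ j` are independent for `i ≠ j`. -/
lemma indepFun {i j : Fin d} (hij : i ≠ j) {ι κ : Type*} (f : ι → Lp ℝ 2 (spaceTime T))
    (h : κ → Lp ℝ 2 (spaceTime T)) :
    IndepFun (fun ω a => ξ i (f a) ω) (fun ω a => ξ j (h a) ω) P := by
  have := hξ.gaussian.isProbabilityMeasure
  refine IsGaussianProcess.indepFun_of_covariance_eq_zero (X := fun a => ξ i (f a))
    (Y := fun a => ξ j (h a)) ?_ (fun a => hξ.aemeasurable i (f a))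
    (fun a => hξ.aemeasurable j (h a)) fun a a' => ?_
  · have := hξ.gaussian.comp_right (Sum.elim (fun a => (i, f a)) (fun a => (j, h a)))
    refine this.congr fun a => ?_
    cases a <;> exact EventuallyEq.rfl
  · rw [covariance_eq_sub (hξ.memLp_two i _) (hξ.memLp_two j _), hξ.centred, hξ.centred]
    have := hξ.covariance i j (f a) (h a')
    rw [if_neg hij] at this
    simp [this]

/-- Moments of a decoupled bilinear form in Gaussian variables. -/
lemma lintegral_bilinear_le {i j : Fin d} (hij : i ≠ j) {ι : Type*} [Fintype ι]
    (f h : ι → Lp ℝ 2 (spaceTime T)) (b : ι → ℝ) (hb : ∀ a, 0 ≤ b a)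
    (hq : ∀ c : ι → ℝ, ‖∑ a, c a • f a‖ ^ 2 ≤ ∑ a, b a * c a ^ 2) {r : ℕ} (hr : r ≠ 0) :
    ∫⁻ ω, ‖∑ a, ξ i (f a) ω * ξ j (h a) ω‖ₑ ^ (2 * r) ∂P
      ≤ gaussMoment (2 * r) ^ 2 * ENNReal.ofReal (∑ a, b a * ‖h a‖ ^ 2) ^ r := by
  have := hξ.gaussian.isProbabilityMeasure
  set U : Ω → ι → ℝ := fun ω a => ξ i (f a) ω
  set V : Ω → ι → ℝ := fun ω a => ξ j (h a) ω
  have hU : AEMeasurable U P := aemeasurable_pi_lambda _ fun a => hξ.aemeasurable i (f a)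
  have hV : AEMeasurable V P := aemeasurable_pi_lambda _ fun a => hξ.aemeasurable j (h a)
  -- By independence the family U can be integrated first. For frozen v the sum is the noise of the
  -- single vector ∑ v a • f a, a Gaussian of variance at most ∑ b a (v a)²; what remains is a
  -- moment of a weighted sum of squares.
  have hind := (indepFun_iff_map_prod_eq_prod_map_map hU hV).1 (hξ.indepFun hij f h)
  have hF : Measurable fun q : (ι → ℝ) × (ι → ℝ) => ‖∑ a, q.1 a * q.2 a‖ₑ ^ (2 * r) := by
    fun_prop
  have h1 : ∫⁻ ω, ‖∑ a, ξ i (f a) ω * ξ j (h a) ω‖ₑ ^ (2 * r) ∂P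
      = ∫⁻ v, ∫⁻ u, ‖∑ a, u a * v a‖ₑ ^ (2 * r) ∂(P.map U) ∂(P.map V) := by
    have := Measure.isProbabilityMeasure_map hU
    have := Measure.isProbabilityMeasure_map hV
    rw [← lintegral_prod_symm _ hF.aemeasurable, ← hind, lintegral_map' hF.aemeasurable
      (hU.prodMk hV)]
  have h2 : ∀ v : ι → ℝ, ∫⁻ u, ‖∑ a, u a * v a‖ₑ ^ (2 * r) ∂(P.map U)
      ≤ ENNReal.ofReal (∑ a, b a * v a ^ 2) ^ r * gaussMoment (2 * r) := by
    intro v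
    have hm : Measurable fun u : ι → ℝ => ‖∑ a, u a * v a‖ₑ ^ (2 * r) := by fun_prop
    rw [lintegral_map' hm.aemeasurable hU]
    have h3 : ∫⁻ ω, ‖∑ a, U ω a * v a‖ₑ ^ (2 * r) ∂P
        = ∫⁻ ω, ‖ξ i (∑ a, v a • f a) ω‖ₑ ^ (2 * r) ∂P := by
      refine lintegral_congr_ae ?_
      filter_upwards [hξ.sum_smul_ae i Finset.univ v f] with ω hω
      rw [hω]
      simp only [U, mul_comm]
    rw [h3, hξ.lintegral_pow, pow_mul]
    gcongr
    rw [← ofReal_norm, ← ENNReal.ofReal_pow (norm_nonneg _)]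
    exact ENNReal.ofReal_le_ofReal (hq v)
  rw [h1]
  refine (lintegral_mono h2).trans ?_
  have hG : Measurable fun v : ι → ℝ => ENNReal.ofReal (∑ a, b a * v a ^ 2) ^ r := by fun_prop
  rw [lintegral_map' (hG.mul_const _).aemeasurable hV,
    lintegral_mul_const'' _ (show AEMeasurable (fun ω =>
      ENNReal.ofReal (∑ a, b a * V ω a ^ 2) ^ r) P from hG.comp_aemeasurable hV)]
  refine (mul_le_mul_left (hξ.lintegral_sum_sq_pow_le j h b hb hr) _).trans ?_
  rw [pow_two, mul_comm, mul_comm (_ ^ r), mul_assoc]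

end IsWhiteNoise

/-! ### Two general estimates -/

/-- A quadratic form bound for vectors which sum to zero and are negatively correlated. -/
lemma norm_sum_smul_sq_le_of_inner_nonpos {E ι : Type*} [NormedAddCommGroup E]
    [InnerProductSpace ℝ E] [Fintype ι] (e : ι → E) (hsum : ∑ a, e a = 0)
    (hneg : ∀ a b, a ≠ b → (inner ℝ (e a) (e b) : ℝ) ≤ 0) {B : ℝ} (hB : ∀ a, ‖e a‖ ^ 2 ≤ B)
    (c : ι → ℝ) : ‖∑ a, c a • e a‖ ^ 2 ≤ ∑ a, 2 * B * c a ^ 2 := by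
  classical
  set m : ι → ι → ℝ := fun a b => inner ℝ (e a) (e b) with hm
  have hrow : ∀ a, ∑ b, m a b = 0 := fun a => by
    simp only [hm, ← inner_sum, hsum, inner_zero_right]
  have hcol : ∀ b, ∑ a, m a b = 0 := fun b => by
    simp only [hm, ← sum_inner, hsum, inner_zero_left]
  have h1 : ‖∑ a, c a • e a‖ ^ 2 = ∑ a, ∑ b, c a * c b * m a b := by
    rw [← real_inner_self_eq_norm_sq, sum_inner]
    refine Finset.sum_congr rfl fun a _ => ?_
    rw [inner_sum]
    refine Finset.sum_congr rfl fun b _ => ?_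
    rw [real_inner_smul_left, real_inner_smul_right, mul_assoc]
  -- Off the diagonal this says (c a + c b)² m a b ≤ 0. After summation the squares disappear with
  -- the row and column sums, and only twice the diagonal survives.
  have h2 : ∀ a b, c a * c b * m a b ≤ -(c a ^ 2 / 2 * m a b) - c b ^ 2 / 2 * m a b
      + if a = b then 2 * (c a ^ 2 * m a a) else 0 := by
    intro a b
    split_ifs with hab
    · subst hab; nlinarith
    · nlinarith [hneg a b hab, mul_nonneg (sq_nonneg (c a + c b)) (neg_nonneg.2 (hneg a b hab))]
  rw [h1]
  refine (Finset.sum_le_sum fun a _ => Finset.sum_le_sum fun b _ => h2 a b).trans ?_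
  simp_rw [Finset.sum_add_distrib, Finset.sum_sub_distrib]
  have h3 : ∑ a, ∑ b, -(c a ^ 2 / 2 * m a b) = 0 := by
    simp_rw [Finset.sum_neg_distrib, ← Finset.mul_sum, hrow]; simp
  have h4 : ∑ a, ∑ b, c b ^ 2 / 2 * m a b = 0 := by
    rw [Finset.sum_comm]
    simp_rw [← Finset.mul_sum, hcol]; simp
  rw [h3, h4]
  simp only [Finset.sum_ite_eq, Finset.mem_univ, if_true, sub_zero, zero_add]
  refine Finset.sum_le_sum fun a _ => ?_
  have : m a a ≤ B := by simpa [hm] using hB a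
  nlinarith [sq_nonneg (c a)]

/-- A countable family of random variables with summable `p`-th moments has a common bound with a
finite `p`-th moment. -/
lemma exists_common_bound {Ω ι : Type*} [MeasurableSpace Ω] {P : Measure Ω} [Countable ι]
    (V : ι → Ω → ℝ) (hV : ∀ q, AEMeasurable (V q) P) {p : ℕ} (hp : p ≠ 0)
    (hsum : ∑' q, ∫⁻ ω, ‖V q ω‖ₑ ^ p ∂P < ⊤) :
    ∃ R : Ω → ℝ, (∀ ω, 0 ≤ R ω) ∧ ∫⁻ ω, ENNReal.ofReal (R ω) ^ p ∂P < ⊤ ∧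
      ∀ᵐ ω ∂P, ∀ q, |V q ω| ≤ R ω := by
  -- The p-th power of the ℓ^p norm of the family: it dominates the p-th power of each member, and
  -- its expectation is the given sum of moments.
  set Z : Ω → ℝ≥0∞ := fun ω => ∑' q, ‖V q ω‖ₑ ^ p with hZ
  have hint : ∫⁻ ω, Z ω ∂P < ⊤ := by
    rw [hZ, lintegral_tsum fun q => (hV q).enorm.pow_const p]
    exact hsum
  have hpow : ∀ x : ℝ≥0∞, (x ^ (1 / (p : ℝ))) ^ p = x := fun x => by
    rw [← ENNReal.rpow_natCast, ← ENNReal.rpow_mul, one_div,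
      inv_mul_cancel₀ (by exact_mod_cast hp), ENNReal.rpow_one]
  refine ⟨fun ω => (Z ω ^ (1 / (p : ℝ))).toReal, fun ω => ENNReal.toReal_nonneg, ?_, ?_⟩
  · refine lt_of_le_of_lt (lintegral_mono fun ω => ?_) hint
    calc _ ≤ (Z ω ^ (1 / (p : ℝ))) ^ p := by gcongr; exact ENNReal.ofReal_toReal_le
      _ = Z ω := hpow _
  · have hmeas : AEMeasurable Z P := AEMeasurable.tsum fun q => (hV q).enorm.pow_const p
    filter_upwards [ae_lt_top' hmeas hint.ne] with ω hω q
    have h1 : ‖V q ω‖ₑ ≤ Z ω ^ (1 / (p : ℝ)) := by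
      rw [← ENNReal.pow_le_pow_left_iff hp, hpow]
      exact ENNReal.le_tsum q
    have h2 : Z ω ^ (1 / (p : ℝ)) ≠ ⊤ := (ENNReal.rpow_lt_top_of_nonneg (by positivity) hω.ne).ne
    have := ENNReal.toReal_mono h2 h1
    simpa using this

/-! ### Block sums of discrete areas -/

section Blocks

variable {E : Type*} [AddCommGroup E] [Module ℝ E]

/-- Half the sum of the deviations of `u a`, `u (a + 1)` from the end values of the block
`[n, n')`. -/
def centredMean (u : ℕ → E) (n n' a : ℕ) : E :=
  (1 / 2 : ℝ) • (u a + u (a + 1)) - (1 / 2 : ℝ) • (u n + u n')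

/-- The centred mean with respect to the block `[n l, n (l+1))` that contains `a`. -/
def blockVec (u : ℕ → E) (n : ℕ → ℕ) (L a : ℕ) : E :=
  ∑ l ∈ Finset.range L,
    (if n l ≤ a ∧ a < n (l + 1) then (1 : ℝ) else 0) • centredMean u (n l) (n (l + 1)) a

/-- Monotonicity of n makes the blocks disjoint, so at most one indicator is nonzero. -/
lemma blockVec_cases (u : ℕ → E) {n : ℕ → ℕ} (hn : Monotone n) (L a : ℕ) :
    ((∀ l < L, ¬ (n l ≤ a ∧ a < n (l + 1))) ∧ blockVec u n L a = 0) ∨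
      ∃ l < L, n l ≤ a ∧ a < n (l + 1) ∧
        blockVec u n L a = centredMean u (n l) (n (l + 1)) a := by
  by_cases h : ∃ l < L, n l ≤ a ∧ a < n (l + 1)
  · obtain ⟨l, hl, h1, h2⟩ := h
    refine Or.inr ⟨l, hl, h1, h2, ?_⟩
    unfold blockVec
    rw [Finset.sum_eq_single l]
    · simp [h1, h2]
    · intro l' _ hne
      have : ¬ (n l' ≤ a ∧ a < n (l' + 1)) := by
        rintro ⟨h3, h4⟩
        rcases lt_or_gt_of_ne hne with h5 | h5
        · have := hn (Nat.succ_le_of_lt h5)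
          simp only [Nat.succ_eq_add_one] at this; omega
        · have := hn (Nat.succ_le_of_lt h5)
          simp only [Nat.succ_eq_add_one] at this; omega
      simp [this]
    · intro h'; exact absurd (Finset.mem_range.2 hl) h'
  · push Not at h
    refine Or.inl ⟨fun l hl h' => absurd h'.2 (not_lt.2 (h l hl h'.1)), ?_⟩
    refine Finset.sum_eq_zero fun l hl => ?_
    have := h l (Finset.mem_range.1 hl)
    rw [if_neg (fun h' => absurd h'.2 (not_lt.2 (this h'.1))), zero_smul]

lemma blockVec_sub (u v : ℕ → E) (n : ℕ → ℕ) (L a : ℕ) :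
    blockVec (fun b => u b - v b) n L a = blockVec u n L a - blockVec v n L a := by
  unfold blockVec
  rw [← Finset.sum_sub_distrib]
  refine Finset.sum_congr rfl fun l _ => ?_
  unfold centredMean
  module

end Blocks

/-- The discrete area of `a` along the points `l / 2^K`, `n ≤ l ≤ n'`. -/
def gridArea {d : ℕ} (K n n' : ℕ) (a : ℝ → Vec d) : Tens d :=
  ∑ l ∈ Finset.Ico n n', tensor (centredMean (fun l : ℕ => a (l / 2 ^ K)) n n' l)
    (a ((l + 1 : ℕ) / 2 ^ K) - a (l / 2 ^ K))

lemma gridArea_apply {d : ℕ} (K n n' : ℕ) (a : ℝ → Vec d) (p q : Fin d) :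
    gridArea K n n' a (p, q) = ∑ l ∈ Finset.Ico n n',
      centredMean (fun l : ℕ => a (l / 2 ^ K) p) n n' l
        * (a ((l + 1 : ℕ) / 2 ^ K) q - a (l / 2 ^ K) q) := by
  unfold gridArea
  rw [WithLp.ofLp_sum, Finset.sum_apply]
  refine Finset.sum_congr rfl fun l _ => ?_
  simp only [tensor, centredMean, PiLp.sub_apply, PiLp.smul_apply, PiLp.add_apply]

/-- The summand is half the difference of consecutive squares minus a fixed multiple of the
increment, and both telescope. Hence only off-diagonal components matter, where the two Gaussian
families are independent. -/
lemma gridArea_apply_self {d : ℕ} (K : ℕ) {n n' : ℕ} (hn : n ≤ n') (a : ℝ → Vec d) (p : Fin d) :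
    gridArea K n n' a (p, p) = 0 := by
  rw [gridArea_apply]
  set u : ℕ → ℝ := fun l : ℕ => a (l / 2 ^ K) p with hu
  have h : ∀ l, centredMean u n n' l * (u (l + 1) - u l)
      = ((u (l + 1) ^ 2 - u l ^ 2) - (u n + u n') * (u (l + 1) - u l)) / 2 := by
    intro l; simp only [centredMean, smul_eq_mul]; ring
  have h2 : ∑ l ∈ Finset.Ico n n', (u (l + 1) ^ 2 - u l ^ 2) = u n' ^ 2 - u n ^ 2 :=
    Finset.sum_Ico_sub (fun l => u l ^ 2) hn
  calc _ = ∑ l ∈ Finset.Ico n n', centredMean u n n' l * (u (l + 1) - u l) := rfl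
    _ = 0 := by
      simp_rw [h]
      rw [← Finset.sum_div, Finset.sum_sub_distrib, ← Finset.mul_sum, h2,
        Finset.sum_Ico_sub u hn]
      ring

/-- Interchanging the sums turns all blocks together into one bilinear form in the 2^K increments. A
single moment bound for this form keeps the cancellation between blocks, which bounds for individual
blocks would lose. -/
lemma sum_gridArea_apply {d : ℕ} (K : ℕ) {n : ℕ → ℕ} (hn : Monotone n) {L : ℕ}
    (hL : n L ≤ 2 ^ K) (a : ℝ → Vec d) (p q : Fin d) :
    (∑ l ∈ Finset.range L, gridArea K (n l) (n (l + 1)) a) (p, q)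
      = ∑ b ∈ Finset.range (2 ^ K), (a ((b + 1 : ℕ) / 2 ^ K) q - a (b / 2 ^ K) q)
        * blockVec (fun l : ℕ => a (l / 2 ^ K) p) n L b := by
  rw [WithLp.ofLp_sum, Finset.sum_apply]
  simp_rw [gridArea_apply, blockVec, Finset.mul_sum]
  rw [Finset.sum_comm]
  refine Finset.sum_congr rfl fun l hl => ?_
  have hsub : Finset.Ico (n l) (n (l + 1)) ⊆ Finset.range (2 ^ K) := by
    intro b hb
    have h1 := hn (Nat.succ_le_of_lt (Finset.mem_range.1 hl))
    have h2 := (Finset.mem_Ico.1 hb).2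
    simp only [Nat.succ_eq_add_one] at h1
    exact Finset.mem_range.2 (by omega)
  rw [← Finset.sum_subset hsub]
  · refine Finset.sum_congr rfl fun b hb => ?_
    have := Finset.mem_Ico.1 hb
    simp [this, mul_comm]
  · intro b _ hb
    have : ¬ (n l ≤ b ∧ b < n (l + 1)) := fun h => hb (Finset.mem_Ico.2 h)
    simp [this]

/-! ### The representation of the solution in `L²` -/

/-- `g` represents the solution: `g t x` is the class of the kernel at `(t, x)`. -/
def IsKernelMap (T : ℝ) (g : ℝ → ℝ → Lp ℝ 2 (spaceTime T)) : Prop :=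
  ∀ t ∈ Icc 0 T, ∀ x ∈ Icc (0 : ℝ) 1, g t x =ᵐ[spaceTime T] mildKernel t x

variable {Ω : Type*} [MeasurableSpace Ω] {P : Measure Ω} {T : ℝ} {d : ℕ}
  {ξ : Fin d → Lp ℝ 2 (spaceTime T) → Ω → ℝ} {ψ : ℝ → ℝ → Ω → Vec d}

/-- The kernels of all components are almost everywhere equal, so one element of L² serves for all
of them; `i₀` merely provides a component from which to take it. -/
lemma IsHeatSolution.exists_kernelMap (hψ : IsHeatSolution P T ξ ψ) (i₀ : Fin d) :
    ∃ g, IsKernelMap T g ∧ ∀ t ∈ Icc 0 T, ∀ x ∈ Icc (0 : ℝ) 1, ∀ i,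
      (fun ω => ψ t x ω i) =ᵐ[P] ξ i (g t x) := by
  choose! f hf using hψ.mild
  refine ⟨fun t x => f t x i₀, fun t ht x hx => (hf t ht x hx i₀).1, fun t ht x hx i => ?_⟩
  have : f t x i = f t x i₀ := Lp.ext ((hf t ht x hx i).1.trans (hf t ht x hx i₀).1.symm)
  have h := (hf t ht x hx i).2
  rwa [this] at h

lemma grid_mem {K b : ℕ} (hb : b ≤ 2 ^ K) : (b : ℝ) / 2 ^ K ∈ Icc (0 : ℝ) 1 := by
  constructor
  · positivity
  · rw [div_le_one (by positivity)]
    exact_mod_cast hb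

lemma grid_le {K b b' : ℕ} (h : b ≤ b') : (b : ℝ) / 2 ^ K ≤ (b' : ℝ) / 2 ^ K := by
  have : (b : ℝ) ≤ b' := by exact_mod_cast h
  gcongr

namespace IsKernelMap

variable {g : ℝ → ℝ → Lp ℝ 2 (spaceTime T)} (hg : IsKernelMap T g)
include hg

lemma norm_sub_space {t x y : ℝ} (ht : t ∈ Icc 0 T) (hx : 0 ≤ x) (hxy : x ≤ y) (hy : y ≤ 1) :
    ‖g t y - g t x‖ ^ 2 ≤ y - x :=
  norm_mildKernel_sub_space ht.1 ht.2 hx hxy hy (hg t ht y ⟨hx.trans hxy, hy⟩)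
    (hg t ht x ⟨hx, hxy.trans hy⟩)

lemma apply_one {t : ℝ} (ht : t ∈ Icc 0 T) : g t 1 = g t 0 := by
  refine Lp.ext ((hg t ht 1 (by simp)).trans ?_)
  rw [mildKernel_one]
  exact (hg t ht 0 (by simp)).symm

lemma apply_zero (hT : 0 ≤ T) {x : ℝ} (hx : x ∈ Icc (0 : ℝ) 1) : g 0 x = 0 := by
  refine Lp.ext ((hg 0 ⟨le_rfl, hT⟩ x hx).trans ?_)
  exact (mildKernel_zero_ae T x).trans (Lp.coeFn_zero _ _ _).symm

/-- The increments over the cells of level K are pairwise nonpositively correlated by convexity, sum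
to zero by periodicity, and have variance at most 2^(-K), so the Laplacian bound applies. -/
lemma quadratic_form_le {t : ℝ} (ht : t ∈ Icc 0 T) (K : ℕ) (c : Fin (2 ^ K) → ℝ) :
    ‖∑ a : Fin (2 ^ K), c a • (g t ((a + 1 : ℕ) / 2 ^ K) - g t ((a : ℕ) / 2 ^ K))‖ ^ 2
      ≤ ∑ a, 2 * (1 / 2 ^ K) * c a ^ 2 := by
  have hmono : ∀ a b : Fin (2 ^ K), (a : ℕ) < b →
      (inner ℝ (g t ((a + 1 : ℕ) / 2 ^ K) - g t ((a : ℕ) / 2 ^ K))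
        (g t ((b + 1 : ℕ) / 2 ^ K) - g t ((b : ℕ) / 2 ^ K)) : ℝ) ≤ 0 := by
    intro a b hab
    have h1 := grid_mem (K := K) (b := a) a.2.le
    have h2 := grid_mem (K := K) (b := a + 1) a.2
    have h3 := grid_mem (K := K) (b := b) b.2.le
    have h4 := grid_mem (K := K) (b := b + 1) b.2
    exact inner_mildKernel_sub_nonpos ht.1 ht.2 h1.1 (grid_le (Nat.le_succ _))
      (grid_le (Nat.succ_le_of_lt hab)) (grid_le (Nat.le_succ _)) h4.2
      (hg t ht _ h1) (hg t ht _ h2) (hg t ht _ h3) (hg t ht _ h4)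
  refine norm_sum_smul_sq_le_of_inner_nonpos _ ?_ (fun a b hab => ?_) (fun a => ?_) c
  · rw [Fin.sum_univ_eq_sum_range (fun a : ℕ => g t ((a + 1 : ℕ) / 2 ^ K) - g t ((a : ℕ) / 2 ^ K)),
      Finset.sum_range_sub (fun a : ℕ => g t ((a : ℕ) / 2 ^ K))]
    have : ((2 ^ K : ℕ) : ℝ) / 2 ^ K = 1 := by push_cast; exact div_self (by positivity)
    rw [this, hg.apply_one ht]
    simp
  · rcases lt_or_gt_of_ne (fun h => hab (Fin.ext h) : (a : ℕ) ≠ b) with h | h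
    · exact hmono a b h
    · rw [real_inner_comm]; exact hmono b a h
  · refine (hg.norm_sub_space ht (grid_mem a.2.le).1 (grid_le (Nat.le_succ _))
      (grid_mem (K := K) (b := a + 1) a.2).2).trans ?_
    rw [← sub_div]; push_cast; ring_nf; rfl

end IsKernelMap

lemma norm_half_add_sq_le {E : Type*} [NormedAddCommGroup E] [NormedSpace ℝ E] {x y : E} {B : ℝ}
    (hx : ‖x‖ ^ 2 ≤ B) (hy : ‖y‖ ^ 2 ≤ B) : ‖(1 / 2 : ℝ) • x + (1 / 2 : ℝ) • y‖ ^ 2 ≤ B := by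
  have h : ‖(1 / 2 : ℝ) • x + (1 / 2 : ℝ) • y‖ ≤ (1 / 2) * ‖x‖ + (1 / 2) * ‖y‖ := by
    refine (norm_add_le _ _).trans ?_
    rw [norm_smul, norm_smul]; norm_num
  have h0 := norm_nonneg ((1 / 2 : ℝ) • x + (1 / 2 : ℝ) • y)
  nlinarith [sq_nonneg (‖x‖ - ‖y‖), norm_nonneg x, norm_nonneg y]

namespace IsKernelMap

variable {g : ℝ → ℝ → Lp ℝ 2 (spaceTime T)} (hg : IsKernelMap T g)
include hg

/-- A centred mean is the average of two increments between points of the block, up to sign, each of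
variance at most the block length. -/
lemma norm_centredMean_sq_le {t : ℝ} (ht : t ∈ Icc 0 T) {K n n' a : ℕ} (h1 : n ≤ a) (h2 : a < n')
    (h3 : n' ≤ 2 ^ K) :
    ‖centredMean (fun l : ℕ => g t (l / 2 ^ K)) n n' a‖ ^ 2 ≤ (n' - n : ℝ) / 2 ^ K := by
  have e : centredMean (fun l : ℕ => g t (l / 2 ^ K)) n n' a
      = (1 / 2 : ℝ) • (g t (a / 2 ^ K) - g t (n / 2 ^ K))
        + (1 / 2 : ℝ) • (g t ((a + 1 : ℕ) / 2 ^ K) - g t (n' / 2 ^ K)) := by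
    unfold centredMean; module
  rw [e]
  have ha : (n : ℝ) ≤ a := by exact_mod_cast h1
  have ha' : (a : ℝ) + 1 ≤ n' := by exact_mod_cast h2
  apply norm_half_add_sq_le
  · refine (hg.norm_sub_space ht (by positivity) (grid_le h1) (grid_mem (by omega)).2).trans ?_
    rw [← sub_div]; gcongr
  · rw [norm_sub_rev]
    refine (hg.norm_sub_space ht (by positivity) (grid_le h2) (grid_mem h3).2).trans ?_
    rw [← sub_div]; gcongr; linarith

/-- A block of N cells contributes N times the weight 2/2^K times its length N/2^K, that is, twice
its squared length. -/
lemma sum_norm_blockVec_sq_le {t : ℝ} (ht : t ∈ Icc 0 T) (K : ℕ) {n : ℕ → ℕ} (hn : Monotone n)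
    {L : ℕ} (hL : n L ≤ 2 ^ K) :
    ∑ a : Fin (2 ^ K), 2 * (1 / 2 ^ K) * ‖blockVec (fun l : ℕ => g t (l / 2 ^ K)) n L a‖ ^ 2
      ≤ 2 * ∑ l ∈ Finset.range L, ((n (l + 1) - n l : ℝ) / 2 ^ K) ^ 2 := by
  have h0 : ∀ l, (0 : ℝ) ≤ (n (l + 1) - n l : ℝ) / 2 ^ K := fun l => by
    have : (n l : ℝ) ≤ n (l + 1) := by exact_mod_cast hn (Nat.le_succ l)
    exact div_nonneg (by linarith) (by positivity)
  have h1 : ∀ a : ℕ, ‖blockVec (fun l : ℕ => g t (l / 2 ^ K)) n L a‖ ^ 2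
      ≤ ∑ l ∈ Finset.range L, if n l ≤ a ∧ a < n (l + 1) then (n (l + 1) - n l : ℝ) / 2 ^ K
        else 0 := by
    intro a
    have hnn : ∀ l ∈ Finset.range L, (0 : ℝ) ≤ if n l ≤ a ∧ a < n (l + 1) then
        (n (l + 1) - n l : ℝ) / 2 ^ K else 0 := fun l _ => by
      split_ifs
      · exact h0 l
      · exact le_rfl
    rcases blockVec_cases (fun l : ℕ => g t (l / 2 ^ K)) hn L a with ⟨_, h⟩ | ⟨l, hl, h2, h3, h⟩
    · rw [h]; simpa using Finset.sum_nonneg hnn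
    · rw [h]
      refine le_trans ?_ (Finset.single_le_sum hnn (Finset.mem_range.2 hl))
      rw [if_pos ⟨h2, h3⟩]
      exact hg.norm_centredMean_sq_le ht h2 h3 ((hn (Nat.succ_le_of_lt hl)).trans hL)
  rw [Fin.sum_univ_eq_sum_range (fun a : ℕ =>
    2 * (1 / 2 ^ K) * ‖blockVec (fun l : ℕ => g t (l / 2 ^ K)) n L a‖ ^ 2)]
  refine (Finset.sum_le_sum fun a _ => mul_le_mul_of_nonneg_left (h1 a) (by positivity)).trans ?_
  rw [← Finset.mul_sum, Finset.sum_comm, mul_assoc]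
  gcongr
  rw [Finset.mul_sum]
  refine Finset.sum_le_sum fun l hl => ?_
  rw [← Finset.sum_filter, Finset.sum_const, nsmul_eq_mul]
  have hcard : ((Finset.range (2 ^ K)).filter fun a => n l ≤ a ∧ a < n (l + 1)).card
      ≤ n (l + 1) - n l := by
    rw [← Nat.card_Ico]
    refine Finset.card_le_card fun a ha => ?_
    exact Finset.mem_Ico.2 (Finset.mem_filter.1 ha).2
  have hcard' : (((Finset.range (2 ^ K)).filter fun a => n l ≤ a ∧ a < n (l + 1)).card : ℝ)
      ≤ n (l + 1) - n l := by
    rw [← Nat.cast_sub (hn (Nat.le_succ l))]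
    exact_mod_cast hcard
  calc _ ≤ 1 / 2 ^ K * ((n (l + 1) - n l : ℝ) * ((n (l + 1) - n l : ℝ) / 2 ^ K)) := by
        gcongr; exact h0 l
    _ = _ := by ring

end IsKernelMap

/-! ### Moments of increments and areas -/

lemma enorm_sub_pow_le (x y : ℝ) (n : ℕ) : ‖x - y‖ₑ ^ n ≤ 2 ^ n * (‖x‖ₑ ^ n + ‖y‖ₑ ^ n) := by
  have h : ‖x - y‖ₑ ≤ ‖x‖ₑ + ‖y‖ₑ := enorm_sub_le
  rcases le_total ‖x‖ₑ ‖y‖ₑ with h1 | h1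
  · calc ‖x - y‖ₑ ^ n ≤ (2 * ‖y‖ₑ) ^ n := by rw [two_mul]; gcongr; exact h.trans (by gcongr)
      _ = 2 ^ n * ‖y‖ₑ ^ n := mul_pow _ _ _
      _ ≤ _ := by gcongr; exact le_add_self
  · calc ‖x - y‖ₑ ^ n ≤ (2 * ‖x‖ₑ) ^ n := by rw [two_mul]; gcongr; exact h.trans (by gcongr)
      _ = 2 ^ n * ‖x‖ₑ ^ n := mul_pow _ _ _
      _ ≤ _ := by gcongr; exact le_self_add

lemma IsWhiteNoise.centredMean_ae (hξ : IsWhiteNoise P T ξ) (i : Fin d)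
    (u : ℕ → Lp ℝ 2 (spaceTime T)) (n n' a : ℕ) :
    ξ i (centredMean u n n' a) =ᵐ[P] fun ω => centredMean (fun b => ξ i (u b) ω) n n' a := by
  unfold centredMean
  filter_upwards [hξ.sub_ae i ((1 / 2 : ℝ) • (u a + u (a + 1))) ((1 / 2 : ℝ) • (u n + u n')),
    hξ.smul_ae i (1 / 2) (u a + u (a + 1)), hξ.smul_ae i (1 / 2) (u n + u n'),
    hξ.add_ae i (u a) (u (a + 1)), hξ.add_ae i (u n) (u n')] with ω h1 h2 h3 h4 h5
  rw [h1, h2, h3, h4, h5]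
  simp

lemma IsWhiteNoise.blockVec_ae (hξ : IsWhiteNoise P T ξ) (i : Fin d)
    (u : ℕ → Lp ℝ 2 (spaceTime T)) (n : ℕ → ℕ) (L a : ℕ) :
    ξ i (blockVec u n L a) =ᵐ[P] fun ω => blockVec (fun b => ξ i (u b) ω) n L a := by
  unfold blockVec
  have h2 : ∀ᵐ ω ∂P, ∀ l, ξ i (centredMean u (n l) (n (l + 1)) a) ω
      = centredMean (fun b => ξ i (u b) ω) (n l) (n (l + 1)) a :=
    ae_all_iff.2 fun l => hξ.centredMean_ae i u _ _ a
  filter_upwards [hξ.sum_smul_ae i (Finset.range L) _ _, h2] with ω h1 h2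
  rw [h1]
  exact Finset.sum_congr rfl fun l _ => by rw [h2, smul_eq_mul]

/-- The solution `ψ` is represented by the kernel map `g`. -/
def IsRepresentedBy (P : Measure Ω) (ξ : Fin d → Lp ℝ 2 (spaceTime T) → Ω → ℝ)
    (ψ : ℝ → ℝ → Ω → Vec d) (g : ℝ → ℝ → Lp ℝ 2 (spaceTime T)) : Prop :=
  ∀ t ∈ Icc 0 T, ∀ x ∈ Icc (0 : ℝ) 1, ∀ i, (fun ω => ψ t x ω i) =ᵐ[P] ξ i (g t x)

variable {g : ℝ → ℝ → Lp ℝ 2 (spaceTime T)}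

lemma IsRepresentedBy.grid_ae (hr : IsRepresentedBy P ξ ψ g) {t : ℝ} (ht : t ∈ Icc 0 T) (K : ℕ)
    (i : Fin d) : ∀ᵐ ω ∂P, ∀ b : ℕ, b ≤ 2 ^ K → ψ t (b / 2 ^ K) ω i = ξ i (g t (b / 2 ^ K)) ω := by
  rw [ae_all_iff]
  intro b
  by_cases hb : b ≤ 2 ^ K
  · filter_upwards [hr t ht _ (grid_mem hb) i] with ω hω _ using hω
  · exact ae_of_all _ fun ω h => absurd h hb

lemma centredMean_congr {E : Type*} [AddCommGroup E] [Module ℝ E] {u v : ℕ → E} {N n n' a : ℕ}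
    (h : ∀ b ≤ N, u b = v b) (hn : n ≤ N) (hn' : n' ≤ N) (ha : a < N) :
    centredMean u n n' a = centredMean v n n' a := by
  unfold centredMean
  rw [h a ha.le, h (a + 1) ha, h n hn, h n' hn']

lemma blockVec_congr {E : Type*} [AddCommGroup E] [Module ℝ E] {u v : ℕ → E} {N L a : ℕ}
    {n : ℕ → ℕ} (h : ∀ b ≤ N, u b = v b) (hn : Monotone n) (hL : n L ≤ N) (ha : a < N) :
    blockVec u n L a = blockVec v n L a := by
  unfold blockVec
  refine Finset.sum_congr rfl fun l hl => ?_
  have hl := Finset.mem_range.1 hl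
  rw [centredMean_congr h ((hn hl.le).trans hL) ((hn hl).trans hL) ha]

/-- A component of a block sum of areas is a decoupled bilinear form in the noise. -/
lemma blockArea_ae (hξ : IsWhiteNoise P T ξ) (hr : IsRepresentedBy P ξ ψ g) {t : ℝ}
    (ht : t ∈ Icc 0 T) (K : ℕ) {n : ℕ → ℕ} (hn : Monotone n) {L : ℕ} (hL : n L ≤ 2 ^ K)
    (p q : Fin d) :
    ∀ᵐ ω ∂P, (∑ l ∈ Finset.range L, gridArea K (n l) (n (l + 1)) (fun x => ψ t x ω)) (p, q)
      = ∑ a : Fin (2 ^ K), ξ q (g t ((a + 1 : ℕ) / 2 ^ K) - g t ((a : ℕ) / 2 ^ K)) ω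
        * ξ p (blockVec (fun l : ℕ => g t (l / 2 ^ K)) n L a) ω := by
  have h1 : ∀ᵐ ω ∂P, ∀ a : ℕ, ξ q (g t ((a + 1 : ℕ) / 2 ^ K) - g t ((a : ℕ) / 2 ^ K)) ω
      = ξ q (g t ((a + 1 : ℕ) / 2 ^ K)) ω - ξ q (g t ((a : ℕ) / 2 ^ K)) ω :=
    ae_all_iff.2 fun a => hξ.sub_ae q _ _
  have h2 : ∀ᵐ ω ∂P, ∀ a : ℕ, ξ p (blockVec (fun l : ℕ => g t (l / 2 ^ K)) n L a) ω
      = blockVec (fun l : ℕ => ξ p (g t (l / 2 ^ K)) ω) n L a :=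
    ae_all_iff.2 fun a => hξ.blockVec_ae p _ n L a
  filter_upwards [h1, h2, hr.grid_ae ht K p, hr.grid_ae ht K q] with ω h1 h2 h3 h4
  rw [sum_gridArea_apply K hn hL, Finset.sum_range]
  refine Finset.sum_congr rfl fun a _ => ?_
  rw [h1, h2, h4 _ a.2.le, h4 _ (Nat.succ_le_of_lt a.2), blockVec_congr h3 hn hL a.2]

/-- Diagonal components vanish. For the others, the Laplacian bound on the increments and the
variance bound on the centred means combine to the sum of squared block lengths, the same order as
for Brownian areas. -/
lemma lintegral_blockArea_le (hξ : IsWhiteNoise P T ξ) (hg : IsKernelMap T g)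
    (hr : IsRepresentedBy P ξ ψ g) {t : ℝ} (ht : t ∈ Icc 0 T) (K : ℕ) {n : ℕ → ℕ}
    (hn : Monotone n) {L : ℕ} (hL : n L ≤ 2 ^ K) (p q : Fin d) {r : ℕ} (hr0 : r ≠ 0) :
    ∫⁻ ω, ‖(∑ l ∈ Finset.range L, gridArea K (n l) (n (l + 1)) (fun x => ψ t x ω)) (p, q)‖ₑ
        ^ (2 * r) ∂P
      ≤ gaussMoment (2 * r) ^ 2
        * ENNReal.ofReal (2 * ∑ l ∈ Finset.range L, ((n (l + 1) - n l : ℝ) / 2 ^ K) ^ 2) ^ r := by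
  by_cases hpq : p = q
  · subst hpq
    have h0 : ∀ ω, (∑ l ∈ Finset.range L, gridArea K (n l) (n (l + 1))
        (fun x => ψ t x ω)) (p, p) = 0 := by
      intro ω
      rw [WithLp.ofLp_sum, Finset.sum_apply]
      exact Finset.sum_eq_zero fun l _ => gridArea_apply_self K (hn (Nat.le_succ l)) _ p
    simp [h0, hr0]
  · rw [lintegral_congr_ae ((blockArea_ae hξ hr ht K hn hL p q).mono fun ω h => by rw [h])]
    refine (hξ.lintegral_bilinear_le (Ne.symm hpq) _ _ (fun _ => 2 * (1 / 2 ^ K))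
      (fun _ => by positivity) (fun c => hg.quadratic_form_le ht K c) hr0).trans ?_
    gcongr
    exact hg.sum_norm_blockVec_sq_le ht K hn hL

/-- A crude bound of the time increments of a block sum of areas. -/
lemma lintegral_blockArea_sub_le (hξ : IsWhiteNoise P T ξ) (hg : IsKernelMap T g)
    (hr : IsRepresentedBy P ξ ψ g) {s t : ℝ} (hs : s ∈ Icc 0 T) (ht : t ∈ Icc 0 T) {ρ : ℝ}
    (hρ : ∀ x ∈ Icc (0 : ℝ) 1, ‖g t x - g s x‖ ^ 2 ≤ ρ) (K : ℕ) {n : ℕ → ℕ}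
    (hn : Monotone n) {L : ℕ} (hL : n L ≤ 2 ^ K) (p q : Fin d) {r : ℕ} (hr0 : r ≠ 0) :
    ∫⁻ ω, ‖(∑ l ∈ Finset.range L, gridArea K (n l) (n (l + 1)) (fun x => ψ t x ω)) (p, q)
        - (∑ l ∈ Finset.range L, gridArea K (n l) (n (l + 1)) (fun x => ψ s x ω)) (p, q)‖ₑ
        ^ (2 * r) ∂P
      ≤ gaussMoment (2 * r) ^ 2 * ENNReal.ofReal (16 * 4 ^ K * ρ) ^ r := by
  by_cases hpq : p = q
  · subst hpq
    have h0 : ∀ s ω, (∑ l ∈ Finset.range L, gridArea K (n l) (n (l + 1))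
        (fun x => ψ s x ω)) (p, p) = 0 := by
      intro s ω
      rw [WithLp.ofLp_sum, Finset.sum_apply]
      exact Finset.sum_eq_zero fun l _ => gridArea_apply_self K (hn (Nat.le_succ l)) _ p
    simp [h0, hr0]
  have hρ0 : 0 ≤ ρ := (sq_nonneg _).trans (hρ 0 (by simp))
  set F : ℝ → Fin (2 ^ K) → Lp ℝ 2 (spaceTime T) := fun t a =>
    g t ((a + 1 : ℕ) / 2 ^ K) - g t ((a : ℕ) / 2 ^ K) with hF
  set H : ℝ → Fin (2 ^ K) → Lp ℝ 2 (spaceTime T) := fun t a =>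
    blockVec (fun l : ℕ => g t (l / 2 ^ K)) n L a with hH
  have hFs : ∀ a, ‖F s a‖ ^ 2 ≤ 1 := fun a => by
    refine (hg.norm_sub_space hs (grid_mem a.2.le).1 (grid_le (Nat.le_succ _))
      (grid_mem (K := K) (b := a + 1) a.2).2).trans ?_
    have := (grid_mem (K := K) (b := a + 1) a.2).2
    have := (grid_mem (K := K) (b := a) a.2.le).1
    linarith
  have hHt : ∀ a, ‖H t a‖ ^ 2 ≤ 1 := fun a => by
    rcases blockVec_cases (fun l : ℕ => g t (l / 2 ^ K)) hn L a with ⟨_, h⟩ | ⟨l, hl, h2, h3, h⟩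
    · simp only [hH]; rw [h]; simp
    · simp only [hH]; rw [h]
      have h4 : n (l + 1) ≤ 2 ^ K := (hn (Nat.succ_le_of_lt hl)).trans hL
      refine (hg.norm_centredMean_sq_le ht h2 h3 h4).trans ?_
      rw [sub_div]
      have := (grid_mem (K := K) h4).2
      have := (grid_mem (K := K) (b := n l) (by omega)).1
      linarith
  have h4ρ : ∀ x ∈ Icc (0 : ℝ) 1, ∀ y ∈ Icc (0 : ℝ) 1,
      ‖(g t x - g s x) - (g t y - g s y)‖ ^ 2 ≤ 4 * ρ := fun x hx y hy => by
    have h1 := norm_sub_le (g t x - g s x) (g t y - g s y)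
    have h2 := norm_nonneg ((g t x - g s x) - (g t y - g s y))
    have h3 := hρ x hx
    have h4 := hρ y hy
    nlinarith [sq_nonneg (‖g t x - g s x‖ - ‖g t y - g s y‖), norm_nonneg (g t x - g s x),
      norm_nonneg (g t y - g s y)]
  have hFd : ∀ a, ‖F t a - F s a‖ ^ 2 ≤ 4 * ρ := fun a => by
    have e : F t a - F s a = (g t ((a + 1 : ℕ) / 2 ^ K) - g s ((a + 1 : ℕ) / 2 ^ K))
      - (g t ((a : ℕ) / 2 ^ K) - g s ((a : ℕ) / 2 ^ K)) := by simp only [hF]; abel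
    rw [e]
    exact h4ρ _ (grid_mem a.2) _ (grid_mem a.2.le)
  have hHd : ∀ a, ‖H t a - H s a‖ ^ 2 ≤ 4 * ρ := fun a => by
    simp only [hH]
    rw [← blockVec_sub]
    rcases blockVec_cases (fun l : ℕ => g t (l / 2 ^ K) - g s (l / 2 ^ K)) hn L a with
      ⟨_, h⟩ | ⟨l, hl, h2, h3, h⟩
    · rw [h]; simpa using hρ0
    · rw [h]
      have h4 : n (l + 1) ≤ 2 ^ K := (hn (Nat.succ_le_of_lt hl)).trans hL
      have e : centredMean (fun l : ℕ => g t (l / 2 ^ K) - g s (l / 2 ^ K)) (n l) (n (l + 1)) a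
          = (1 / 2 : ℝ) • ((g t ((a : ℕ) / 2 ^ K) - g s ((a : ℕ) / 2 ^ K))
            - (g t (n l / 2 ^ K) - g s (n l / 2 ^ K)))
          + (1 / 2 : ℝ) • ((g t ((a + 1 : ℕ) / 2 ^ K) - g s ((a + 1 : ℕ) / 2 ^ K))
            - (g t (n (l + 1) / 2 ^ K) - g s (n (l + 1) / 2 ^ K))) := by
        unfold centredMean; module
      rw [e]
      exact norm_half_add_sq_le (h4ρ _ (grid_mem a.2.le) _ (grid_mem (by omega)))
        (h4ρ _ (grid_mem a.2) _ (grid_mem h4))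
  -- The product rule (F t - F s) H t + F s (H t - H s), written as a single bilinear form over a
  -- disjoint union.
  set f : Fin (2 ^ K) ⊕ Fin (2 ^ K) → Lp ℝ 2 (spaceTime T) :=
    Sum.elim (fun a => F t a - F s a) (F s) with hf
  set h : Fin (2 ^ K) ⊕ Fin (2 ^ K) → Lp ℝ 2 (spaceTime T) :=
    Sum.elim (H t) (fun a => H t a - H s a) with hh
  have hae : ∀ᵐ ω ∂P,
      (∑ l ∈ Finset.range L, gridArea K (n l) (n (l + 1)) (fun x => ψ t x ω)) (p, q)
        - (∑ l ∈ Finset.range L, gridArea K (n l) (n (l + 1)) (fun x => ψ s x ω)) (p, q)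
      = ∑ a, ξ q (f a) ω * ξ p (h a) ω := by
    have h1 : ∀ᵐ ω ∂P, ∀ a, ξ q (F t a - F s a) ω = ξ q (F t a) ω - ξ q (F s a) ω :=
      ae_all_iff.2 fun a => hξ.sub_ae q _ _
    have h2 : ∀ᵐ ω ∂P, ∀ a, ξ p (H t a - H s a) ω = ξ p (H t a) ω - ξ p (H s a) ω :=
      ae_all_iff.2 fun a => hξ.sub_ae p _ _
    filter_upwards [h1, h2, blockArea_ae hξ hr ht K hn hL p q, blockArea_ae hξ hr hs K hn hL p q]
      with ω h1 h2 h3 h4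
    rw [h3, h4, Fintype.sum_sum_type, ← Finset.sum_sub_distrib, ← Finset.sum_add_distrib]
    refine Finset.sum_congr rfl fun a _ => ?_
    simp only [hf, hh, Sum.elim_inl, Sum.elim_inr, h1, h2]
    ring
  rw [lintegral_congr_ae (hae.mono fun ω h => by rw [h])]
  -- Negative correlation is not available for these differences, so the quadratic form is bounded
  -- by Cauchy-Schwarz with the number 2 · 2^K of terms. The resulting growth 4^K is harmless,
  -- because only a small power of this bound is used later.
  refine (hξ.lintegral_bilinear_le (Ne.symm hpq) f h (fun a => 2 * 2 ^ K * ‖f a‖ ^ 2)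
    (fun a => by positivity) (fun c => ?_) hr0).trans ?_
  · have h1 : ‖∑ a, c a • f a‖ ≤ ∑ a, |c a| * ‖f a‖ := by
      refine (norm_sum_le _ _).trans (le_of_eq ?_)
      exact Finset.sum_congr rfl fun a _ => by rw [norm_smul, Real.norm_eq_abs]
    calc _ ≤ (∑ a, |c a| * ‖f a‖) ^ 2 := by gcongr
      _ ≤ (Finset.univ : Finset (Fin (2 ^ K) ⊕ Fin (2 ^ K))).card * ∑ a, (|c a| * ‖f a‖) ^ 2 :=
          sq_sum_le_card_mul_sum_sq
      _ = _ := by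
          rw [Finset.mul_sum]
          refine Finset.sum_congr rfl fun a _ => ?_
          rw [mul_pow, sq_abs]
          simp
          ring
  · gcongr
    rw [Fintype.sum_sum_type]
    simp only [hf, hh, Sum.elim_inl, Sum.elim_inr]
    have h1 : ∀ a, 2 * 2 ^ K * ‖F t a - F s a‖ ^ 2 * ‖H t a‖ ^ 2 ≤ 2 * 2 ^ K * (4 * ρ) * 1 :=
      fun a => by gcongr; exacts [hFd a, hHt a]
    have h2 : ∀ a, 2 * 2 ^ K * ‖F s a‖ ^ 2 * ‖H t a - H s a‖ ^ 2 ≤ 2 * 2 ^ K * 1 * (4 * ρ) :=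
      fun a => by gcongr; exacts [hFs a, hHd a]
    refine (add_le_add (Finset.sum_le_sum fun a _ => h1 a)
      (Finset.sum_le_sum fun a _ => h2 a)).trans (le_of_eq ?_)
    have : (4 : ℝ) ^ K = 2 ^ K * 2 ^ K := by rw [← mul_pow]; norm_num
    simp [this]
    ring

lemma aemeasurable_blockArea (hξ : IsWhiteNoise P T ξ) (hr : IsRepresentedBy P ξ ψ g) {t : ℝ}
    (ht : t ∈ Icc 0 T) (K : ℕ) {n : ℕ → ℕ} (hn : Monotone n) {L : ℕ} (hL : n L ≤ 2 ^ K)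
    (p q : Fin d) : AEMeasurable (fun ω =>
      (∑ l ∈ Finset.range L, gridArea K (n l) (n (l + 1)) (fun x => ψ t x ω)) (p, q)) P := by
  refine AEMeasurable.congr ?_ ((blockArea_ae hξ hr ht K hn hL p q).mono fun ω h => h.symm)
  exact Finset.aemeasurable_fun_sum _ fun a _ => (hξ.aemeasurable q _).mul (hξ.aemeasurable p _)

/-- The two times are estimated separately, with full spatial decay and no gain in t - s; the gain
comes from interpolation with the crude bound. -/
lemma lintegral_blockArea_sub_le' (hξ : IsWhiteNoise P T ξ) (hg : IsKernelMap T g)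
    (hr : IsRepresentedBy P ξ ψ g) {s t : ℝ} (hs : s ∈ Icc 0 T) (ht : t ∈ Icc 0 T) (K : ℕ)
    {n : ℕ → ℕ} (hn : Monotone n) {L : ℕ} (hL : n L ≤ 2 ^ K) (p q : Fin d) {r : ℕ} (hr0 : r ≠ 0) :
    ∫⁻ ω, ‖(∑ l ∈ Finset.range L, gridArea K (n l) (n (l + 1)) (fun x => ψ t x ω)) (p, q)
        - (∑ l ∈ Finset.range L, gridArea K (n l) (n (l + 1)) (fun x => ψ s x ω)) (p, q)‖ₑ
        ^ (2 * r) ∂P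
      ≤ 2 ^ (2 * r) * 2 * gaussMoment (2 * r) ^ 2
        * ENNReal.ofReal (2 * ∑ l ∈ Finset.range L, ((n (l + 1) - n l : ℝ) / 2 ^ K) ^ 2) ^ r := by
  have hm := fun t ht => aemeasurable_blockArea hξ hr (t := t) ht K hn hL p q
  refine (lintegral_mono fun ω => enorm_sub_pow_le _ _ _).trans ?_
  rw [lintegral_const_mul' _ _ (by finiteness),
    lintegral_add_left' ((hm t ht).enorm.pow_const _)]
  refine (mul_le_mul_right (add_le_add (lintegral_blockArea_le hξ hg hr ht K hn hL p q hr0)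
    (lintegral_blockArea_le hξ hg hr hs K hn hL p q hr0)) _).trans (le_of_eq ?_)
  ring

/-- Moments of the space-time increments. -/
lemma lintegral_increment_le (hξ : IsWhiteNoise P T ξ) (hr : IsRepresentedBy P ξ ψ g) {s t x y : ℝ}
    (hs : s ∈ Icc 0 T) (ht : t ∈ Icc 0 T) (hx : x ∈ Icc (0 : ℝ) 1) (hy : y ∈ Icc (0 : ℝ) 1)
    {B : ℝ} (hB : ‖(g t y - g t x) - (g s y - g s x)‖ ^ 2 ≤ B) (p : Fin d) (r : ℕ) :
    ∫⁻ ω, ‖(ψ t y ω - ψ t x ω) p - (ψ s y ω - ψ s x ω) p‖ₑ ^ (2 * r) ∂P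
      ≤ gaussMoment (2 * r) * ENNReal.ofReal B ^ r := by
  have hae : ∀ᵐ ω ∂P, (ψ t y ω - ψ t x ω) p - (ψ s y ω - ψ s x ω) p
      = ξ p ((g t y - g t x) - (g s y - g s x)) ω := by
    filter_upwards [hr t ht x hx p, hr t ht y hy p, hr s hs x hx p, hr s hs y hy p,
      hξ.sub_ae p (g t y - g t x) (g s y - g s x), hξ.sub_ae p (g t y) (g t x),
      hξ.sub_ae p (g s y) (g s x)] with ω h1 h2 h3 h4 h5 h6 h7
    rw [h5, h6, h7, PiLp.sub_apply, PiLp.sub_apply, h1, h2, h3, h4]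
  rw [lintegral_congr_ae (hae.mono fun ω h => by rw [h]), hξ.lintegral_pow, mul_comm, pow_mul]
  gcongr
  rw [← ofReal_norm, ← ENNReal.ofReal_pow (norm_nonneg _)]
  exact ENNReal.ofReal_le_ofReal hB

/-- The smaller of two numbers is at most any weighted geometric mean of them. With small θ this
trades little spatial decay for a power of the time step. -/
lemma le_of_le_of_le_interpolate {Q c : ℝ≥0∞} {B₁ B₂ θ : ℝ} {r : ℕ} (hB₁ : 0 ≤ B₁) (hB₂ : 0 ≤ B₂)
    (hθ : 0 ≤ θ) (hθ' : θ ≤ 1) (h₁ : Q ≤ c * ENNReal.ofReal B₁ ^ r)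
    (h₂ : Q ≤ c * ENNReal.ofReal B₂ ^ r) :
    Q ≤ c * ENNReal.ofReal (B₁ ^ (1 - θ) * B₂ ^ θ) ^ r := by
  rcases le_total B₁ B₂ with h | h
  · refine h₁.trans ?_
    gcongr
    calc B₁ = B₁ ^ (1 - θ) * B₁ ^ θ := by
          rw [← Real.rpow_add_of_nonneg hB₁ (by linarith) hθ]; simp
      _ ≤ _ := by gcongr
  · refine h₂.trans ?_
    gcongr
    calc B₂ = B₂ ^ (1 - θ) * B₂ ^ θ := by
          rw [← Real.rpow_add_of_nonneg hB₂ (by linarith) hθ]; simp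
      _ ≤ _ := by gcongr

/-! ### Dyadic chaining -/

lemma floor_two_mul_cases (u : ℝ) (hu : 0 ≤ u) :
    ⌊2 * u⌋₊ = 2 * ⌊u⌋₊ ∨ ⌊2 * u⌋₊ = 2 * ⌊u⌋₊ + 1 := by
  have h1 := Nat.floor_le hu
  have h2 := Nat.lt_floor_add_one u
  have h3 : 2 * ⌊u⌋₊ ≤ ⌊2 * u⌋₊ := Nat.le_floor (by push_cast; linarith)
  have h4 : ⌊2 * u⌋₊ < 2 * ⌊u⌋₊ + 2 := (Nat.floor_lt (by linarith)).2 (by push_cast; linarith)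
  omega

lemma ceil_two_mul_cases (u : ℝ) (hu : 0 ≤ u) :
    ⌈2 * u⌉₊ = 2 * ⌈u⌉₊ ∨ ⌈2 * u⌉₊ + 1 = 2 * ⌈u⌉₊ := by
  have h1 := Nat.le_ceil u
  have h2 := Nat.ceil_lt_add_one hu
  have h3 : ⌈2 * u⌉₊ ≤ 2 * ⌈u⌉₊ := Nat.ceil_le.2 (by push_cast; linarith)
  have h4 : 2 * ⌈u⌉₊ < ⌈2 * u⌉₊ + 2 := by
    have : (2 * ⌈u⌉₊ : ℝ) < ⌈2 * u⌉₊ + 2 := by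
      have := Nat.le_ceil (2 * u)
      linarith
    exact_mod_cast this
  omega

lemma tendsto_two_pow_inv : Tendsto (fun n : ℕ => (1 : ℝ) / 2 ^ n) atTop (𝓝 0) := by
  have := tendsto_pow_atTop_nhds_zero_of_lt_one (r := (1 / 2 : ℝ)) (by norm_num) (by norm_num)
  simpa [div_pow] using this

lemma tendsto_floor_dyadic {y : ℝ} (hy : 0 ≤ y) :
    Tendsto (fun n : ℕ => (⌊2 ^ n * y⌋₊ : ℝ) / 2 ^ n) atTop (𝓝 y) := by
  have h1 : Tendsto (fun n : ℕ => y - 1 / 2 ^ n) atTop (𝓝 y) := by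
    simpa using tendsto_const_nhds.sub tendsto_two_pow_inv
  refine tendsto_of_tendsto_of_tendsto_of_le_of_le h1 tendsto_const_nhds (fun n => ?_) fun n => ?_
  · have := Nat.lt_floor_add_one (2 ^ n * y)
    simp only
    rw [le_div_iff₀ (by positivity), sub_mul, div_mul_cancel₀ _ (by positivity)]
    linarith
  · have := Nat.floor_le (a := 2 ^ n * y) (by positivity)
    simp only
    rw [div_le_iff₀ (by positivity)]
    linarith

lemma tendsto_ceil_dyadic {y : ℝ} (hy : 0 ≤ y) :
    Tendsto (fun n : ℕ => (⌈2 ^ n * y⌉₊ : ℝ) / 2 ^ n) atTop (𝓝 y) := by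
  have h1 : Tendsto (fun n : ℕ => y + 1 / 2 ^ n) atTop (𝓝 y) := by
    simpa using tendsto_const_nhds.add tendsto_two_pow_inv
  refine tendsto_of_tendsto_of_tendsto_of_le_of_le tendsto_const_nhds h1 (fun n => ?_) fun n => ?_
  · have := Nat.le_ceil (2 ^ n * y)
    simp only
    rw [le_div_iff₀ (by positivity)]
    linarith
  · have := Nat.ceil_lt_add_one (a := 2 ^ n * y) (by positivity)
    simp only
    rw [div_le_iff₀ (by positivity), add_mul, div_mul_cancel₀ _ (by positivity)]
    linarith

/-- A continuous path is controlled by its dyadic increments. -/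
lemma norm_le_of_dyadic_increments {E : Type*} [NormedAddCommGroup E] {T : ℝ} (hT : 0 < T)
    {X : ℝ → E} (hX : ContinuousOn X (Icc 0 T)) (hX0 : X 0 = 0) {A q : ℝ} (hA : 0 ≤ A)
    (hq : 0 ≤ q) (hq1 : q < 1)
    (h : ∀ n j : ℕ, j < 2 ^ n → ‖X ((j + 1 : ℕ) * T / 2 ^ n) - X (j * T / 2 ^ n)‖ ≤ A * q ^ n)
    {t : ℝ} (ht : t ∈ Icc 0 T) : ‖X t‖ ≤ A * (1 / (1 - q)) := by
  set u := t / T with hu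
  have hu0 : 0 ≤ u := div_nonneg ht.1 hT.le
  have hu1 : u ≤ 1 := (div_le_one hT).2 ht.2
  set j : ℕ → ℕ := fun n => ⌊2 ^ n * u⌋₊ with hj
  have hjle : ∀ n, j n ≤ 2 ^ n := fun n => by
    have : (j n : ℝ) ≤ 2 ^ n * u := Nat.floor_le (by positivity)
    have h2 : (j n : ℝ) ≤ 2 ^ n := this.trans (mul_le_of_le_one_right (by positivity) hu1)
    exact_mod_cast h2
  have hb : ∀ n, ‖X (j n * T / 2 ^ n)‖ ≤ A * ∑ l ∈ Finset.range (n + 1), q ^ l := by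
    intro n
    induction n with
    | zero =>
      have h1 := hjle 0
      have h0 := h 0 0 (by norm_num)
      have : j 0 = 0 ∨ j 0 = 1 := by simp only [pow_zero] at h1; omega
      rcases this with h2 | h2
      · simp [h2, hX0, hA]
      · simpa [h2, hX0] using h0
    | succ n ih =>
      rw [Finset.sum_range_succ, mul_add]
      have e : j (n + 1) = ⌊2 * (2 ^ n * u)⌋₊ := by simp only [hj]; congr 1; ring
      have e2 : ((2 * j n : ℕ) : ℝ) * T / 2 ^ (n + 1) = j n * T / 2 ^ n := by
        push_cast; field_simp; ring
      rcases floor_two_mul_cases (2 ^ n * u) (by positivity) with h1 | h1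
      · rw [e, h1, e2]
        have : 0 ≤ A * q ^ (n + 1) := by positivity
        linarith
      · have h2 := h (n + 1) (2 * j n) (by
          have := hjle (n + 1)
          rw [e, h1] at this
          simp only [hj]; omega)
        rw [e2] at h2
        rw [e, h1]
        have := norm_sub_norm_le (X ((2 * j n + 1 : ℕ) * T / 2 ^ (n + 1))) (X (j n * T / 2 ^ n))
        simp only [hj] at *
        linarith
  have hsum : ∀ n, ∑ l ∈ Finset.range (n + 1), q ^ l ≤ 1 / (1 - q) := fun n => by
    rw [one_div, ← tsum_geometric_of_lt_one hq hq1]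
    exact (summable_geometric_of_lt_one hq hq1).sum_le_tsum _ fun l _ => pow_nonneg hq l
  have hlim : Tendsto (fun n : ℕ => (j n : ℝ) * T / 2 ^ n) atTop (𝓝[Icc 0 T] t) := by
    refine tendsto_nhdsWithin_iff.2 ⟨?_, Eventually.of_forall fun n => ?_⟩
    · have := (tendsto_floor_dyadic hu0).mul_const T
      rw [hu, div_mul_cancel₀ _ hT.ne'] at this
      refine this.congr fun n => ?_
      simp only [hj]; ring
    · refine ⟨by positivity, ?_⟩
      rw [div_le_iff₀ (by positivity), mul_comm]
      have : (j n : ℝ) ≤ 2 ^ n := by exact_mod_cast hjle n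
      gcongr
  refine le_of_tendsto ((hX t ht).tendsto.comp hlim).norm (Eventually.of_forall fun n => ?_)
  exact (hb n).trans (by have := hsum n; gcongr)

/-- The constant of the dyadic chaining argument. -/
def chainConst (β : ℝ) : ℝ := 1 + 2 / (1 - (1 / 2 : ℝ) ^ (β / 2))

lemma half_rpow_lt_one {β : ℝ} (hβ : 0 < β) : (1 / 2 : ℝ) ^ β < 1 :=
  Real.rpow_lt_one (by norm_num) (by norm_num) hβ

lemma chainConst_pos {β : ℝ} (hβ : 0 < β) : 0 < chainConst β := by
  have := half_rpow_lt_one (half_pos hβ)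
  have : 0 < 1 - (1 / 2 : ℝ) ^ (β / 2) := by linarith
  unfold chainConst
  positivity

/-- An almost additive function of two variables is controlled by its values on dyadic
intervals. -/
lemma norm_le_of_dyadic_intervals {E : Type*} [NormedAddCommGroup E] {β η κ : ℝ} (hβ : 0 < β)
    (hη : 0 ≤ η) (hκ : 0 ≤ κ) {h : ℝ → ℝ → E}
    (hcont : ContinuousOn (fun p : ℝ × ℝ => h p.1 p.2) simplex)
    (h0 : ∀ x ∈ Icc (0 : ℝ) 1, h x x = 0)
    (hadd : ∀ x z y : ℝ, 0 ≤ x → x ≤ z → z ≤ y → y ≤ 1 →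
      ‖h x y‖ ≤ ‖h x z‖ + ‖h z y‖ + κ * ((z - x) ^ (β / 2) * (y - z) ^ (β / 2)))
    (hd : ∀ m i : ℕ, i < 2 ^ m → ‖h (i / 2 ^ m) ((i + 1 : ℕ) / 2 ^ m)‖ ≤ η * ((1 : ℝ) / 2 ^ m) ^ β)
    {x y : ℝ} (hx : 0 ≤ x) (hxy : x < y) (hy : y ≤ 1) :
    ‖h x y‖ ≤ (η + κ) * chainConst β * (y - x) ^ β := by
  set ℓ := y - x with hℓ
  have hℓ0 : 0 < ℓ := by linarith
  have hy0 : 0 ≤ y := by linarith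
  obtain ⟨m, hm1, hm2⟩ : ∃ m : ℕ, (1 : ℝ) / 2 ^ m ≤ ℓ ∧ ℓ < 2 / 2 ^ m := by
    have hex : ∃ m : ℕ, (1 : ℝ) / 2 ^ m ≤ ℓ :=
      (tendsto_two_pow_inv.eventually (ge_mem_nhds hℓ0)).exists
    classical
    refine ⟨Nat.find hex, Nat.find_spec hex, ?_⟩
    rcases hm : Nat.find hex with _ | m
    · norm_num; linarith
    · have h1 := Nat.find_min hex (m := m) (by omega)
      rw [pow_succ]
      rw [not_le] at h1
      exact h1.trans_eq (by field_simp)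
  -- c and f mark the largest interval with end points of level n inside [x,y]. It exists for n ≥ m,
  -- is at most one cell for n = m, and passing from n to n + 1 adds at most one cell at each end.
  set c : ℕ → ℕ := fun n => ⌈2 ^ n * x⌉₊ with hc
  set f : ℕ → ℕ := fun n => ⌊2 ^ n * y⌋₊ with hf
  have hcf : ∀ n, m ≤ n → c n ≤ f n := fun n hn => by
    refine Nat.le_floor ?_
    have h1 : (c n : ℝ) < 2 ^ n * x + 1 := Nat.ceil_lt_add_one (by positivity)
    have h2 : (1 : ℝ) ≤ 2 ^ n * ℓ := by
      calc (1 : ℝ) = 2 ^ m * (1 / 2 ^ m) := by field_simp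
        _ ≤ 2 ^ n * ℓ := by gcongr; norm_num
    rw [hℓ, mul_sub] at h2
    linarith
  have hf1 : ∀ n, f n ≤ 2 ^ n := fun n => by
    have : (f n : ℝ) ≤ 2 ^ n * y := Nat.floor_le (by positivity)
    have h2 : (f n : ℝ) ≤ 2 ^ n := this.trans (mul_le_of_le_one_right (by positivity) hy)
    exact_mod_cast h2
  have hxc : ∀ n, x ≤ (c n : ℝ) / 2 ^ n := fun n => by
    rw [le_div_iff₀ (by positivity), mul_comm]
    exact Nat.le_ceil _
  have hfy : ∀ n, (f n : ℝ) / 2 ^ n ≤ y := fun n => by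
    rw [div_le_iff₀ (by positivity), mul_comm]
    exact Nat.floor_le (by positivity)
  have hcf' : ∀ n, m ≤ n → (c n : ℝ) / 2 ^ n ≤ (f n : ℝ) / 2 ^ n := fun n hn => grid_le (hcf n hn)
  -- One half of the exponent β becomes the length factor Λ, the other half the geometric decay in
  -- n. The additivity defect, with its two factors of exponent β/2, has the same mixed form.
  set q := (1 / 2 : ℝ) ^ (β / 2) with hq
  have hq0 : 0 < q := Real.rpow_pos_of_pos (by norm_num) _
  have hq1 : q < 1 := half_rpow_lt_one (half_pos hβ)
  have hqn : ∀ n : ℕ, ((1 : ℝ) / 2 ^ n) ^ (β / 2) = q ^ n := fun n => by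
    rw [hq, Real.rpow_pow_comm (by norm_num), div_pow, one_pow]
  have hsplit : ∀ z : ℝ, 0 ≤ z → z ^ β = z ^ (β / 2) * z ^ (β / 2) := fun z hz => by
    rw [← Real.rpow_add_of_nonneg hz (by linarith) (by linarith), add_halves]
  set Λ := ℓ ^ (β / 2) with hΛ
  have hΛ0 : 0 ≤ Λ := Real.rpow_nonneg hℓ0.le _
  have hqΛ : ∀ n, m ≤ n → q ^ n ≤ Λ := fun n hn => by
    rw [← hqn]
    refine Real.rpow_le_rpow (by positivity) (le_trans ?_ hm1) (by linarith)
    gcongr; norm_num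
  have hleft : ∀ n, m ≤ n → ‖h (c (n + 1) / 2 ^ (n + 1)) (c n / 2 ^ n)‖ ≤ η * (Λ * q ^ (n + 1))
      ∧ (c (n + 1) : ℝ) / 2 ^ (n + 1) ≤ c n / 2 ^ n
      ∧ (c n : ℝ) / 2 ^ n - c (n + 1) / 2 ^ (n + 1) ≤ 1 / 2 ^ (n + 1) := fun n hn => by
    have e : c (n + 1) = ⌈2 * (2 ^ n * x)⌉₊ := by simp only [hc]; congr 1; ring
    have e2 : ((2 * c n : ℕ) : ℝ) / 2 ^ (n + 1) = c n / 2 ^ n := by push_cast; field_simp; ring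
    have hcn := (hcf n hn).trans (hf1 n)
    rcases ceil_two_mul_cases (2 ^ n * x) (by positivity) with h1 | h1
    · rw [e, h1, e2]
      rw [h0 _ (grid_mem hcn)]
      refine ⟨by rw [norm_zero]; positivity, le_rfl, by rw [sub_self]; positivity⟩
    · rw [← e] at h1
      have h1' : 2 * c n = c (n + 1) + 1 := h1.symm
      rw [← e2, h1']
      refine ⟨(hd (n + 1) (c (n + 1)) (by rw [pow_succ]; omega)).trans ?_, grid_le (Nat.le_succ _),
        le_of_eq (by push_cast; ring)⟩
      rw [hsplit _ (by positivity), hqn]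
      have := hqΛ (n + 1) (by omega)
      gcongr
  have hright : ∀ n, m ≤ n → ‖h (f n / 2 ^ n) (f (n + 1) / 2 ^ (n + 1))‖ ≤ η * (Λ * q ^ (n + 1))
      ∧ (f n : ℝ) / 2 ^ n ≤ f (n + 1) / 2 ^ (n + 1)
      ∧ (f (n + 1) : ℝ) / 2 ^ (n + 1) - f n / 2 ^ n ≤ 1 / 2 ^ (n + 1) := fun n hn => by
    have e : f (n + 1) = ⌊2 * (2 ^ n * y)⌋₊ := by simp only [hf]; congr 1; ring
    have e2 : ((2 * f n : ℕ) : ℝ) / 2 ^ (n + 1) = f n / 2 ^ n := by push_cast; field_simp; ring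
    rcases floor_two_mul_cases (2 ^ n * y) (by positivity) with h1 | h1
    · rw [e, h1, e2, h0 _ (grid_mem (hf1 n))]
      refine ⟨by rw [norm_zero]; positivity, le_rfl, by rw [sub_self]; positivity⟩
    · rw [← e] at h1
      have h1' : f (n + 1) = 2 * f n + 1 := h1
      have := hf1 (n + 1)
      rw [← e2, h1']
      refine ⟨(hd (n + 1) (2 * f n) (by omega)).trans ?_, grid_le (Nat.le_succ _),
        le_of_eq (by push_cast; ring)⟩
      rw [hsplit _ (by positivity), hqn]
      have := hqΛ (n + 1) (by omega)
      gcongr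
  have hstep : ∀ n, m ≤ n → ‖h (c (n + 1) / 2 ^ (n + 1)) (f (n + 1) / 2 ^ (n + 1))‖
      ≤ ‖h (c n / 2 ^ n) (f n / 2 ^ n)‖ + 2 * (η + κ) * (Λ * q ^ (n + 1)) := fun n hn => by
    obtain ⟨l1, l2, l3⟩ := hleft n hn
    obtain ⟨r1, r2, r3⟩ := hright n hn
    have h1 := hadd _ _ _ ((hx.trans (hxc (n + 1)))) l2 ((hcf' n hn).trans r2)
      ((hfy (n + 1)).trans hy)
    have h2 := hadd _ _ _ ((hx.trans (hxc n))) (hcf' n hn) r2 ((hfy (n + 1)).trans hy)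
    have h3 : ((c n : ℝ) / 2 ^ n - c (n + 1) / 2 ^ (n + 1)) ^ (β / 2) ≤ q ^ (n + 1) := by
      rw [← hqn]; exact Real.rpow_le_rpow (by linarith) l3 (by linarith)
    have h4 : ((f (n + 1) : ℝ) / 2 ^ (n + 1) - c n / 2 ^ n) ^ (β / 2) ≤ Λ :=
      Real.rpow_le_rpow (by linarith [hcf' n hn])
        (by linarith [hfy (n + 1), hxc n]) (by linarith)
    have h5 : ((f (n + 1) : ℝ) / 2 ^ (n + 1) - f n / 2 ^ n) ^ (β / 2) ≤ q ^ (n + 1) := by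
      rw [← hqn]; exact Real.rpow_le_rpow (by linarith) r3 (by linarith)
    have h6 : ((f n : ℝ) / 2 ^ n - c n / 2 ^ n) ^ (β / 2) ≤ Λ :=
      Real.rpow_le_rpow (by linarith [hcf' n hn])
        (by linarith [hfy n, hxc n]) (by linarith)
    have h7 : κ * (((c n : ℝ) / 2 ^ n - c (n + 1) / 2 ^ (n + 1)) ^ (β / 2)
        * ((f (n + 1) : ℝ) / 2 ^ (n + 1) - c n / 2 ^ n) ^ (β / 2)) ≤ κ * (q ^ (n + 1) * Λ) := by
      gcongr
      exact Real.rpow_nonneg (by linarith [hcf' n hn]) _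
    have h8 : κ * (((f n : ℝ) / 2 ^ n - c n / 2 ^ n) ^ (β / 2)
        * ((f (n + 1) : ℝ) / 2 ^ (n + 1) - f n / 2 ^ n) ^ (β / 2)) ≤ κ * (Λ * q ^ (n + 1)) := by
      gcongr
    nlinarith
  have hbase : ‖h (c m / 2 ^ m) (f m / 2 ^ m)‖ ≤ η * (Λ * Λ) := by
    have h1 : f m < c m + 2 := by
      have h2 : (f m : ℝ) ≤ 2 ^ m * y := Nat.floor_le (by positivity)
      have h3 : 2 ^ m * x ≤ (c m : ℝ) := Nat.le_ceil _
      have h4 : 2 ^ m * ℓ < 2 := by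
        rw [lt_div_iff₀ (by positivity)] at hm2; linarith
      have : (f m : ℝ) < c m + 2 := by rw [hℓ, mul_sub] at h4; linarith
      exact_mod_cast this
    have h2 := hcf m le_rfl
    have h3 : f m = c m ∨ f m = c m + 1 := by omega
    rcases h3 with h3 | h3
    · rw [h3, h0 _ (grid_mem (h3 ▸ hf1 m)), norm_zero]; positivity
    · rw [h3]
      refine (hd m (c m) (by have := hf1 m; omega)).trans ?_
      rw [hsplit _ (by positivity), hqn]
      have := hqΛ m le_rfl
      gcongr
  have hq1' : 0 < 1 - q := by linarith
  -- The current norm plus the geometric tail of all steps still to come does not increase with n.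
  have hpot : ∀ n, m ≤ n → ‖h (c n / 2 ^ n) (f n / 2 ^ n)‖
      + 2 * (η + κ) * Λ * (q ^ (n + 1) / (1 - q))
      ≤ η * (Λ * Λ) + 2 * (η + κ) * Λ * (q ^ (m + 1) / (1 - q)) := fun n hn => by
    induction n, hn using Nat.le_induction with
    | base => linarith
    | succ n hn ih =>
      have h1 := hstep n hn
      have h2 : q ^ (n + 1) / (1 - q) = q ^ (n + 1) + q ^ (n + 1 + 1) / (1 - q) := by
        field_simp; ring
      rw [h2] at ih
      nlinarith
  have hbound : ∀ n, m ≤ n → ‖h (c n / 2 ^ n) (f n / 2 ^ n)‖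
      ≤ (η + κ) * chainConst β * ℓ ^ β := fun n hn => by
    have h1 := hpot n hn
    have h2 : 0 ≤ 2 * (η + κ) * Λ * (q ^ (n + 1) / (1 - q)) := by positivity
    have h3 : q ^ (m + 1) ≤ Λ := hqΛ (m + 1) (by omega)
    have h4 : 2 * (η + κ) * Λ * (q ^ (m + 1) / (1 - q)) ≤ 2 * (η + κ) * Λ * (Λ / (1 - q)) := by
      gcongr
    rw [hsplit ℓ hℓ0.le]
    unfold chainConst
    have h5 : (η + κ) * (1 + 2 / (1 - q)) * (Λ * Λ)
        = (η + κ) * (Λ * Λ) + 2 * (η + κ) * Λ * (Λ / (1 - q)) := by ring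
    rw [h5]
    nlinarith [mul_nonneg hκ (mul_nonneg hΛ0 hΛ0)]
  have hmem : ∀ n, m ≤ n → ((c n : ℝ) / 2 ^ n, (f n : ℝ) / 2 ^ n) ∈ simplex := fun n hn =>
    ⟨hx.trans (hxc n), hcf' n hn, (hfy n).trans hy⟩
  have hlim : Tendsto (fun n : ℕ => ((c n : ℝ) / 2 ^ n, (f n : ℝ) / 2 ^ n)) atTop
      (𝓝[simplex] (x, y)) := by
    refine tendsto_nhdsWithin_iff.2 ⟨?_, eventually_atTop.2 ⟨m, hmem⟩⟩
    exact (tendsto_ceil_dyadic hx).prodMk_nhds (tendsto_floor_dyadic hy0)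
  have := (hcont (x, y) ⟨hx, hxy.le, hy⟩).tendsto.comp hlim
  exact le_of_tendsto this.norm (eventually_atTop.2 ⟨m, fun n hn => hbound n hn⟩)

/-! ### Elementary tensors -/

section Tensor

variable {d : ℕ}

lemma tensor_apply (u v : Vec d) (p : Fin d × Fin d) : tensor u v p = u p.1 * v p.2 := rfl

lemma norm_tensor (u v : Vec d) : ‖tensor u v‖ = ‖u‖ * ‖v‖ := by
  have h : ‖tensor u v‖ ^ 2 = (‖u‖ * ‖v‖) ^ 2 := by
    rw [mul_pow, EuclideanSpace.norm_sq_eq, EuclideanSpace.norm_sq_eq, EuclideanSpace.norm_sq_eq,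
      Finset.sum_mul_sum, ← Finset.univ_product_univ, Finset.sum_product]
    simp_rw [tensor_apply, norm_mul, mul_pow]
  exact (pow_left_inj₀ (norm_nonneg _) (by positivity) two_ne_zero).1 h

variable (d) in
/-- The elementary tensor as a continuous bilinear map. -/
def tensorL : Vec d →L[ℝ] Vec d →L[ℝ] Tens d :=
  LinearMap.mkContinuous₂
    (LinearMap.mk₂ ℝ tensor
      (fun u u' v => by ext p; simp [tensor_apply, add_mul])
      (fun c u v => by ext p; simp [tensor_apply, mul_assoc])
      (fun u v v' => by ext p; simp [tensor_apply, mul_add])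
      (fun c u v => by ext p; simp [tensor_apply, mul_left_comm])) 1
    (fun u v => by simp [norm_tensor])

lemma tensorL_apply (u v : Vec d) : tensorL d u v = tensor u v := rfl

lemma tensor_sub_left (u u' v : Vec d) : tensor (u - u') v = tensor u v - tensor u' v := by
  simp [← tensorL_apply]

lemma tensor_sub_right (u v v' : Vec d) : tensor u (v - v') = tensor u v - tensor u v' := by
  simp [← tensorL_apply]

lemma tensor_add_left (u u' v : Vec d) : tensor (u + u') v = tensor u v + tensor u' v := by
  simp [← tensorL_apply]

lemma tensor_smul_left (c : ℝ) (u v : Vec d) : tensor (c • u) v = c • tensor u v := by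
  simp [← tensorL_apply]

lemma tensor_smul_right (c : ℝ) (u v : Vec d) : tensor u (c • v) = c • tensor u v := by
  simp [← tensorL_apply]

lemma tensor_zero_left (v : Vec d) : tensor 0 v = 0 := by simp [← tensorL_apply]

lemma tensor_zero_right (u : Vec d) : tensor u 0 = 0 := by simp [← tensorL_apply]

lemma continuous_tensor : Continuous fun q : Vec d × Vec d => tensor q.1 q.2 :=
  (tensorL d).continuous₂

end Tensor

/-! ### Hölder norms -/

section Holder

variable {E : Type*} [NormedAddCommGroup E] {α C : ℝ} {A B : ℝ → ℝ → E}

lemma holderNorm_le (h : ∀ x y : ℝ, 0 ≤ x → x < y → y ≤ 1 → ‖A x y‖ ≤ C * (y - x) ^ α) :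
    holderNorm α A ≤ ENNReal.ofReal C := by
  refine iSup_le fun x => iSup_le fun y => iSup_le fun ⟨h0, h1, h2⟩ => ?_
  refine ENNReal.ofReal_le_ofReal ?_
  have : 0 < (y - x) ^ α := Real.rpow_pos_of_pos (by linarith) _
  rw [div_le_iff₀ this]
  exact h x y h0 h1 h2

lemma le_holderNorm {x y : ℝ} (hx : 0 ≤ x) (hxy : x < y) (hy : y ≤ 1) :
    ENNReal.ofReal (‖A x y‖ / (y - x) ^ α) ≤ holderNorm α A :=
  le_iSup₂_of_le x y (le_iSup_of_le (⟨hx, hxy, hy⟩ : 0 ≤ x ∧ x < y ∧ y ≤ 1) le_rfl)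

lemma norm_le_of_holderNorm_le (hC : 0 ≤ C) (h : holderNorm α A ≤ ENNReal.ofReal C) {x y : ℝ}
    (hx : 0 ≤ x) (hxy : x < y) (hy : y ≤ 1) : ‖A x y‖ ≤ C * (y - x) ^ α := by
  have h1 := (le_holderNorm hx hxy hy).trans h
  rw [ENNReal.ofReal_le_ofReal_iff hC, div_le_iff₀ (Real.rpow_pos_of_pos (by linarith) _)] at h1
  exact h1

lemma holderNorm_congr (h : ∀ x y : ℝ, 0 ≤ x → x < y → y ≤ 1 → ‖A x y‖ = ‖B x y‖) :
    holderNorm α A = holderNorm α B := by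
  unfold holderNorm
  refine iSup_congr fun x => iSup_congr fun y => iSup_congr fun ⟨h0, h1, h2⟩ => ?_
  rw [h x y h0 h1 h2]

lemma holderNorm_add_le : holderNorm α (fun x y => A x y + B x y)
    ≤ holderNorm α A + holderNorm α B := by
  refine iSup_le fun x => iSup_le fun y => iSup_le fun ⟨h0, h1, h2⟩ => ?_
  refine le_trans ?_ (add_le_add (le_holderNorm h0 h1 h2) (le_holderNorm h0 h1 h2))
  have : 0 < (y - x) ^ α := Real.rpow_pos_of_pos (by linarith) _
  rw [← ENNReal.ofReal_add (by positivity) (by positivity), ← add_div]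
  refine ENNReal.ofReal_le_ofReal ?_
  gcongr
  exact norm_add_le _ _

lemma holderNorm_sub_le_sub_add_sub (D : ℝ → ℝ → E) : holderNorm α (fun x y => A x y - D x y)
    ≤ holderNorm α (fun x y => A x y - B x y) + holderNorm α (fun x y => B x y - D x y) := by
  refine le_trans (le_of_eq (holderNorm_congr fun x y _ _ _ => ?_)) holderNorm_add_le
  rw [sub_add_sub_cancel]

lemma holderNorm_sub_comm : holderNorm α (fun x y => A x y - B x y)
    = holderNorm α (fun x y => B x y - A x y) :=
  holderNorm_congr fun _ _ _ _ _ => norm_sub_rev _ _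

lemma holderNorm_sub_self : holderNorm α (fun x y => A x y - A x y) = 0 := by
  refine le_antisymm ?_ zero_le
  have := holderNorm_le (α := α) (C := 0) (A := fun x y => A x y - A x y)
    (fun x y _ _ _ => by simp)
  simpa using this

end Holder

section RoughDist

variable {d : ℕ} {α T : ℝ} {A B D : RoughData d}

lemma roughDist_triangle : roughDist α A D ≤ roughDist α A B + roughDist α B D := by
  unfold roughDist
  have h1 := edist_triangle A.init B.init D.init
  have h2 := holderNorm_sub_le_sub_add_sub (α := α) (A := A.fst) (B := B.fst) D.fst
  have h3 := holderNorm_sub_le_sub_add_sub (α := 2 * α) (A := A.snd) (B := B.snd) D.snd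
  calc _ ≤ _ := add_le_add (add_le_add h1 h2) h3
    _ = _ := by ring

lemma roughDist_comm : roughDist α A B = roughDist α B A := by
  unfold roughDist
  rw [edist_comm, holderNorm_sub_comm, holderNorm_sub_comm (A := A.snd)]

lemma roughDist_self : roughDist α A A = 0 := by
  unfold roughDist
  rw [edist_self, holderNorm_sub_self, holderNorm_sub_self]; simp

lemma roughDist_le_pathDist {A B : ℝ → RoughData d} {t : ℝ} (ht : t ∈ Icc 0 T) :
    roughDist α (A t) (B t) ≤ pathDist α T A B := by
  unfold roughDist pathDist levelDist
  rw [add_assoc]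
  refine add_le_add ?_ (add_le_add ?_ ?_)
  · exact le_iSup₂ (f := fun t (_ : t ∈ Icc 0 T) => edist (A t).init (B t).init) t ht
  · exact le_iSup₂ (f := fun t (_ : t ∈ Icc 0 T) =>
      holderNorm α (fun x y => (A t).fst x y - (B t).fst x y)) t ht
  · exact le_iSup₂ (f := fun t (_ : t ∈ Icc 0 T) =>
      holderNorm (2 * α) (fun x y => (A t).snd x y - (B t).snd x y)) t ht

end RoughDist

/-! ### Natural lifts of Lipschitz paths -/

/-- `b` is Lipschitz on `[0,1]` with constant `K`. -/
def IsLipschitzPath {d : ℕ} (K : ℝ) (b : ℝ → Vec d) : Prop :=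
  ∀ x y : ℝ, 0 ≤ x → x ≤ y → y ≤ 1 → ‖b y - b x‖ ≤ K * (y - x)

namespace IsLipschitzPath

variable {d : ℕ} {K L ε : ℝ} {b c : ℝ → Vec d}

lemma nonneg (hb : IsLipschitzPath K b) : 0 ≤ K := by
  have := (norm_nonneg _).trans (hb 0 1 le_rfl zero_le_one le_rfl)
  linarith

lemma lipschitzOnWith (hb : IsLipschitzPath K b) : LipschitzOnWith K.toNNReal b (Icc 0 1) := by
  refine LipschitzOnWith.of_dist_le_mul fun x hx y hy => ?_
  rw [Real.coe_toNNReal _ hb.nonneg, dist_eq_norm, Real.dist_eq]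
  rcases le_total x y with h | h
  · rw [norm_sub_rev, abs_sub_comm, abs_of_nonneg (by linarith)]
    exact hb x y hx.1 h hy.2
  · rw [abs_of_nonneg (by linarith)]
    exact hb y x hy.1 h hx.2

lemma ae_differentiableAt (hb : IsLipschitzPath K b) :
    ∀ᵐ z, z ∈ Ioo (0 : ℝ) 1 → DifferentiableAt ℝ b z := by
  filter_upwards [hb.lipschitzOnWith.ae_differentiableWithinAt_of_mem_real] with z hz hz1
  exact (hz (Ioo_subset_Icc_self hz1)).differentiableAt (Icc_mem_nhds hz1.1 hz1.2)

lemma norm_deriv_le (hb : IsLipschitzPath K b) {z : ℝ} (hz : z ∈ Ioo (0 : ℝ) 1) :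
    ‖deriv b z‖ ≤ K := by
  have := norm_deriv_le_of_lipschitzOn (Icc_mem_nhds hz.1 hz.2) hb.lipschitzOnWith
  rwa [Real.coe_toNNReal _ hb.nonneg] at this

lemma continuousOn (hb : IsLipschitzPath K b) : ContinuousOn b (Icc 0 1) :=
  hb.lipschitzOnWith.continuousOn

lemma ae_mem_Ioo {x y : ℝ} (hx : 0 ≤ x) (hy : y ≤ 1) :
    ∀ᵐ z ∂volume.restrict (Ioc x y), z ∈ Ioo (0 : ℝ) 1 := by
  rw [ae_restrict_iff' measurableSet_Ioc]
  have : ∀ᵐ z : ℝ, z ≠ 1 := by simp [ae_iff]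
  filter_upwards [this] with z hz h
  exact ⟨hx.trans_lt h.1, lt_of_le_of_ne (h.2.trans hy) hz⟩

lemma intervalIntegrable_deriv (hb : IsLipschitzPath K b) {x y : ℝ} (hx : 0 ≤ x) (hxy : x ≤ y)
    (hy : y ≤ 1) : IntervalIntegrable (deriv b) volume x y := by
  rw [intervalIntegrable_iff_integrableOn_Ioc_of_le hxy]
  refine Measure.integrableOn_of_bounded (M := K) (by simp)
    (stronglyMeasurable_deriv b).aestronglyMeasurable ?_
  filter_upwards [ae_mem_Ioo hx hy] with z hz using hb.norm_deriv_le hz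

lemma intervalIntegrable_tensor (hb : IsLipschitzPath K b) (hc : ContinuousOn c (Icc 0 1))
    {x y : ℝ} (hx : 0 ≤ x) (hxy : x ≤ y) (hy : y ≤ 1) :
    IntervalIntegrable (fun z => tensor (c z) (deriv b z)) volume x y := by
  have hcm : ContinuousOn c (Icc x y) := hc.mono (Icc_subset_Icc hx hy)
  obtain ⟨M, hM⟩ := isCompact_Icc.exists_bound_of_continuousOn hcm
  rw [intervalIntegrable_iff_integrableOn_Ioc_of_le hxy]
  refine Integrable.of_bound ?_ (M * K) ?_
  · have h1 : AEStronglyMeasurable c (volume.restrict (Ioc x y)) :=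
      (hcm.mono Ioc_subset_Icc_self).aestronglyMeasurable measurableSet_Ioc
    exact continuous_tensor.comp_aestronglyMeasurable
      (h1.prodMk (stronglyMeasurable_deriv b).aestronglyMeasurable)
  · filter_upwards [ae_mem_Ioo hx hy, ae_restrict_mem measurableSet_Ioc] with z hz hz2
    rw [norm_tensor]
    exact mul_le_mul (hM z (Ioc_subset_Icc_self hz2)) (hb.norm_deriv_le hz) (norm_nonneg _)
      ((norm_nonneg _).trans (hM z (Ioc_subset_Icc_self hz2)))

lemma integral_deriv (hb : IsLipschitzPath K b) {x y : ℝ} (hx : 0 ≤ x) (hxy : x ≤ y)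
    (hy : y ≤ 1) : ∫ z in x..y, deriv b z = b y - b x := by
  ext i
  have hl : LipschitzOnWith K.toNNReal (fun z => b z i) (uIcc x y) := by
    rw [uIcc_of_le hxy]
    have := (LipschitzWith.of_dist_le_mul (K := 1) (f := fun v : Vec d => v i) (fun u v => by
      rw [NNReal.coe_one, one_mul, dist_eq_norm, dist_eq_norm]
      exact PiLp.norm_apply_le (u - v) i)).comp_lipschitzOnWith
      (hb.lipschitzOnWith.mono (Icc_subset_Icc hx hy))
    rwa [one_mul] at this
  have h1 := hl.absolutelyContinuousOnInterval.integral_deriv_eq_sub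
  have h2 : (∫ z in x..y, deriv b z) i = ∫ z in x..y, deriv b z i :=
    ((EuclideanSpace.proj i : Vec d →L[ℝ] ℝ).intervalIntegral_comp_comm
      (hb.intervalIntegrable_deriv hx hxy hy)).symm
  rw [h2, PiLp.sub_apply, ← h1]
  refine intervalIntegral.integral_congr_ae ?_
  rw [uIoc_of_le hxy]
  have h3 := (ae_restrict_iff' measurableSet_Ioc).1 (ae_mem_Ioo hx hy)
  filter_upwards [hb.ae_differentiableAt, h3] with z hz hz2 hz3
  have := (hz (hz2 hz3)).hasDerivAt
  exact (((EuclideanSpace.proj i : Vec d →L[ℝ] ℝ).hasFDerivAt.comp_hasDerivAt z this).deriv).symm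

lemma chen_snd (hb : IsLipschitzPath K b) {x z y : ℝ} (hx : 0 ≤ x) (hxz : x ≤ z) (hzy : z ≤ y)
    (hy : y ≤ 1) : (naturalLift b).snd x y
      = (naturalLift b).snd x z + (naturalLift b).snd z y + tensor (b z - b x) (b y - b z) := by
  simp only [naturalLift]
  have hc : ∀ v, ContinuousOn (fun w => b w - v) (Icc 0 1) := fun v =>
    hb.continuousOn.sub continuousOn_const
  rw [← intervalIntegral.integral_add_adjacent_intervals
    (hb.intervalIntegrable_tensor (hc (b x)) hx hxz (hzy.trans hy))
    (hb.intervalIntegrable_tensor (hc (b x)) (hx.trans hxz) hzy hy), add_assoc]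
  congr 1
  rw [← hb.integral_deriv (hx.trans hxz) hzy hy]
  have h1 : tensor (b z - b x) (∫ w in z..y, deriv b w)
      = ∫ w in z..y, tensor (b z - b x) (deriv b w) :=
    ((tensorL d (b z - b x)).intervalIntegral_comp_comm
      (hb.intervalIntegrable_deriv (hx.trans hxz) hzy hy)).symm
  rw [h1, ← intervalIntegral.integral_add
    (hb.intervalIntegrable_tensor (hc (b z)) (hx.trans hxz) hzy hy)
    (hb.intervalIntegrable_tensor continuousOn_const (hx.trans hxz) hzy hy)]
  refine intervalIntegral.integral_congr fun w _ => ?_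
  rw [← tensor_add_left, add_comm, sub_add_sub_cancel']

lemma norm_integral_tensor_le {h : ℝ → Vec d} (hb : IsLipschitzPath K b) (hL : 0 ≤ L) {x y : ℝ}
    (hx : 0 ≤ x) (hxy : x ≤ y) (hy : y ≤ 1) (hh : ∀ z ∈ Icc x y, ‖h z‖ ≤ L * (z - x)) :
    ‖∫ z in x..y, tensor (h z) (deriv b z)‖ ≤ L * K * (y - x) ^ 2 := by
  have : ‖∫ z in x..y, tensor (h z) (deriv b z)‖ ≤ (L * (y - x) * K) * |y - x| := by
    refine intervalIntegral.norm_integral_le_of_norm_le_const_ae ?_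
    rw [uIoc_of_le hxy]
    filter_upwards [(ae_restrict_iff' measurableSet_Ioc).1 (ae_mem_Ioo hx hy)] with z hz hz1
    rw [norm_tensor]
    have h1 := hh z (Ioc_subset_Icc_self hz1)
    have h2 := hb.norm_deriv_le (hz hz1)
    have h3 : L * (z - x) ≤ L * (y - x) := by have := hz1.2; gcongr
    exact mul_le_mul (h1.trans h3) h2 (norm_nonneg _) (mul_nonneg hL (by linarith))
  rw [abs_of_nonneg (by linarith)] at this
  exact this.trans_eq (by ring)

lemma norm_snd_le (hb : IsLipschitzPath K b) {x y : ℝ} (hx : 0 ≤ x) (hxy : x ≤ y) (hy : y ≤ 1) :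
    ‖(naturalLift b).snd x y‖ ≤ K * K * (y - x) ^ 2 :=
  hb.norm_integral_tensor_le hb.nonneg hx hxy hy fun z hz => hb x z hx hz.1 (hz.2.trans hy)

/-- First the integrand is changed with the integrator b kept, then the integrator. The bound is
linear in ε, which gives continuity in time of the lifted interpolations. -/
lemma norm_snd_sub_le (hb : IsLipschitzPath K b) (hc : IsLipschitzPath L c)
    (hbc : IsLipschitzPath ε fun z => b z - c z) {x y : ℝ} (hx : 0 ≤ x) (hxy : x ≤ y)
    (hy : y ≤ 1) :
    ‖(naturalLift b).snd x y - (naturalLift c).snd x y‖ ≤ (K + L) * ε * (y - x) ^ 2 := by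
  have hcont : ∀ {f : ℝ → Vec d} (v), ContinuousOn f (Icc 0 1) →
    ContinuousOn (fun w => f w - v) (Icc 0 1) := fun v hf => hf.sub continuousOn_const
  have e : (naturalLift b).snd x y - (naturalLift c).snd x y
      = (∫ z in x..y, tensor ((b z - c z) - (b x - c x)) (deriv b z))
        + ∫ z in x..y, tensor (c z - c x) (deriv (fun z => b z - c z) z) := by
    simp only [naturalLift]
    rw [← intervalIntegral.integral_sub
      (hb.intervalIntegrable_tensor (hcont _ hb.continuousOn) hx hxy hy)
      (hc.intervalIntegrable_tensor (hcont _ hc.continuousOn) hx hxy hy),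
      ← intervalIntegral.integral_add
      (hb.intervalIntegrable_tensor (hcont _ hbc.continuousOn) hx hxy hy)
      (hbc.intervalIntegrable_tensor (hcont _ hc.continuousOn) hx hxy hy)]
    refine intervalIntegral.integral_congr_ae ?_
    rw [uIoc_of_le hxy]
    filter_upwards [(ae_restrict_iff' measurableSet_Ioc).1 (ae_mem_Ioo hx hy),
      hb.ae_differentiableAt, hc.ae_differentiableAt] with z hz h1 h2 hz1
    rw [deriv_fun_sub (h1 (hz hz1)) (h2 (hz hz1))]
    simp only [tensor_sub_left, tensor_sub_right]
    abel
  rw [e]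
  refine (norm_add_le _ _).trans ?_
  have h1 := hb.norm_integral_tensor_le hbc.nonneg hx hxy hy
    fun z hz => hbc x z hx hz.1 (hz.2.trans hy)
  have h2 := hbc.norm_integral_tensor_le hc.nonneg hx hxy hy
    fun z hz => hc x z hx hz.1 (hz.2.trans hy)
  linarith

lemma rpow_le_of_le_one {u β : ℝ} {n : ℕ} (hu : 0 < u) (hu1 : u ≤ 1) (hβ : β ≤ n) :
    u ^ n ≤ u ^ β := by
  rw [← Real.rpow_natCast]
  exact Real.rpow_le_rpow_of_exponent_ge hu hu1 hβ

lemma continuousOn_increment (hb : IsLipschitzPath K b) :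
    ContinuousOn (fun p : ℝ × ℝ => b p.2 - b p.1) simplex :=
  (hb.continuousOn.comp continuousOn_snd fun _ hp => ⟨hp.1.trans hp.2.1, hp.2.2⟩).sub
    (hb.continuousOn.comp continuousOn_fst fun _ hp => ⟨hp.1, hp.2.1.trans hp.2.2⟩)

/-- Chen's identity reduces the question to the one-variable function y ↦ A² (0,y), which is
Lipschitz. -/
lemma continuousOn_area (hb : IsLipschitzPath K b) :
    ContinuousOn (fun p : ℝ × ℝ => (naturalLift b).snd p.1 p.2) simplex := by
  set G : ℝ → Tens d := fun y => (naturalLift b).snd 0 y with hG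
  have hchen : ∀ x y : ℝ, 0 ≤ x → x ≤ y → y ≤ 1 →
      (naturalLift b).snd x y = G y - G x - tensor (b x - b 0) (b y - b x) := fun x y hx hxy hy => by
    have := hb.chen_snd le_rfl hx hxy hy
    simp only [hG, this]; abel
  have hGc : ContinuousOn G (Icc 0 1) := by
    have : LipschitzOnWith (2 * K * K).toNNReal G (Icc 0 1) := by
      have hK := hb.nonneg
      have key : ∀ x y : ℝ, 0 ≤ x → x ≤ y → y ≤ 1 → ‖G y - G x‖ ≤ 2 * K * K * (y - x) := by
        intro x y hx hxy hy
        have h1 := hchen x y hx hxy hy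
        have h2 : G y - G x = (naturalLift b).snd x y + tensor (b x - b 0) (b y - b x) := by
          rw [h1]; abel
        rw [h2]
        refine (norm_add_le _ _).trans ?_
        rw [norm_tensor]
        have h3 := hb.norm_snd_le hx hxy hy
        have h4 := hb 0 x le_rfl hx (hxy.trans hy)
        have h5 := hb x y hx hxy hy
        have h6 : ‖b x - b 0‖ * ‖b y - b x‖ ≤ (K * 1) * (K * (y - x)) := by
          gcongr
          exact h4.trans (by gcongr; linarith)
        have h7 : K * K * (y - x) ^ 2 ≤ K * K * (y - x) := by
          gcongr; nlinarith
        linarith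
      refine LipschitzOnWith.of_dist_le_mul fun x hx y hy => ?_
      rw [Real.coe_toNNReal _ (by positivity), dist_eq_norm, Real.dist_eq]
      rcases le_total x y with h | h
      · rw [norm_sub_rev, abs_sub_comm, abs_of_nonneg (by linarith)]
        exact key x y hx.1 h hy.2
      · rw [abs_of_nonneg (by linarith)]
        exact key y x hy.1 h hx.2
    exact this.continuousOn
  have m1 : MapsTo (Prod.fst : ℝ × ℝ → ℝ) simplex (Icc 0 1) :=
    fun p hp => ⟨hp.1, hp.2.1.trans hp.2.2⟩
  have m2 : MapsTo (Prod.snd : ℝ × ℝ → ℝ) simplex (Icc 0 1) :=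
    fun p hp => ⟨hp.1.trans hp.2.1, hp.2.2⟩
  refine ContinuousOn.congr (f := fun p : ℝ × ℝ =>
    G p.2 - G p.1 - tensor (b p.1 - b 0) (b p.2 - b p.1)) ?_
    fun p hp => hchen p.1 p.2 hp.1 hp.2.1 hp.2.2
  refine ((hGc.comp continuousOn_snd m2).sub (hGc.comp continuousOn_fst m1)).sub ?_
  exact continuous_tensor.comp_continuousOn
    (((hb.continuousOn.comp continuousOn_fst m1).sub continuousOn_const).prodMk hb.continuousOn_increment)

lemma isGeometricRoughPath (hb : IsLipschitzPath K b) {α : ℝ} (hα : α ≤ 1) :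
    IsGeometricRoughPath α (naturalLift b) := by
  refine ⟨⟨hb.continuousOn_increment, hb.continuousOn_area, fun x z y _ _ _ _ => ?_,
    fun x z y hx hxz hzy hy => hb.chen_snd hx hxz hzy hy, ?_, ?_⟩, fun ε hε => ?_⟩
  · simp only [naturalLift]; abel
  · refine (holderNorm_le (C := K) fun x y hx hxy hy => ?_).trans_lt ENNReal.ofReal_lt_top
    refine (hb x y hx hxy.le hy).trans ?_
    have := rpow_le_of_le_one (n := 1) (sub_pos.2 hxy) (by linarith) (by simpa using hα)
    have hK := hb.nonneg
    rw [pow_one] at this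
    gcongr
  · refine (holderNorm_le (C := K * K) fun x y hx hxy hy => ?_).trans_lt ENNReal.ofReal_lt_top
    refine (hb.norm_snd_le hx hxy.le hy).trans ?_
    have := rpow_le_of_le_one (n := 2) (β := 2 * α) (sub_pos.2 hxy) (by linarith)
      (by push_cast; linarith)
    have hK := hb.nonneg
    gcongr
  · exact ⟨b, ⟨_, hb.lipschitzOnWith⟩, by rwa [roughDist_self]⟩

lemma roughDist_le (hb : IsLipschitzPath K b) (hc : IsLipschitzPath L c)
    (hbc : IsLipschitzPath ε fun z => b z - c z) {α : ℝ} (hα : α ≤ 1) :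
    roughDist α (naturalLift b) (naturalLift c)
      ≤ ENNReal.ofReal ‖b 0 - c 0‖ + ENNReal.ofReal ε + ENNReal.ofReal ((K + L) * ε) := by
  have hε := hbc.nonneg
  refine add_le_add (add_le_add ?_ (holderNorm_le fun x y hx hxy hy => ?_))
    (holderNorm_le fun x y hx hxy hy => ?_)
  · rw [edist_dist, dist_eq_norm]; rfl
  · have e : (naturalLift b).fst x y - (naturalLift c).fst x y = (b y - c y) - (b x - c x) := by
      simp only [naturalLift]; abel
    rw [e]
    refine (hbc x y hx hxy.le hy).trans ?_
    have := rpow_le_of_le_one (n := 1) (sub_pos.2 hxy) (by linarith) (by simpa using hα)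
    rw [pow_one] at this
    gcongr
  · refine (hb.norm_snd_sub_le hc hbc hx hxy.le hy).trans ?_
    have := rpow_le_of_le_one (n := 2) (β := 2 * α) (sub_pos.2 hxy) (by linarith)
      (by push_cast; linarith)
    have hK := hb.nonneg
    have hL := hc.nonneg
    gcongr

end IsLipschitzPath

/-! ### Piecewise linear interpolation -/

section Interp

variable {d k : ℕ} {a : ℝ → Vec d}

lemma dyadicInterp_grid (k : ℕ) (a : ℝ → Vec d) (j : ℕ) :
    dyadicInterp k a (j / 2 ^ k) = a (j / 2 ^ k) := by
  have e : (2 : ℝ) ^ k * (j / 2 ^ k) = j := by field_simp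
  simp [dyadicInterp, e]

lemma dyadicInterp_eq {j : ℕ} {z : ℝ} (hz : z ∈ Icc ((j : ℝ) / 2 ^ k) ((j + 1 : ℕ) / 2 ^ k)) :
    dyadicInterp k a z
      = a (j / 2 ^ k) + (2 ^ k * z - j) • (a ((j + 1 : ℕ) / 2 ^ k) - a (j / 2 ^ k)) := by
  rcases eq_or_lt_of_le hz.2 with h | h
  · rw [h, dyadicInterp_grid]
    have e : (2 : ℝ) ^ k * ((j + 1 : ℕ) / 2 ^ k) - j = 1 := by push_cast; field_simp; ring
    rw [e, one_smul, add_sub_cancel]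
  · have h1 : (j : ℝ) ≤ 2 ^ k * z := by
      have := hz.1; rwa [div_le_iff₀ (by positivity), mul_comm] at this
    have h2 : 2 ^ k * z < j + 1 := by
      rw [lt_div_iff₀ (by positivity), mul_comm] at h; push_cast at h; exact h
    have hf : ⌊2 ^ k * z⌋ = (j : ℤ) := by
      rw [Int.floor_eq_iff]; exact ⟨by exact_mod_cast h1, by exact_mod_cast h2⟩
    simp only [dyadicInterp, hf]
    push_cast
    rfl

lemma dyadicInterp_sub (k : ℕ) (a c : ℝ → Vec d) (z : ℝ) :
    dyadicInterp k a z - dyadicInterp k c z = dyadicInterp k (fun x => a x - c x) z := by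
  simp only [dyadicInterp]
  module

lemma dyadicInterp_sub_dyadicInterp {j : ℕ} {x y : ℝ}
    (hx : x ∈ Icc ((j : ℝ) / 2 ^ k) ((j + 1 : ℕ) / 2 ^ k))
    (hy : y ∈ Icc ((j : ℝ) / 2 ^ k) ((j + 1 : ℕ) / 2 ^ k)) :
    dyadicInterp k a y - dyadicInterp k a x
      = (2 ^ k * (y - x)) • (a ((j + 1 : ℕ) / 2 ^ k) - a (j / 2 ^ k)) := by
  rw [dyadicInterp_eq hx, dyadicInterp_eq hy]
  module

/-- Each cell has slope at most 2^k K, and an induction over the cells glues the estimates. -/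
lemma isLipschitzPath_dyadicInterp {K : ℝ}
    (h : ∀ j < 2 ^ k, ‖a ((j + 1 : ℕ) / 2 ^ k) - a (j / 2 ^ k)‖ ≤ K) :
    IsLipschitzPath (2 ^ k * K) (dyadicInterp k a) := by
  have hpiece : ∀ j : ℕ, j < 2 ^ k → ∀ x y : ℝ, (j : ℝ) / 2 ^ k ≤ x → x ≤ y → y ≤ (j + 1 : ℕ) / 2 ^ k →
      ‖dyadicInterp k a y - dyadicInterp k a x‖ ≤ 2 ^ k * K * (y - x) := by
    intro j hj x y hx hxy hy
    rw [dyadicInterp_sub_dyadicInterp ⟨hx, hxy.trans hy⟩ ⟨hx.trans hxy, hy⟩, norm_smul,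
      Real.norm_of_nonneg (mul_nonneg (by positivity) (by linarith))]
    have := h j hj
    have h2 : 0 ≤ 2 ^ k * (y - x) := mul_nonneg (by positivity) (by linarith)
    calc _ ≤ 2 ^ k * (y - x) * K := by gcongr
      _ = _ := by ring
  have key : ∀ n : ℕ, n ≤ 2 ^ k → ∀ x y : ℝ, 0 ≤ x → x ≤ y → y ≤ (n : ℝ) / 2 ^ k →
      ‖dyadicInterp k a y - dyadicInterp k a x‖ ≤ 2 ^ k * K * (y - x) := by
    intro n
    induction n with
    | zero =>
      intro _ x y hx hxy hy
      have : x = y := by simp at hy; linarith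
      simp [this]
    | succ n ih =>
      intro hn x y hx hxy hy
      rcases le_total y ((n : ℝ) / 2 ^ k) with h1 | h1
      · exact ih (by omega) x y hx hxy h1
      rcases le_total x ((n : ℝ) / 2 ^ k) with h2 | h2
      · have h3 := ih (by omega) x _ hx h2 le_rfl
        have h4 := hpiece n (by omega) _ y le_rfl h1 hy
        have := norm_sub_le_norm_sub_add_norm_sub (dyadicInterp k a y)
          (dyadicInterp k a (n / 2 ^ k)) (dyadicInterp k a x)
        linarith
      · exact hpiece n (by omega) x y h2 hxy hy
  intro x y hx hxy hy
  exact key (2 ^ k) le_rfl x y hx hxy (by simpa using hy)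

/-- The sum in place of a maximum is crude, but it depends continuously on the grid values and
vanishes with them, which suffices for continuity in time. -/
lemma exists_isLipschitzPath_dyadicInterp (k : ℕ) (a : ℝ → Vec d) :
    IsLipschitzPath (2 ^ k * ∑ j ∈ Finset.range (2 ^ k), ‖a ((j + 1 : ℕ) / 2 ^ k) - a (j / 2 ^ k)‖)
      (dyadicInterp k a) :=
  isLipschitzPath_dyadicInterp fun _ hj =>
    Finset.single_le_sum (f := fun j : ℕ => ‖a ((j + 1 : ℕ) / 2 ^ k) - a (j / 2 ^ k)‖)
      (fun _ _ => norm_nonneg _) (Finset.mem_range.2 hj)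

/-- The natural lifts of the interpolations of a continuous sheet form a continuous path of
geometric rough paths. -/
lemma isGeometricPath_naturalLift_dyadicInterp {T α : ℝ} (hα : α ≤ 1) {ψ : ℝ → ℝ → Vec d}
    (hψ : ContinuousOn (fun q : ℝ × ℝ => ψ q.1 q.2) (Icc 0 T ×ˢ Icc 0 1)) (k : ℕ) :
    IsGeometricPath α T fun t => naturalLift (dyadicInterp k (ψ t)) := by
  refine ⟨fun t _ => (exists_isLipschitzPath_dyadicInterp k (ψ t)).isGeometricRoughPath hα,
    fun t ht => ?_⟩
  set S : (ℝ → Vec d) → ℝ := fun a =>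
    2 ^ k * ∑ j ∈ Finset.range (2 ^ k), ‖a ((j + 1 : ℕ) / 2 ^ k) - a (j / 2 ^ k)‖ with hS
  have hL : ∀ a, IsLipschitzPath (S a) (dyadicInterp k a) :=
    fun a => exists_isLipschitzPath_dyadicInterp k a
  have hc : ∀ x ∈ Icc (0 : ℝ) 1, Tendsto (fun s => ψ s x) (𝓝[Icc 0 T] t) (𝓝 (ψ t x)) :=
    fun x hx => by
      have h1 : ContinuousOn (fun s => ψ s x) (Icc 0 T) :=
        hψ.comp (f := fun s : ℝ => (s, x)) (by fun_prop) fun s hs => ⟨hs, hx⟩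
      exact h1 t ht
  have hε : Tendsto (fun s => S fun x => ψ s x - ψ t x) (𝓝[Icc 0 T] t) (𝓝 0) := by
    have : Tendsto (fun s => S fun x => ψ s x - ψ t x) (𝓝[Icc 0 T] t)
        (𝓝 (S fun x => ψ t x - ψ t x)) := by
      refine Tendsto.const_mul _ (tendsto_finsetSum _ fun j hj => ?_)
      have hj := Finset.mem_range.1 hj
      exact (((hc _ (grid_mem hj)).sub_const _).sub ((hc _ (grid_mem hj.le)).sub_const _)).norm
    simpa [hS] using this
  have hSs : Tendsto (fun s => S (ψ s)) (𝓝[Icc 0 T] t) (𝓝 (S (ψ t))) := by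
    refine Tendsto.const_mul _ (tendsto_finsetSum _ fun j hj => ?_)
    have hj := Finset.mem_range.1 hj
    exact ((hc _ (grid_mem hj)).sub (hc _ (grid_mem hj.le))).norm
  have h0 : Tendsto (fun s => ‖dyadicInterp k (ψ s) 0 - dyadicInterp k (ψ t) 0‖) (𝓝[Icc 0 T] t)
      (𝓝 0) := by
    have e : ∀ s, dyadicInterp k (ψ s) 0 = ψ s 0 := fun s => by
      simpa using dyadicInterp_grid k (ψ s) 0
    simp_rw [e]
    simpa using ((hc 0 (by simp)).sub_const (ψ t 0)).norm
  have hb : Tendsto (fun s => ENNReal.ofReal ‖dyadicInterp k (ψ s) 0 - dyadicInterp k (ψ t) 0‖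
      + ENNReal.ofReal (S fun x => ψ s x - ψ t x)
      + ENNReal.ofReal ((S (ψ s) + S (ψ t)) * S fun x => ψ s x - ψ t x)) (𝓝[Icc 0 T] t) (𝓝 0) := by
    have := ((ENNReal.tendsto_ofReal h0).add (ENNReal.tendsto_ofReal hε)).add
      (ENNReal.tendsto_ofReal ((hSs.add_const (S (ψ t))).mul hε))
    simpa using this
  refine tendsto_of_tendsto_of_tendsto_of_le_of_le tendsto_const_nhds hb (fun _ => zero_le)
    fun s => ?_
  refine (hL _).roughDist_le (hL _) ?_ hα
  have := hL fun x => ψ s x - ψ t x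
  simp_rw [dyadicInterp_sub]
  exact this

/-- On an interval where the interpolation is affine, the second level is symmetric. -/
lemma snd_dyadicInterp_of_mem {j : ℕ} {x y : ℝ} (hx : (j : ℝ) / 2 ^ k ≤ x) (hxy : x ≤ y)
    (hy : y ≤ (j + 1 : ℕ) / 2 ^ k) :
    (naturalLift (dyadicInterp k a)).snd x y = (1 / 2 : ℝ) •
      tensor (dyadicInterp k a y - dyadicInterp k a x) (dyadicInterp k a y - dyadicInterp k a x) := by
  set v := a ((j + 1 : ℕ) / 2 ^ k) - a (j / 2 ^ k) with hv
  have hder : ∀ z ∈ Ioo ((j : ℝ) / 2 ^ k) ((j + 1 : ℕ) / 2 ^ k),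
      deriv (dyadicInterp k a) z = (2 ^ k : ℝ) • v := fun z hz => by
    have h1 : dyadicInterp k a =ᶠ[𝓝 z] fun w => a (j / 2 ^ k) + (2 ^ k * w - j) • v := by
      filter_upwards [Ioo_mem_nhds hz.1 hz.2] with w hw
      exact dyadicInterp_eq (Ioo_subset_Icc_self hw)
    rw [h1.deriv_eq]
    have h2 : HasDerivAt (fun w : ℝ => 2 ^ k * w - j) (2 ^ k) z := by
      simpa using ((hasDerivAt_id z).const_mul ((2 : ℝ) ^ k)).sub_const (j : ℝ)
    exact ((h2.smul_const v).const_add _).deriv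
  have h1 : (naturalLift (dyadicInterp k a)).snd x y
      = ∫ z in x..y, ((z - x) * (2 ^ k * 2 ^ k) : ℝ) • tensor v v := by
    simp only [naturalLift]
    refine intervalIntegral.integral_congr_ae ?_
    rw [uIoc_of_le hxy]
    have : ∀ᵐ z : ℝ, z ≠ (j + 1 : ℕ) / 2 ^ k := by simp [ae_iff]
    filter_upwards [this] with z hz hz1
    have hz2 : z < (j + 1 : ℕ) / 2 ^ k := lt_of_le_of_ne (hz1.2.trans hy) hz
    rw [hder z ⟨hx.trans_lt hz1.1, hz2⟩, dyadicInterp_sub_dyadicInterp ⟨hx, hxy.trans hy⟩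
      ⟨hx.trans hz1.1.le, hz2.le⟩, tensor_smul_left, tensor_smul_right, smul_smul]
    congr 1; ring
  rw [h1, dyadicInterp_sub_dyadicInterp ⟨hx, hxy.trans hy⟩ ⟨hx.trans hxy, hy⟩, ← hv,
    intervalIntegral.integral_smul_const, intervalIntegral.integral_mul_const, tensor_smul_left,
    tensor_smul_right, smul_smul, smul_smul]
  congr 1
  have h2 : ∫ z in x..y, (z - x) = (y - x) ^ 2 / 2 := by
    rw [intervalIntegral.integral_comp_sub_right (fun z => z) x, integral_id]; ring
  rw [h2]; ring

end Interp

/-! ### Second levels and areas -/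

section Area

variable {d : ℕ} {A : RoughData d} {a : ℝ → Vec d}

/-- The difference of the second level and its symmetric part. -/
def area {d : ℕ} (A : RoughData d) (x y : ℝ) : Tens d :=
  A.snd x y - (1 / 2 : ℝ) • tensor (A.fst x y) (A.fst x y)

lemma snd_self_of_chen (h1 : ∀ x y, (x, y) ∈ simplex → A.fst x y = a y - a x)
    (h2 : ∀ x z y : ℝ, 0 ≤ x → x ≤ z → z ≤ y → y ≤ 1 →
      A.snd x y = A.snd x z + A.snd z y + tensor (A.fst x z) (A.fst z y))
    {x : ℝ} (hx : x ∈ Icc (0 : ℝ) 1) : A.snd x x = 0 := by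
  have := h2 x x x hx.1 le_rfl le_rfl hx.2
  rw [h1 x x ⟨hx.1, le_rfl, hx.2⟩, sub_self, tensor_zero_left, add_zero] at this
  simpa using this

/-- The second level differs from a symmetric Riemann sum by the sum of the areas over the
intervals of the partition. -/
lemma snd_sub_stratonovichSum (h1 : ∀ x y, (x, y) ∈ simplex → A.fst x y = a y - a x)
    (h2 : ∀ x z y : ℝ, 0 ≤ x → x ≤ z → z ≤ y → y ≤ 1 →
      A.snd x y = A.snd x z + A.snd z y + tensor (A.fst x z) (A.fst z y))
    {n : ℕ} {u : ℕ → ℝ} (hu : Monotone u) (hu0 : 0 ≤ u 0) (hun : u n ≤ 1) :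
    A.snd (u 0) (u n) - stratonovichSum a n u
      = ∑ l ∈ Finset.range n, area A (u l) (u (l + 1)) := by
  induction n with
  | zero =>
    have := snd_self_of_chen h1 h2 (x := u 0) ⟨hu0, hun⟩
    simp [stratonovichSum, this]
  | succ n ih =>
    have hn : u n ≤ u (n + 1) := hu (Nat.le_succ _)
    have h0 : u 0 ≤ u n := hu (Nat.zero_le _)
    rw [Finset.sum_range_succ, ← ih (hn.trans hun)]
    unfold stratonovichSum area
    rw [Finset.sum_range_succ, h2 _ (u n) _ hu0 h0 hn hun, h1 _ _ ⟨hu0, h0, hn.trans hun⟩,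
      h1 _ _ ⟨hu0.trans h0, hn, hun⟩]
    simp only [tensor_sub_left, tensor_sub_right, tensor_add_left, tensor_smul_left]
    module

lemma stratonovichSum_congr {c : ℝ → Vec d} {n : ℕ} {u : ℕ → ℝ} (h : ∀ l ≤ n, a (u l) = c (u l)) :
    stratonovichSum a n u = stratonovichSum c n u := by
  unfold stratonovichSum
  refine Finset.sum_congr rfl fun l hl => ?_
  have hl := Finset.mem_range.1 hl
  rw [h l hl.le, h (l + 1) hl, h 0 (Nat.zero_le _)]

lemma chen_naturalLift_dyadicInterp (k : ℕ) (a : ℝ → Vec d) (x z y : ℝ) (hx : 0 ≤ x) (hxz : x ≤ z)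
    (hzy : z ≤ y) (hy : y ≤ 1) : (naturalLift (dyadicInterp k a)).snd x y
      = (naturalLift (dyadicInterp k a)).snd x z + (naturalLift (dyadicInterp k a)).snd z y
        + tensor ((naturalLift (dyadicInterp k a)).fst x z)
          ((naturalLift (dyadicInterp k a)).fst z y) :=
  (exists_isLipschitzPath_dyadicInterp k a).chen_snd hx hxz hzy hy

lemma area_dyadicInterp_of_mem {k j : ℕ} {x y : ℝ} (hx : (j : ℝ) / 2 ^ k ≤ x) (hxy : x ≤ y)
    (hy : y ≤ (j + 1 : ℕ) / 2 ^ k) : area (naturalLift (dyadicInterp k a)) x y = 0 := by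
  rw [area, snd_dyadicInterp_of_mem hx hxy hy]
  simp [naturalLift]

lemma snd_dyadicInterp_sub_stratonovichSum (k : ℕ) (a : ℝ → Vec d) {n : ℕ} {u : ℕ → ℝ}
    (hu : Monotone u) (hu0 : 0 ≤ u 0) (hun : u n ≤ 1) :
    (naturalLift (dyadicInterp k a)).snd (u 0) (u n) - stratonovichSum (dyadicInterp k a) n u
      = ∑ l ∈ Finset.range n, area (naturalLift (dyadicInterp k a)) (u l) (u (l + 1)) :=
  snd_sub_stratonovichSum (fun _ _ _ => rfl) (chen_naturalLift_dyadicInterp k a) hu hu0 hun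

lemma grid_monotone (K n : ℕ) : Monotone fun l : ℕ => ((n + l : ℕ) : ℝ) / 2 ^ K :=
  fun _ _ h => grid_le (Nat.add_le_add_left h n)

/-- The interpolation has no area on its own cells, so between grid points its second level is the
Stratonovich sum along the grid. Subtracting the symmetric part replaces the base point by the mean
of the two end values. -/
lemma area_dyadicInterp_grid (K : ℕ) (a : ℝ → Vec d) {n n' : ℕ} (hn : n ≤ n') (hn' : n' ≤ 2 ^ K) :
    area (naturalLift (dyadicInterp K a)) (n / 2 ^ K) (n' / 2 ^ K) = gridArea K n n' a := by
  obtain ⟨L, rfl⟩ := Nat.exists_eq_add_of_le hn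
  have h1 := snd_dyadicInterp_sub_stratonovichSum K a (n := L) (grid_monotone K n)
    (grid_mem (by omega)).1 (grid_mem hn').2
  rw [Finset.sum_eq_zero fun l _ => area_dyadicInterp_of_mem (j := n + l) le_rfl
    (grid_monotone K n (Nat.le_succ l)) le_rfl, sub_eq_zero,
    stratonovichSum_congr (c := a) fun l _ => dyadicInterp_grid K a (n + l)] at h1
  simp only [add_zero] at h1
  rw [area, h1]
  simp only [naturalLift, dyadicInterp_grid]
  set v : ℕ → Vec d := fun l => a ((n + l : ℕ) / 2 ^ K) with hv
  have hsum : ∑ l ∈ Finset.range L, (v (l + 1) - v l) = v L - v 0 := Finset.sum_range_sub v L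
  have e1 : gridArea K n (n + L) a = ∑ l ∈ Finset.range L,
      tensor ((1 / 2 : ℝ) • (v l + v (l + 1)) - (1 / 2 : ℝ) • (v 0 + v L)) (v (l + 1) - v l) := by
    unfold gridArea centredMean
    rw [Finset.sum_Ico_eq_sum_range, Nat.add_sub_cancel_left]
    rfl
  have e2 : stratonovichSum a L (fun l : ℕ => ((n + l : ℕ) : ℝ) / 2 ^ K)
      = ∑ l ∈ Finset.range L,
        tensor ((1 / 2 : ℝ) • (v l + v (l + 1)) - v 0) (v (l + 1) - v l) := rfl
  have e3 : tensor (v 0 - (1 / 2 : ℝ) • (v 0 + v L)) (v L - v 0) = ∑ l ∈ Finset.range L,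
      tensor (v 0 - (1 / 2 : ℝ) • (v 0 + v L)) (v (l + 1) - v l) := by
    rw [← hsum, ← tensorL_apply, map_sum]; rfl
  have e4 : gridArea K n (n + L) a = stratonovichSum a L (fun l : ℕ => ((n + l : ℕ) : ℝ) / 2 ^ K)
      + tensor (v 0 - (1 / 2 : ℝ) • (v 0 + v L)) (v L - v 0) := by
    rw [e1, e2, e3, ← Finset.sum_add_distrib]
    refine Finset.sum_congr rfl fun l _ => ?_
    rw [← tensor_add_left, sub_add_sub_cancel]
  have e5 : v 0 - (1 / 2 : ℝ) • (v 0 + v L) = (-(1 / 2) : ℝ) • (v L - v 0) := by module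
  rw [e4, e5, tensor_smul_left, neg_smul, sub_eq_add_neg]
  rfl

/-- The increment of the second level from one dyadic level to the next over a coarser dyadic
interval is a sum of areas. -/
lemma snd_dyadicInterp_succ_sub {k m i : ℕ} (hm : m ≤ k) (hi : i < 2 ^ m) (a : ℝ → Vec d) :
    (naturalLift (dyadicInterp (k + 1) a)).snd (i / 2 ^ m) ((i + 1 : ℕ) / 2 ^ m)
        - (naturalLift (dyadicInterp k a)).snd (i / 2 ^ m) ((i + 1 : ℕ) / 2 ^ m)
      = ∑ l ∈ Finset.range (2 ^ (k - m)), gridArea (k + 1) (2 * (i * 2 ^ (k - m) + l))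
          (2 * (i * 2 ^ (k - m) + (l + 1))) a := by
  obtain ⟨e, rfl⟩ := Nat.exists_eq_add_of_le hm
  rw [Nat.add_sub_cancel_left]
  set u : ℕ → ℝ := fun l => ((i * 2 ^ e + l : ℕ) : ℝ) / 2 ^ (m + e) with hu
  have hum : Monotone u := grid_monotone (m + e) (i * 2 ^ e)
  have hle : i * 2 ^ e + 2 ^ e ≤ 2 ^ (m + e) := by
    rw [pow_add]; nlinarith [Nat.one_le_two_pow (n := e)]
  have h0 : u 0 = i / 2 ^ m := by simp only [hu]; push_cast; rw [pow_add]; field_simp; ring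
  have h1 : u (2 ^ e) = (i + 1 : ℕ) / 2 ^ m := by
    simp only [hu]; push_cast; rw [pow_add]; field_simp
  have hu0 : 0 ≤ u 0 := by positivity
  have hu1 : u (2 ^ e) ≤ 1 := (grid_mem hle).2
  have h2 : ∀ l, u l = ((2 * (i * 2 ^ e + l) : ℕ) : ℝ) / 2 ^ (m + e + 1) := fun l => by
    simp only [hu]; push_cast; rw [pow_succ _ (m + e)]; field_simp
  have hA := snd_dyadicInterp_sub_stratonovichSum (m + e + 1) a hum hu0 hu1
  have hB := snd_dyadicInterp_sub_stratonovichSum (m + e) a hum hu0 hu1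
  -- Both interpolations take the values of a at the points u, so their Stratonovich sums along u
  -- coincide. The coarser one has no area on these cells; for the finer one each cell contributes
  -- the area of its two halves.
  rw [stratonovichSum_congr (c := a) fun l _ => by rw [h2 l]; exact dyadicInterp_grid _ a _] at hA
  rw [stratonovichSum_congr (c := a) fun l _ => dyadicInterp_grid _ a _,
    Finset.sum_eq_zero fun l _ => area_dyadicInterp_of_mem (j := i * 2 ^ e + l) le_rfl
    (hum (Nat.le_succ l)) le_rfl, sub_eq_zero] at hB
  rw [h0, h1] at hA hB
  rw [hB, hA]
  refine Finset.sum_congr rfl fun l hl => ?_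
  have hl := Finset.mem_range.1 hl
  rw [h2 l, h2 (l + 1), area_dyadicInterp_grid _ a (by omega) (by rw [pow_succ]; omega)]

end Area

/-! ### Dyadic control of the interpolations at a fixed time -/

section FixedTime

variable {d : ℕ} {a : ℝ → Vec d}

lemma dyadicInterp_coarse {m k : ℕ} (hm : m ≤ k) (a : ℝ → Vec d) (i : ℕ) :
    dyadicInterp k a (i / 2 ^ m) = a (i / 2 ^ m) := by
  obtain ⟨e, rfl⟩ := Nat.exists_eq_add_of_le hm
  have h : (i : ℝ) / 2 ^ m = ((i * 2 ^ e : ℕ) : ℝ) / 2 ^ (m + e) := by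
    push_cast; rw [pow_add]; field_simp
  rw [h, dyadicInterp_grid]

lemma exists_coarse_interval {k m i : ℕ} (hm : k ≤ m) (hi : i < 2 ^ m) :
    ∃ j : ℕ, j < 2 ^ k ∧ (j : ℝ) / 2 ^ k ≤ i / 2 ^ m ∧ ((i + 1 : ℕ) : ℝ) / 2 ^ m ≤ (j + 1 : ℕ) / 2 ^ k := by
  obtain ⟨e, rfl⟩ := Nat.exists_eq_add_of_le hm
  have he : 0 < 2 ^ e := by positivity
  refine ⟨i / 2 ^ e, ?_, ?_, ?_⟩
  · rw [Nat.div_lt_iff_lt_mul he, ← pow_add]; exact hi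
  · have h : i / 2 ^ e * 2 ^ e ≤ i := Nat.div_mul_le_self _ _
    have h' : ((i / 2 ^ e : ℕ) : ℝ) * 2 ^ e ≤ i := by exact_mod_cast h
    rw [div_le_div_iff₀ (by positivity) (by positivity), pow_add]
    nlinarith [show (0 : ℝ) < 2 ^ k by positivity]
  · have h : i + 1 ≤ (i / 2 ^ e + 1) * 2 ^ e := by
      have h1 := Nat.div_add_mod i (2 ^ e)
      have h2 := Nat.mod_lt i he
      nlinarith
    have h' : ((i + 1 : ℕ) : ℝ) ≤ ((i / 2 ^ e + 1 : ℕ) : ℝ) * 2 ^ e := by exact_mod_cast h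
    rw [div_le_div_iff₀ (by positivity) (by positivity), pow_add]
    nlinarith [show (0 : ℝ) < 2 ^ k by positivity]

lemma half_rpow_pow (m : ℕ) (β : ℝ) : ((1 : ℝ) / 2 ^ m) ^ β = ((1 / 2 : ℝ) ^ β) ^ m := by
  rw [Real.rpow_pow_comm (by norm_num), div_pow, one_pow]

variable {α δ M N : ℝ}

/-- At levels up to k the interpolation takes the values of the path. Inside a cell it is affine,
and the shrinking factor 2^(-e) is at most 2^(-eα) since α ≤ 1. -/
lemma norm_dyadicInterp_increment_le (hα : α ≤ 1)
    (hM : ∀ m i : ℕ, i < 2 ^ m → ‖a ((i + 1 : ℕ) / 2 ^ m) - a (i / 2 ^ m)‖ ≤ M * ((1 : ℝ) / 2 ^ m) ^ α)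
    (k : ℕ) {m i : ℕ} (hi : i < 2 ^ m) :
    ‖dyadicInterp k a ((i + 1 : ℕ) / 2 ^ m) - dyadicInterp k a (i / 2 ^ m)‖
      ≤ M * ((1 : ℝ) / 2 ^ m) ^ α := by
  rcases le_total m k with h | h
  · rw [dyadicInterp_coarse h, dyadicInterp_coarse h]; exact hM m i hi
  · obtain ⟨j, hj, h1, h2⟩ := exists_coarse_interval h hi
    obtain ⟨e, rfl⟩ := Nat.exists_eq_add_of_le h
    have h3 : (i : ℝ) / 2 ^ (k + e) ≤ (i + 1 : ℕ) / 2 ^ (k + e) := grid_le (Nat.le_succ _)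
    rw [dyadicInterp_sub_dyadicInterp ⟨h1, h3.trans h2⟩ ⟨h1.trans h3, h2⟩]
    have h4 : (2 : ℝ) ^ k * (((i + 1 : ℕ) : ℝ) / 2 ^ (k + e) - i / 2 ^ (k + e)) = 1 / 2 ^ e := by
      push_cast; rw [pow_add]; field_simp; ring
    rw [h4, norm_smul, Real.norm_of_nonneg (by positivity)]
    have h5 : (1 : ℝ) / 2 ^ e ≤ (1 / 2 ^ e) ^ α := by
      have := IsLipschitzPath.rpow_le_of_le_one (u := (1 : ℝ) / 2 ^ e) (n := 1) (by positivity)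
        ((div_le_one (by positivity)).2 (one_le_pow₀ (by norm_num))) (by simpa using hα)
      rwa [pow_one] at this
    calc (1 : ℝ) / 2 ^ e * ‖a ((j + 1 : ℕ) / 2 ^ k) - a (j / 2 ^ k)‖
        ≤ (1 / 2 ^ e) ^ α * (M * (1 / 2 ^ k) ^ α) := by
          have := hM k j hj
          gcongr
      _ = M * (1 / 2 ^ (k + e)) ^ α := by
          rw [pow_add, ← one_div_mul_one_div, Real.mul_rpow (by positivity) (by positivity)]; ring

lemma nonneg_of_dyadic_bound
    (hM : ∀ m i : ℕ, i < 2 ^ m → ‖a ((i + 1 : ℕ) / 2 ^ m) - a (i / 2 ^ m)‖ ≤ M * ((1 : ℝ) / 2 ^ m) ^ α) :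
    0 ≤ M := by
  have := (norm_nonneg _).trans (hM 0 0 (by norm_num))
  simpa using this

lemma half_pow_rpow_le_of_le (hδ : 0 ≤ δ) {k m : ℕ} (h : k ≤ m) :
    ((1 : ℝ) / 2 ^ m) ^ δ ≤ ((1 / 2 : ℝ) ^ δ) ^ k := by
  rw [half_rpow_pow]
  exact pow_le_pow_of_le_one (by positivity) (Real.rpow_le_one (by norm_num) (by norm_num) hδ) h

lemma half_pow_rpow_add_le (hδ : 0 ≤ δ) {k m : ℕ} (h : k ≤ m) :
    ((1 : ℝ) / 2 ^ m) ^ (α + δ) ≤ ((1 / 2 : ℝ) ^ δ) ^ k * ((1 : ℝ) / 2 ^ m) ^ α := by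
  rw [Real.rpow_add (by positivity), mul_comm]
  have := half_pow_rpow_le_of_le hδ h
  gcongr

lemma norm_dyadicInterp_sub_le (hα : 0 < α) (hδ : 0 ≤ δ) (hαδ : α + δ ≤ 1)
    (hM : ∀ m i : ℕ, i < 2 ^ m →
      ‖a ((i + 1 : ℕ) / 2 ^ m) - a (i / 2 ^ m)‖ ≤ M * ((1 : ℝ) / 2 ^ m) ^ (α + δ))
    (k : ℕ) {x y : ℝ} (hx : 0 ≤ x) (hxy : x ≤ y) (hy : y ≤ 1) :
    ‖dyadicInterp k a y - dyadicInterp k a x‖ ≤ M * chainConst α * (y - x) ^ α := by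
  have hM0 := nonneg_of_dyadic_bound hM
  have hL := exists_isLipschitzPath_dyadicInterp k a
  rcases eq_or_lt_of_le hxy with rfl | hxy
  · simp [Real.zero_rpow hα.ne']
  have := norm_le_of_dyadic_intervals (h := fun x y => dyadicInterp k a y - dyadicInterp k a x)
    (κ := 0) hα hM0 le_rfl hL.continuousOn_increment (fun x _ => sub_self _)
    (fun x z y _ _ _ _ => by
      rw [zero_mul, add_zero, add_comm]
      exact norm_sub_le_norm_sub_add_norm_sub _ _ _)
    (fun m i hi => (norm_dyadicInterp_increment_le hαδ hM k hi).trans (by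
      have := half_pow_rpow_add_le (α := α) hδ (Nat.zero_le m)
      rw [pow_zero, one_mul] at this
      gcongr)) hx hxy hy
  rwa [add_zero] at this

/-- The two interpolations agree at dyadic points of level at most k. On finer cells the surplus
exponent δ in the hypothesis supplies the decay in k. -/
lemma norm_fst_dyadicInterp_succ_sub_le (hα : 0 < α) (hδ : 0 ≤ δ) (hαδ : α + δ ≤ 1)
    (hM : ∀ m i : ℕ, i < 2 ^ m →
      ‖a ((i + 1 : ℕ) / 2 ^ m) - a (i / 2 ^ m)‖ ≤ M * ((1 : ℝ) / 2 ^ m) ^ (α + δ))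
    (k : ℕ) {x y : ℝ} (hx : 0 ≤ x) (hxy : x ≤ y) (hy : y ≤ 1) :
    ‖(naturalLift (dyadicInterp (k + 1) a)).fst x y - (naturalLift (dyadicInterp k a)).fst x y‖
      ≤ 2 * M * ((1 / 2 : ℝ) ^ δ) ^ k * chainConst α * (y - x) ^ α := by
  have hM0 := nonneg_of_dyadic_bound hM
  have hL := fun k => exists_isLipschitzPath_dyadicInterp k a
  rcases eq_or_lt_of_le hxy with rfl | hxy
  · simp [Real.zero_rpow hα.ne', naturalLift]
  have := norm_le_of_dyadic_intervals (h := fun x y =>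
    (naturalLift (dyadicInterp (k + 1) a)).fst x y - (naturalLift (dyadicInterp k a)).fst x y)
    (κ := 0) (η := 2 * M * ((1 / 2 : ℝ) ^ δ) ^ k) hα (by positivity) le_rfl
    ((hL (k + 1)).continuousOn_increment.sub (hL k).continuousOn_increment)
    (fun x _ => by simp [naturalLift])
    (fun x z y _ _ _ _ => by
      rw [zero_mul, add_zero]
      refine le_trans (le_of_eq ?_) (norm_add_le _ _)
      simp only [naturalLift]
      congr 1; abel)
    (fun m i hi => ?_) hx hxy hy
  · rwa [add_zero] at this
  · rcases Nat.lt_or_ge k m with h | h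
    · refine (norm_sub_le _ _).trans ?_
      have h1 := norm_dyadicInterp_increment_le hαδ hM k hi
      have h2 := norm_dyadicInterp_increment_le hαδ hM (k + 1) hi
      have h3 := half_pow_rpow_add_le (α := α) hδ h.le
      simp only [naturalLift]
      calc _ ≤ 2 * M * (1 / 2 ^ m) ^ (α + δ) := by linarith
        _ ≤ 2 * M * (((1 / 2 : ℝ) ^ δ) ^ k * (1 / 2 ^ m) ^ α) := by gcongr
        _ = _ := by ring
    · simp only [naturalLift, dyadicInterp_coarse h, dyadicInterp_coarse (h.trans (Nat.le_succ k)),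
        sub_self, norm_zero]
      positivity

/-- Three contributions: N from the areas over coarse intervals, M² from the symmetric squares over
fine intervals, where both interpolations are affine, and a last term from the additivity defect in
Chen's identity, which the first-level estimates control. -/
lemma norm_snd_dyadicInterp_succ_sub_le (hα : 0 < α) (hδ : 0 ≤ δ) (hαδ : α + δ ≤ 1)
    (hM : ∀ m i : ℕ, i < 2 ^ m →
      ‖a ((i + 1 : ℕ) / 2 ^ m) - a (i / 2 ^ m)‖ ≤ M * ((1 : ℝ) / 2 ^ m) ^ (α + δ))
    (hN0 : 0 ≤ N) (k : ℕ)
    (hN : ∀ m i : ℕ, m ≤ k → i < 2 ^ m →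
      ‖(naturalLift (dyadicInterp (k + 1) a)).snd (i / 2 ^ m) ((i + 1 : ℕ) / 2 ^ m)
        - (naturalLift (dyadicInterp k a)).snd (i / 2 ^ m) ((i + 1 : ℕ) / 2 ^ m)‖
      ≤ N * ((1 / 2 : ℝ) ^ δ) ^ k * ((1 : ℝ) / 2 ^ m) ^ (2 * α))
    {x y : ℝ} (hx : 0 ≤ x) (hxy : x ≤ y) (hy : y ≤ 1) :
    ‖(naturalLift (dyadicInterp (k + 1) a)).snd x y - (naturalLift (dyadicInterp k a)).snd x y‖
      ≤ (N + M ^ 2 + 4 * (M * chainConst α) ^ 2) * ((1 / 2 : ℝ) ^ δ) ^ k * chainConst (2 * α)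
        * (y - x) ^ (2 * α) := by
  have hM0 := nonneg_of_dyadic_bound hM
  have hL := fun k => exists_isLipschitzPath_dyadicInterp k a
  have hself : ∀ k, ∀ x ∈ Icc (0 : ℝ) 1, (naturalLift (dyadicInterp k a)).snd x x = 0 :=
    fun k x hx => snd_self_of_chen (a := dyadicInterp k a) (fun _ _ _ => rfl)
      (chen_naturalLift_dyadicInterp k a) hx
  have hCα := chainConst_pos hα
  set ρ := (1 / 2 : ℝ) ^ δ with hρ
  have hρ0 : 0 < ρ := Real.rpow_pos_of_pos (by norm_num) _
  have hρ1 : ρ ≤ 1 := Real.rpow_le_one (by norm_num) (by norm_num) hδ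
  rcases eq_or_lt_of_le hxy with rfl | hxy
  · rw [hself k x ⟨hx, hy⟩, hself (k + 1) x ⟨hx, hy⟩, sub_self, sub_self,
      Real.zero_rpow (by positivity)]; simp
  have hadd : ∀ x z y : ℝ, 0 ≤ x → x ≤ z → z ≤ y → y ≤ 1 →
      ‖(naturalLift (dyadicInterp (k + 1) a)).snd x y - (naturalLift (dyadicInterp k a)).snd x y‖
      ≤ ‖(naturalLift (dyadicInterp (k + 1) a)).snd x z
          - (naturalLift (dyadicInterp k a)).snd x z‖
        + ‖(naturalLift (dyadicInterp (k + 1) a)).snd z y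
          - (naturalLift (dyadicInterp k a)).snd z y‖
        + 4 * (M * chainConst α) ^ 2 * ρ ^ k
          * ((z - x) ^ (2 * α / 2) * (y - z) ^ (2 * α / 2)) := by
    intro x z y hx hxz hzy hy
    rw [mul_div_cancel_left₀ α two_ne_zero]
    have hz0 := hx.trans hxz
    have hz1 := hzy.trans hy
    rw [chen_naturalLift_dyadicInterp k a x z y hx hxz hzy hy,
      chen_naturalLift_dyadicInterp (k + 1) a x z y hx hxz hzy hy]
    set P := (naturalLift (dyadicInterp k a)).fst
    set Q := (naturalLift (dyadicInterp (k + 1) a)).fst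
    have e : ∀ A B A' B' : Tens d,
        A + B + tensor (Q x z) (Q z y) - (A' + B' + tensor (P x z) (P z y))
          = (A - A') + (B - B') + (tensor (Q x z - P x z) (Q z y)
            + tensor (P x z) (Q z y - P z y)) := by
      intro A B A' B'
      simp only [tensor_sub_left, tensor_sub_right]; abel
    rw [e]
    refine (norm_add_le _ _).trans (add_le_add (norm_add_le _ _) ((norm_add_le _ _).trans ?_))
    rw [norm_tensor, norm_tensor]
    have h1 : ‖Q x z - P x z‖ ≤ 2 * M * ρ ^ k * chainConst α * (z - x) ^ α :=
      norm_fst_dyadicInterp_succ_sub_le hα hδ hαδ hM k hx hxz hz1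
    have h2 : ‖Q z y - P z y‖ ≤ 2 * M * ρ ^ k * chainConst α * (y - z) ^ α :=
      norm_fst_dyadicInterp_succ_sub_le hα hδ hαδ hM k hz0 hzy hy
    have h3 : ‖Q z y‖ ≤ M * chainConst α * (y - z) ^ α :=
      norm_dyadicInterp_sub_le hα hδ hαδ hM (k + 1) hz0 hzy hy
    have h4 : ‖P x z‖ ≤ M * chainConst α * (z - x) ^ α :=
      norm_dyadicInterp_sub_le hα hδ hαδ hM k hx hxz hz1
    have h5 : 0 ≤ (z - x) ^ α := Real.rpow_nonneg (by linarith) _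
    have h6 : 0 ≤ (y - z) ^ α := Real.rpow_nonneg (by linarith) _
    calc _ ≤ (2 * M * ρ ^ k * chainConst α * (z - x) ^ α) * (M * chainConst α * (y - z) ^ α)
          + (M * chainConst α * (z - x) ^ α) * (2 * M * ρ ^ k * chainConst α * (y - z) ^ α) := by
          gcongr
      _ = _ := by ring
  have hd : ∀ m i : ℕ, i < 2 ^ m →
      ‖(naturalLift (dyadicInterp (k + 1) a)).snd (i / 2 ^ m) ((i + 1 : ℕ) / 2 ^ m)
        - (naturalLift (dyadicInterp k a)).snd (i / 2 ^ m) ((i + 1 : ℕ) / 2 ^ m)‖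
      ≤ ((N + M ^ 2) * ρ ^ k) * ((1 : ℝ) / 2 ^ m) ^ (2 * α) := by
    intro m i hi
    rcases Nat.lt_or_ge k m with h | h
    · have hsym : ∀ k' ≤ m,
          ‖(naturalLift (dyadicInterp k' a)).snd (i / 2 ^ m) ((i + 1 : ℕ) / 2 ^ m)‖
            ≤ 1 / 2 * (M * (1 / 2 ^ m) ^ (α + δ)) ^ 2 := fun k' hk' => by
        obtain ⟨j, hj, h1, h2⟩ := exists_coarse_interval hk' hi
        rw [snd_dyadicInterp_of_mem h1 (grid_le (Nat.le_succ i)) h2, norm_smul, norm_tensor,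
          Real.norm_of_nonneg (by norm_num), ← sq]
        have := norm_dyadicInterp_increment_le hαδ hM k' hi
        gcongr
      refine (norm_sub_le _ _).trans ?_
      have h1 := hsym k h.le
      have h2 := hsym (k + 1) h
      have h3 := half_pow_rpow_add_le (α := α) hδ h.le
      have h4 : ((1 : ℝ) / 2 ^ m) ^ (2 * α) = ((1 / 2 ^ m) ^ α) ^ 2 := by
        rw [mul_comm, Real.rpow_mul (by positivity)]; norm_cast
      have h5 : ρ ^ k * ρ ^ k ≤ ρ ^ k := mul_le_of_le_one_left (by positivity)
        (pow_le_one₀ hρ0.le hρ1)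
      calc _ ≤ M ^ 2 * ((1 / 2 ^ m) ^ (α + δ)) ^ 2 := by nlinarith
        _ ≤ M ^ 2 * (ρ ^ k * (1 / 2 ^ m) ^ α) ^ 2 := by gcongr
        _ = M ^ 2 * (ρ ^ k * ρ ^ k) * ((1 / 2 ^ m) ^ α) ^ 2 := by ring
        _ ≤ (N + M ^ 2) * ρ ^ k * ((1 / 2 ^ m) ^ α) ^ 2 := by gcongr; linarith
        _ = _ := by rw [h4]
    · refine (hN m i h hi).trans ?_
      gcongr
      nlinarith [sq_nonneg M]
  have := norm_le_of_dyadic_intervals (h := fun x y =>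
    (naturalLift (dyadicInterp (k + 1) a)).snd x y - (naturalLift (dyadicInterp k a)).snd x y)
    (κ := 4 * (M * chainConst α) ^ 2 * ρ ^ k) (η := (N + M ^ 2) * ρ ^ k) (β := 2 * α)
    (by positivity) (by positivity) (by positivity)
    ((hL (k + 1)).continuousOn_area.sub (hL k).continuousOn_area)
    (fun x hx => by simp [hself _ x hx]) hadd hd hx hxy hy
  refine this.trans_eq ?_
  ring

end FixedTime

/-! ### Dyadic control in time and space -/

/-- The increment of the second level of the interpolations from level `k` to level `k + 1` over
`[i/2^m, (i+1)/2^m]`, `m ≤ k`. -/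
def levelArea {d : ℕ} (k m i : ℕ) (a : ℝ → Vec d) : Tens d :=
  ∑ l ∈ Finset.range (2 ^ (k - m)), gridArea (k + 1) (2 * (i * 2 ^ (k - m) + l))
    (2 * (i * 2 ^ (k - m) + (l + 1))) a

/-- The increments and the areas of the continuous sheet `ψ` are controlled by `R` along dyadic
points. -/
structure IsControlled {d : ℕ} (T α δ q R : ℝ) (ψ : ℝ → ℝ → Vec d) : Prop where
  continuousOn : ContinuousOn (fun p : ℝ × ℝ => ψ p.1 p.2) (Icc 0 T ×ˢ Icc 0 1)
  initial : ∀ m i : ℕ, i ≤ 2 ^ m → ψ 0 (i / 2 ^ m) = 0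
  increment : ∀ m n i j : ℕ, i < 2 ^ m → j < 2 ^ n →
    ‖(ψ ((j + 1 : ℕ) * T / 2 ^ n) ((i + 1 : ℕ) / 2 ^ m) - ψ ((j + 1 : ℕ) * T / 2 ^ n) (i / 2 ^ m))
      - (ψ (j * T / 2 ^ n) ((i + 1 : ℕ) / 2 ^ m) - ψ (j * T / 2 ^ n) (i / 2 ^ m))‖
      ≤ R * ((1 : ℝ) / 2 ^ m) ^ (α + δ) * q ^ n
  area : ∀ k m n i j : ℕ, m ≤ k → i < 2 ^ m → j < 2 ^ n →
    ‖levelArea k m i (ψ ((j + 1 : ℕ) * T / 2 ^ n)) - levelArea k m i (ψ (j * T / 2 ^ n))‖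
      ≤ R * ((1 / 2 : ℝ) ^ δ) ^ k * ((1 : ℝ) / 2 ^ m) ^ (2 * α) * q ^ n

/-- The constant in the estimates for the levels of the interpolations. -/
def levelConst (α q : ℝ) : ℝ :=
  2 * (1 / (1 - q)) * chainConst α
    + ((1 / (1 - q)) + (1 / (1 - q)) ^ 2 + 4 * ((1 / (1 - q)) * chainConst α) ^ 2)
      * chainConst (2 * α)

lemma _root_.ContinuousOn.tensor {d : ℕ} {X : Type*} [TopologicalSpace X] {s : Set X}
    {f g : X → Vec d} (hf : ContinuousOn f s) (hg : ContinuousOn g s) :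
    ContinuousOn (fun t => SpatialLift.tensor (f t) (g t)) s :=
  continuous_tensor.comp_continuousOn (hf.prodMk hg)

lemma continuousOn_gridArea {d : ℕ} {X : Type*} [TopologicalSpace X] {s : Set X}
    {ψ : X → ℝ → Vec d} (hψ : ∀ x ∈ Icc (0 : ℝ) 1, ContinuousOn (fun t => ψ t x) s) {K n n' : ℕ}
    (hn : n ≤ n') (hn' : n' ≤ 2 ^ K) : ContinuousOn (fun t => gridArea K n n' (ψ t)) s := by
  unfold gridArea centredMean
  refine continuousOn_finsetSum _ fun l hl => ?_
  obtain ⟨l1, l2⟩ := Finset.mem_Ico.1 hl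
  have h : ∀ b : ℕ, b ≤ 2 ^ K → ContinuousOn (fun t => ψ t ((b : ℝ) / 2 ^ K)) s :=
    fun b hb => hψ _ (grid_mem hb)
  have c1 := h l (l2.le.trans hn')
  have c2 := h (l + 1) (Nat.le_trans l2 hn')
  have c3 := h n (hn.trans hn')
  have c4 := h n' hn'
  have h1 := ((c1.add c2).const_smul (1 / 2 : ℝ)).sub ((c3.add c4).const_smul (1 / 2 : ℝ))
  exact h1.tensor (c2.sub c1)

lemma levelArea_index_le {k m i l : ℕ} (hm : m ≤ k) (hi : i < 2 ^ m) (hl : l < 2 ^ (k - m)) :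
    2 * (i * 2 ^ (k - m) + (l + 1)) ≤ 2 ^ (k + 1) := by
  obtain ⟨e, rfl⟩ := Nat.exists_eq_add_of_le hm
  rw [Nat.add_sub_cancel_left] at *
  have : i * 2 ^ e + 2 ^ e ≤ 2 ^ (m + e) := by
    rw [pow_add]; nlinarith [Nat.one_le_two_pow (n := e)]
  rw [pow_succ]
  omega

lemma levelArea_eq_zero {d : ℕ} {k m i : ℕ} (hm : m ≤ k) (hi : i < 2 ^ m) {a : ℝ → Vec d}
    (ha : ∀ K b : ℕ, b ≤ 2 ^ K → a (b / 2 ^ K) = 0) : levelArea k m i a = 0 := by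
  unfold levelArea gridArea
  refine Finset.sum_eq_zero fun l hl => Finset.sum_eq_zero fun b hb => ?_
  have h1 := levelArea_index_le hm hi (Finset.mem_range.1 hl)
  have hb := Finset.mem_Ico.1 hb
  rw [ha _ _ (by omega), ha _ _ (by omega), sub_zero, tensor_zero_right]

namespace IsControlled

variable {d : ℕ} {T α δ q R : ℝ} {ψ : ℝ → ℝ → Vec d}

lemma continuousOn_time (h : IsControlled T α δ q R ψ) {x : ℝ} (hx : x ∈ Icc (0 : ℝ) 1) :
    ContinuousOn (fun t => ψ t x) (Icc 0 T) :=
  h.continuousOn.comp (f := fun s : ℝ => (s, x)) (by fun_prop) fun _ hs => ⟨hs, hx⟩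

lemma continuousOn_space (h : IsControlled T α δ q R ψ) {t : ℝ} (ht : t ∈ Icc 0 T) :
    ContinuousOn (fun x => ψ t x) (Icc 0 1) :=
  h.continuousOn.comp (f := fun x : ℝ => (t, x)) (by fun_prop) fun _ hs => ⟨ht, hs⟩

/-- Chaining in time, started from the zero initial condition; the areas in `norm_levelArea_le` are
treated in the same way. -/
lemma norm_increment_le (h : IsControlled T α δ q R ψ) (hT : 0 < T) (hR : 0 ≤ R) (hq : 0 ≤ q)
    (hq1 : q < 1) {t : ℝ} (ht : t ∈ Icc 0 T) {m i : ℕ} (hi : i < 2 ^ m) :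
    ‖ψ t ((i + 1 : ℕ) / 2 ^ m) - ψ t (i / 2 ^ m)‖
      ≤ R * (1 / (1 - q)) * ((1 : ℝ) / 2 ^ m) ^ (α + δ) := by
  have := norm_le_of_dyadic_increments hT
    (X := fun t => ψ t ((i + 1 : ℕ) / 2 ^ m) - ψ t (i / 2 ^ m))
    (A := R * ((1 : ℝ) / 2 ^ m) ^ (α + δ))
    ((h.continuousOn_time (grid_mem hi)).sub (h.continuousOn_time (grid_mem hi.le)))
    (by beta_reduce; rw [h.initial m i hi.le, h.initial m (i + 1) hi, sub_zero]) (by positivity) hq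
    hq1 (fun n j hj => h.increment m n i j hi hj) ht
  refine this.trans_eq ?_
  ring

lemma norm_levelArea_le (h : IsControlled T α δ q R ψ) (hT : 0 < T) (hR : 0 ≤ R) (hq : 0 ≤ q)
    (hq1 : q < 1) {t : ℝ} (ht : t ∈ Icc 0 T) {k m i : ℕ} (hm : m ≤ k) (hi : i < 2 ^ m) :
    ‖levelArea k m i (ψ t)‖
      ≤ R * (1 / (1 - q)) * ((1 / 2 : ℝ) ^ δ) ^ k * ((1 : ℝ) / 2 ^ m) ^ (2 * α) := by
  have := norm_le_of_dyadic_increments hT (X := fun t => levelArea k m i (ψ t))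
    (A := R * ((1 / 2 : ℝ) ^ δ) ^ k * ((1 : ℝ) / 2 ^ m) ^ (2 * α))
    (by
      unfold levelArea
      refine continuousOn_finsetSum _ fun l hl => ?_
      exact continuousOn_gridArea (fun x hx => h.continuousOn_time hx) (by omega)
        (levelArea_index_le hm hi (Finset.mem_range.1 hl)))
    (levelArea_eq_zero hm hi h.initial) (by positivity) hq hq1
    (fun n j hj => h.area k m n i j hm hi hj) ht
  refine this.trans_eq ?_
  ring

lemma norm_fst_sub_le (h : IsControlled T α δ q R ψ) (hT : 0 < T) (hα : 0 < α) (hδ : 0 < δ)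
    (hαδ : α + δ ≤ 1) (hq : 0 ≤ q) (hq1 : q < 1) (hR : 0 ≤ R) {t : ℝ} (ht : t ∈ Icc 0 T) (k : ℕ)
    {x y : ℝ} (hx : 0 ≤ x) (hxy : x ≤ y) (hy : y ≤ 1) :
    ‖(naturalLift (dyadicInterp (k + 1) (ψ t))).fst x y
        - (naturalLift (dyadicInterp k (ψ t))).fst x y‖
      ≤ levelConst α q * (R + R ^ 2) * ((1 / 2 : ℝ) ^ δ) ^ k * (y - x) ^ α := by
  refine (norm_fst_dyadicInterp_succ_sub_le hα hδ.le hαδ (fun m i hi =>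
    h.norm_increment_le hT hR hq hq1 ht hi) k hx hxy hy).trans ?_
  have hc : 0 ≤ 1 / (1 - q) := by rw [one_div_nonneg]; linarith
  have h1 := (chainConst_pos hα).le
  have h2 := (chainConst_pos (β := 2 * α) (by positivity)).le
  have h3 : 0 ≤ (y - x) ^ α := Real.rpow_nonneg (by linarith) _
  have h4 : 2 * (R * (1 / (1 - q))) * chainConst α ≤ levelConst α q * (R + R ^ 2) := by
    unfold levelConst
    set c := 1 / (1 - q)
    have h5 : 0 ≤ (c + c ^ 2 + 4 * (c * chainConst α) ^ 2) * chainConst (2 * α) := by positivity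
    have h6 : 0 ≤ 2 * c * chainConst α := by positivity
    nlinarith [mul_nonneg h5 (add_nonneg hR (sq_nonneg R)), mul_nonneg h6 (sq_nonneg R)]
  calc _ = (2 * (R * (1 / (1 - q))) * chainConst α) * ((1 / 2 : ℝ) ^ δ) ^ k * (y - x) ^ α := by ring
    _ ≤ _ := by gcongr

/-- The areas enter linearly in R, the products of first-level increments quadratically; hence R +
R². -/
lemma norm_snd_sub_le (h : IsControlled T α δ q R ψ) (hT : 0 < T) (hα : 0 < α) (hδ : 0 < δ)
    (hαδ : α + δ ≤ 1) (hq : 0 ≤ q) (hq1 : q < 1) (hR : 0 ≤ R) {t : ℝ} (ht : t ∈ Icc 0 T) (k : ℕ)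
    {x y : ℝ} (hx : 0 ≤ x) (hxy : x ≤ y) (hy : y ≤ 1) :
    ‖(naturalLift (dyadicInterp (k + 1) (ψ t))).snd x y
        - (naturalLift (dyadicInterp k (ψ t))).snd x y‖
      ≤ levelConst α q * (R + R ^ 2) * ((1 / 2 : ℝ) ^ δ) ^ k * (y - x) ^ (2 * α) := by
  have hc : 0 ≤ 1 / (1 - q) := by rw [one_div_nonneg]; linarith
  refine (norm_snd_dyadicInterp_succ_sub_le hα hδ.le hαδ (N := R * (1 / (1 - q)))
    (fun m i hi => h.norm_increment_le hT hR hq hq1 ht hi) (by positivity) k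
    (fun m i hm hi => ?_) hx hxy hy).trans ?_
  · rw [snd_dyadicInterp_succ_sub hm hi]
    exact h.norm_levelArea_le hT hR hq hq1 ht hm hi
  have h1 := (chainConst_pos hα).le
  have h2 := (chainConst_pos (β := 2 * α) (by positivity)).le
  have h3 : 0 ≤ (y - x) ^ (2 * α) := Real.rpow_nonneg (by linarith) _
  have h4 : (R * (1 / (1 - q)) + (R * (1 / (1 - q))) ^ 2
      + 4 * (R * (1 / (1 - q)) * chainConst α) ^ 2) * chainConst (2 * α)
      ≤ levelConst α q * (R + R ^ 2) := by
    unfold levelConst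
    set c := 1 / (1 - q)
    have h5 : 0 ≤ c * chainConst (2 * α) := by positivity
    have h6 : 0 ≤ 2 * c * chainConst α := by positivity
    have h7 : 0 ≤ (c ^ 2 + 4 * (c * chainConst α) ^ 2) * chainConst (2 * α) := by positivity
    nlinarith [mul_nonneg h6 (add_nonneg hR (sq_nonneg R)), mul_nonneg h5 (sq_nonneg R),
      mul_nonneg h7 hR]
  calc _ = ((R * (1 / (1 - q)) + (R * (1 / (1 - q))) ^ 2
      + 4 * (R * (1 / (1 - q)) * chainConst α) ^ 2) * chainConst (2 * α))
        * ((1 / 2 : ℝ) ^ δ) ^ k * (y - x) ^ (2 * α) := by ring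
    _ ≤ _ := by gcongr

end IsControlled

/-! ### The limit of the lifts -/

/-- The limit of the natural lifts of the dyadic interpolations. -/
def limitLift {d : ℕ} (a : ℝ → Vec d) : RoughData d where
  init := a 0
  fst x y := a y - a x
  snd x y := limUnder atTop fun k => (naturalLift (dyadicInterp k a)).snd x y

/-- A rate of convergence of the lifts to their limit. -/
def limitConst (α δ q : ℝ) : ℝ := levelConst α q / (1 - (1 / 2 : ℝ) ^ δ)

lemma norm_sub_le_of_geometric {E : Type*} [NormedAddCommGroup E] {f : ℕ → E} {v : E} {A ρ : ℝ}
    (hρ : ρ < 1) (h : ∀ k, ‖f (k + 1) - f k‖ ≤ A * ρ ^ k) (hv : Tendsto f atTop (𝓝 v)) (k : ℕ) :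
    ‖f k - v‖ ≤ A * ρ ^ k / (1 - ρ) := by
  have := dist_le_of_le_geometric_of_tendsto (f := f) ρ A hρ
    (fun n => by rw [dist_comm, dist_eq_norm]; exact h n) hv k
  rwa [dist_eq_norm] at this

namespace IsControlled

variable {d : ℕ} {T α δ q R : ℝ} {ψ : ℝ → ℝ → Vec d}

lemma tendsto_dyadicInterp (h : IsControlled T α δ q R ψ) (hT : 0 < T) (hα : 0 < α) (hδ : 0 < δ)
    (hαδ : α + δ ≤ 1) (hq : 0 ≤ q) (hq1 : q < 1) (hR : 0 ≤ R) {t : ℝ} (ht : t ∈ Icc 0 T)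
    {x : ℝ} (hx : x ∈ Icc (0 : ℝ) 1) :
    Tendsto (fun k => dyadicInterp k (ψ t) x) atTop (𝓝 (ψ t x)) := by
  set j : ℕ → ℕ := fun k => ⌊2 ^ k * x⌋₊ with hj
  have hjx : ∀ k, (j k : ℝ) / 2 ^ k ≤ x := fun k => by
    rw [div_le_iff₀ (by positivity), mul_comm]
    exact Nat.floor_le (mul_nonneg (by positivity) hx.1)
  have hj0 := tendsto_floor_dyadic hx.1
  have h1 : Tendsto (fun k => ψ t (j k / 2 ^ k)) atTop (𝓝 (ψ t x)) :=
    (h.continuousOn_space ht x hx).tendsto.comp (tendsto_nhdsWithin_iff.2 ⟨hj0,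
      Eventually.of_forall fun k => ⟨by positivity, (hjx k).trans hx.2⟩⟩)
  have h2 : Tendsto (fun k => dyadicInterp k (ψ t) x - ψ t (j k / 2 ^ k)) atTop (𝓝 0) := by
    refine squeeze_zero_norm (a := fun k => R * (1 / (1 - q)) * chainConst α
      * (x - j k / 2 ^ k) ^ α) (fun k => ?_) ?_
    · rw [← dyadicInterp_grid k (ψ t) (j k)]
      exact norm_dyadicInterp_sub_le hα hδ.le hαδ
        (fun m i hi => h.norm_increment_le hT hR hq hq1 ht hi) k (by positivity) (hjx k) hx.2
    · have h3 : Tendsto (fun k => x - j k / 2 ^ k) atTop (𝓝 0) := by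
        simpa only [sub_self] using (tendsto_const_nhds (x := x)).sub hj0
      have h4 := (h3.rpow_const (Or.inr hα.le)).const_mul (R * (1 / (1 - q)) * chainConst α)
      rwa [Real.zero_rpow hα.ne', mul_zero] at h4
  simpa using h2.add h1

lemma half_rpow_pos (δ : ℝ) : 0 < (1 / 2 : ℝ) ^ δ := Real.rpow_pos_of_pos (by norm_num) _

lemma tendsto_snd (h : IsControlled T α δ q R ψ) (hT : 0 < T) (hα : 0 < α) (hδ : 0 < δ)
    (hαδ : α + δ ≤ 1) (hq : 0 ≤ q) (hq1 : q < 1) (hR : 0 ≤ R) {t : ℝ} (ht : t ∈ Icc 0 T)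
    {x y : ℝ} (hxy : (x, y) ∈ simplex) :
    Tendsto (fun k => (naturalLift (dyadicInterp k (ψ t))).snd x y) atTop
      (𝓝 ((limitLift (ψ t)).snd x y)) := by
  have hc : CauchySeq fun k => (naturalLift (dyadicInterp k (ψ t))).snd x y := by
    refine cauchySeq_of_le_geometric ((1 / 2 : ℝ) ^ δ)
      (levelConst α q * (R + R ^ 2) * (y - x) ^ (2 * α)) (half_rpow_lt_one hδ) fun k => ?_
    rw [dist_comm, dist_eq_norm]
    refine (h.norm_snd_sub_le hT hα hδ hαδ hq hq1 hR ht k hxy.1 hxy.2.1 hxy.2.2).trans_eq ?_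
    ring
  exact hc.tendsto_limUnder

lemma tendsto_fst (h : IsControlled T α δ q R ψ) (hT : 0 < T) (hα : 0 < α) (hδ : 0 < δ)
    (hαδ : α + δ ≤ 1) (hq : 0 ≤ q) (hq1 : q < 1) (hR : 0 ≤ R) {t : ℝ} (ht : t ∈ Icc 0 T)
    {x y : ℝ} (hxy : (x, y) ∈ simplex) :
    Tendsto (fun k => (naturalLift (dyadicInterp k (ψ t))).fst x y) atTop
      (𝓝 ((limitLift (ψ t)).fst x y)) :=
  (h.tendsto_dyadicInterp hT hα hδ hαδ hq hq1 hR ht ⟨hxy.1.trans hxy.2.1, hxy.2.2⟩).sub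
    (h.tendsto_dyadicInterp hT hα hδ hαδ hq hq1 hR ht ⟨hxy.1, hxy.2.1.trans hxy.2.2⟩)

lemma levelDist_le (h : IsControlled T α δ q R ψ) (hT : 0 < T) (hα : 0 < α) (hδ : 0 < δ)
    (hαδ : α + δ ≤ 1) (hq : 0 ≤ q) (hq1 : q < 1) (hR : 0 ≤ R) (k : ℕ) :
    levelDist α T (fun t => naturalLift (dyadicInterp k (ψ t))) (fun t => limitLift (ψ t))
      ≤ 2 * ENNReal.ofReal (limitConst α δ q * (R + R ^ 2) * ((1 / 2 : ℝ) ^ δ) ^ k) := by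
  rw [two_mul]
  refine add_le_add (iSup₂_le fun t ht => holderNorm_le fun x y hx hxy hy => ?_)
    (iSup₂_le fun t ht => holderNorm_le fun x y hx hxy hy => ?_)
  · refine (norm_sub_le_of_geometric (A := levelConst α q * (R + R ^ 2) * (y - x) ^ α)
      (half_rpow_lt_one hδ) (fun k => ?_)
      (h.tendsto_fst hT hα hδ hαδ hq hq1 hR ht ⟨hx, hxy.le, hy⟩) k).trans_eq ?_
    · exact (h.norm_fst_sub_le hT hα hδ hαδ hq hq1 hR ht k hx hxy.le hy).trans_eq (by ring)
    · unfold limitConst; ring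
  · refine (norm_sub_le_of_geometric (A := levelConst α q * (R + R ^ 2) * (y - x) ^ (2 * α))
      (half_rpow_lt_one hδ) (fun k => ?_)
      (h.tendsto_snd hT hα hδ hαδ hq hq1 hR ht ⟨hx, hxy.le, hy⟩) k).trans_eq ?_
    · exact (h.norm_snd_sub_le hT hα hδ hαδ hq hq1 hR ht k hx hxy.le hy).trans_eq (by ring)
    · unfold limitConst; ring

lemma pathDist_eq (k : ℕ) :
    pathDist α T (fun t => naturalLift (dyadicInterp k (ψ t))) (fun t => limitLift (ψ t))
      = levelDist α T (fun t => naturalLift (dyadicInterp k (ψ t))) (fun t => limitLift (ψ t)) := by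
  have : ∀ t, (naturalLift (dyadicInterp k (ψ t))).init = (limitLift (ψ t)).init := fun t => by
    simpa [naturalLift, limitLift] using dyadicInterp_grid k (ψ t) 0
  simp [pathDist, this]

lemma tendsto_pathDist (h : IsControlled T α δ q R ψ) (hT : 0 < T) (hα : 0 < α) (hδ : 0 < δ)
    (hαδ : α + δ ≤ 1) (hq : 0 ≤ q) (hq1 : q < 1) (hR : 0 ≤ R) :
    Tendsto (fun k => pathDist α T (fun t => naturalLift (dyadicInterp k (ψ t)))
      (fun t => limitLift (ψ t))) atTop (𝓝 0) := by
  simp_rw [pathDist_eq]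
  refine tendsto_of_tendsto_of_tendsto_of_le_of_le tendsto_const_nhds ?_ (fun _ => zero_le)
    fun k => h.levelDist_le hT hα hδ hαδ hq hq1 hR k
  have h1 := (tendsto_pow_atTop_nhds_zero_of_lt_one (half_rpow_pos δ).le
    (half_rpow_lt_one hδ)).const_mul (limitConst α δ q * (R + R ^ 2))
  have h2 := ENNReal.Tendsto.const_mul (a := 2) (ENNReal.tendsto_ofReal h1) (Or.inr (by simp))
  simpa using h2

end IsControlled

/-- Closedness of the space of paths of geometric rough paths. -/
lemma isGeometricPath_of_tendsto {d : ℕ} {α T : ℝ} (hα : 0 < α) {A : ℕ → ℝ → RoughData d}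
    {B : ℝ → RoughData d} (hA : ∀ k, IsGeometricPath α T (A k))
    (h1 : ∀ t ∈ Icc 0 T, ∀ x y, (x, y) ∈ simplex →
      Tendsto (fun k => (A k t).fst x y) atTop (𝓝 ((B t).fst x y)))
    (h2 : ∀ t ∈ Icc 0 T, ∀ x y, (x, y) ∈ simplex →
      Tendsto (fun k => (A k t).snd x y) atTop (𝓝 ((B t).snd x y)))
    (h : Tendsto (fun k => pathDist α T (A k) B) atTop (𝓝 0)) : IsGeometricPath α T B := by
  have hclose : ∀ ε : ℝ≥0∞, 0 < ε → ∃ k, pathDist α T (A k) B < ε := fun ε hε =>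
    (h.eventually (gt_mem_nhds hε)).exists
  -- On [0,1] convergence in Hölder norm implies uniform convergence off the diagonal. The Hölder
  -- norm does not see the diagonal, so agreement there is a separate assumption.
  have hunif : ∀ {E : Type} [NormedAddCommGroup E] {β : ℝ} (_ : 0 < β) {a : ℕ → ℝ → ℝ → E}
      {b : ℝ → ℝ → E}, (∀ k, ContinuousOn (fun p : ℝ × ℝ => a k p.1 p.2) simplex) →
      (∀ x ∈ Icc (0 : ℝ) 1, ∀ k, a k x x = b x x) →
      Tendsto (fun k => holderNorm β (fun x y => a k x y - b x y)) atTop (𝓝 0) →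
      ContinuousOn (fun p : ℝ × ℝ => b p.1 p.2) simplex := by
    intro E _ β hβ a b hc hd ht
    refine TendstoUniformlyOn.continuousOn (p := atTop) (F := fun k (p : ℝ × ℝ) => a k p.1 p.2) ?_
      (Frequently.of_forall hc)
    rw [Metric.tendstoUniformlyOn_iff]
    intro ε hε
    have hε' : 0 < ENNReal.ofReal (ε / 2) := ENNReal.ofReal_pos.2 (by linarith)
    filter_upwards [ht.eventually (gt_mem_nhds hε')] with k hk p hp
    rw [dist_comm, dist_eq_norm]
    rcases eq_or_lt_of_le hp.2.1 with h3 | h3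
    · rw [← h3, hd _ ⟨hp.1, h3 ▸ hp.2.2⟩]; simpa using hε
    · have := norm_le_of_holderNorm_le (by positivity) hk.le hp.1 h3 hp.2.2
      have h4 : (p.2 - p.1) ^ β ≤ 1 :=
        Real.rpow_le_one (by linarith) (by linarith [hp.1, hp.2.2]) hβ.le
      have h5 : ε / 2 * (p.2 - p.1) ^ β ≤ ε / 2 * 1 := by gcongr
      linarith
  have hlevel : ∀ t ∈ Icc 0 T, Tendsto (fun k => roughDist α (A k t) (B t)) atTop (𝓝 0) :=
    fun t ht => tendsto_of_tendsto_of_tendsto_of_le_of_le tendsto_const_nhds h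
      (fun _ => zero_le) fun k => roughDist_le_pathDist ht
  have hl1 : ∀ t ∈ Icc 0 T, Tendsto (fun k =>
      holderNorm α (fun x y => (A k t).fst x y - (B t).fst x y)) atTop (𝓝 0) := fun t ht =>
    tendsto_of_tendsto_of_tendsto_of_le_of_le tendsto_const_nhds (hlevel t ht)
      (fun _ => zero_le) fun k => le_add_right le_add_self
  have hl2 : ∀ t ∈ Icc 0 T, Tendsto (fun k =>
      holderNorm (2 * α) (fun x y => (A k t).snd x y - (B t).snd x y)) atTop (𝓝 0) := fun t ht =>
    tendsto_of_tendsto_of_tendsto_of_le_of_le tendsto_const_nhds (hlevel t ht)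
      (fun _ => zero_le) fun k => le_add_self
  have hd1 : ∀ k, ∀ t ∈ Icc 0 T, ∀ x ∈ Icc (0 : ℝ) 1, (A k t).fst x x = 0 := fun k t ht x hx => by
    have := ((hA k).1 t ht).1.chen_fst x x x hx.1 le_rfl le_rfl hx.2
    simpa using this
  have hd2 : ∀ k, ∀ t ∈ Icc 0 T, ∀ x ∈ Icc (0 : ℝ) 1, (A k t).snd x x = 0 := fun k t ht x hx => by
    have := ((hA k).1 t ht).1.chen_snd x x x hx.1 le_rfl le_rfl hx.2
    rw [hd1 k t ht x hx, tensor_zero_left] at this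
    simpa using this
  have hmem : ∀ {x y : ℝ}, 0 ≤ x → x ≤ y → y ≤ 1 → (x, y) ∈ simplex := fun h1 h2 h3 => ⟨h1, h2, h3⟩
  have hfin : ∀ {E : Type} [NormedAddCommGroup E] {β : ℝ} {a : ℕ → ℝ → ℝ → E}
      {b : ℝ → ℝ → E}, (∀ k, holderNorm β (a k) < ⊤) →
      Tendsto (fun k => holderNorm β (fun x y => a k x y - b x y)) atTop (𝓝 0) →
      holderNorm β b < ⊤ := by
    intro E _ β a b hf ht
    obtain ⟨k, hk⟩ := (ht.eventually (gt_mem_nhds ENNReal.zero_lt_top)).exists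
    have e : holderNorm β b = holderNorm β (fun x y => (b x y - a k x y) + a k x y) :=
      holderNorm_congr fun x y _ _ _ => by simp
    rw [e]
    refine holderNorm_add_le.trans_lt (ENNReal.add_lt_top.2 ⟨?_, hf k⟩)
    rw [holderNorm_sub_comm]; exact hk
  refine ⟨fun t ht => ⟨⟨?_, ?_, ?_, ?_, ?_, ?_⟩, fun ε hε => ?_⟩, fun t ht => ?_⟩
  · refine hunif hα (fun k => ((hA k).1 t ht).1.continuousOn_fst) (fun x hx k => ?_) (hl1 t ht)
    rw [hd1 k t ht x hx]
    refine tendsto_nhds_unique ?_ (h1 t ht x x (hmem hx.1 le_rfl hx.2))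
    simp_rw [hd1 _ t ht x hx]; exact tendsto_const_nhds
  · refine hunif (by positivity : 0 < 2 * α) (fun k => ((hA k).1 t ht).1.continuousOn_snd)
      (fun x hx k => ?_) (hl2 t ht)
    rw [hd2 k t ht x hx]
    refine tendsto_nhds_unique ?_ (h2 t ht x x (hmem hx.1 le_rfl hx.2))
    simp_rw [hd2 _ t ht x hx]; exact tendsto_const_nhds
  · intro x z y hx hxz hzy hy
    refine tendsto_nhds_unique (h1 t ht x y (hmem hx (hxz.trans hzy) hy)) ?_
    refine ((h1 t ht x z (hmem hx hxz (hzy.trans hy))).add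
      (h1 t ht z y (hmem (hx.trans hxz) hzy hy))).congr fun k => ?_
    exact (((hA k).1 t ht).1.chen_fst x z y hx hxz hzy hy).symm
  · intro x z y hx hxz hzy hy
    have m1 := hmem hx hxz (hzy.trans hy)
    have m2 := hmem (hx.trans hxz) hzy hy
    refine tendsto_nhds_unique (h2 t ht x y (hmem hx (hxz.trans hzy) hy)) ?_
    refine (((h2 t ht x z m1).add (h2 t ht z y m2)).add
      ((continuous_tensor.tendsto _).comp
        ((h1 t ht x z m1).prodMk_nhds (h1 t ht z y m2)))).congr fun k => ?_
    exact (((hA k).1 t ht).1.chen_snd x z y hx hxz hzy hy).symm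
  · exact hfin (fun k => ((hA k).1 t ht).1.holder_fst) (hl1 t ht)
  · exact hfin (fun k => ((hA k).1 t ht).1.holder_snd) (hl2 t ht)
  · have hε2 : 0 < ε / 2 := ENNReal.half_pos hε.ne'
    obtain ⟨k, hk⟩ := hclose _ hε2
    obtain ⟨a, ha, hak⟩ := ((hA k).1 t ht).2 _ hε2
    refine ⟨a, ha, (roughDist_triangle (B := A k t)).trans_lt ?_⟩
    rw [← ENNReal.add_halves ε]
    refine ENNReal.add_lt_add ?_ hak
    rw [roughDist_comm]
    exact (roughDist_le_pathDist ht).trans_lt hk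
  · rw [ENNReal.tendsto_nhds_zero]
    intro ε hε
    have hε3 : 0 < ε / 3 := ENNReal.div_pos hε.ne' (by simp)
    obtain ⟨k, hk⟩ := hclose _ hε3
    have h5 := (ENNReal.tendsto_nhds_zero.1 ((hA k).2 t ht)) _ hε3
    filter_upwards [h5, self_mem_nhdsWithin] with s hs hsT
    calc roughDist α (B s) (B t)
        ≤ roughDist α (B s) (A k s) + (roughDist α (A k s) (A k t) + roughDist α (A k t) (B t)) :=
          roughDist_triangle.trans (add_le_add le_rfl roughDist_triangle)
      _ ≤ ε / 3 + (ε / 3 + ε / 3) := by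
          refine add_le_add ?_ (add_le_add hs ((roughDist_le_pathDist ht).trans hk.le))
          rw [roughDist_comm]
          exact (roughDist_le_pathDist hsT).trans hk.le
      _ = ε := by rw [← add_assoc, ENNReal.add_thirds]

lemma IsControlled.isGeometricPath_limitLift {d : ℕ} {T α δ q R : ℝ} {ψ : ℝ → ℝ → Vec d}
    (h : IsControlled T α δ q R ψ) (hT : 0 < T) (hα : 0 < α) (hδ : 0 < δ)
    (hαδ : α + δ ≤ 1) (hq : 0 ≤ q) (hq1 : q < 1) (hR : 0 ≤ R) :
    IsGeometricPath α T fun t => limitLift (ψ t) :=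
  isGeometricPath_of_tendsto hα
    (fun k => isGeometricPath_naturalLift_dyadicInterp (by linarith) h.continuousOn k)
    (fun _ ht _ _ hxy => h.tendsto_fst hT hα hδ hαδ hq hq1 hR ht hxy)
    (fun _ ht _ _ hxy => h.tendsto_snd hT hα hδ hαδ hq hq1 hR ht hxy)
    (h.tendsto_pathDist hT hα hδ hαδ hq hq1 hR)

/-! ### Random control of the solution -/

/-- There are 2^m 2^n rectangles of level (m,n). The factors 2m and 2n in the exponent leave, after
counting, the convergent sum of 2^(-k-m-n). -/
lemma exists_dyadic_bound {Ω κ : Type*} [MeasurableSpace Ω] {P : Measure Ω} [Fintype κ]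
    (V : ℕ → ℕ → ℕ → ℕ → ℕ → κ → Ω → ℝ)
    (hV : ∀ k m n i j c, i < 2 ^ m → j < 2 ^ n → AEMeasurable (V k m n i j c) P) {p : ℕ}
    (hp : p ≠ 0) {B : ℝ≥0∞} (hB : B ≠ ⊤)
    (hVB : ∀ k m n i j c, i < 2 ^ m → j < 2 ^ n →
      ∫⁻ ω, ‖V k m n i j c ω‖ₑ ^ p ∂P ≤ B * ENNReal.ofReal (2 ^ (-(k + 2 * m + 2 * n : ℝ)))) :
    ∃ R : Ω → ℝ, (∀ ω, 0 ≤ R ω) ∧ ∫⁻ ω, ENNReal.ofReal (R ω) ^ p ∂P < ⊤ ∧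
      ∀ᵐ ω ∂P, ∀ k m n i j c, i < 2 ^ m → j < 2 ^ n → |V k m n i j c ω| ≤ R ω := by
  have hterm : ∀ q : ℕ × ℕ × ℕ, ∑' s : Fin (2 ^ q.2.1) × Fin (2 ^ q.2.2) × κ,
      ∫⁻ ω, ‖V q.1 q.2.1 q.2.2 s.1 s.2.1 s.2.2 ω‖ₑ ^ p ∂P
      ≤ Fintype.card κ * B * (2⁻¹ ^ q.1 * (2⁻¹ ^ q.2.1 * 2⁻¹ ^ q.2.2)) := by
    rintro ⟨k, m, n⟩
    rw [tsum_fintype]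
    refine (Finset.sum_le_card_nsmul _ _ _ fun s _ => hVB k m n _ _ s.2.2 s.1.2 s.2.1.2).trans ?_
    simp only [Finset.card_univ, Fintype.card_prod, Fintype.card_fin, nsmul_eq_mul]
    have e : (((2 ^ m * (2 ^ n * Fintype.card κ) : ℕ) : ℝ≥0∞))
        = Fintype.card κ * ENNReal.ofReal (2 ^ m * 2 ^ n) := by
      rw [ENNReal.ofReal_mul (by positivity), ENNReal.ofReal_pow (by norm_num),
        ENNReal.ofReal_pow (by norm_num)]
      push_cast
      rw [ENNReal.ofReal_ofNat]
      ring
    have e2 : (2⁻¹ ^ k * (2⁻¹ ^ m * 2⁻¹ ^ n) : ℝ≥0∞)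
        = ENNReal.ofReal (2⁻¹ ^ k * (2⁻¹ ^ m * 2⁻¹ ^ n)) := by
      rw [ENNReal.ofReal_mul (by positivity), ENNReal.ofReal_mul (by positivity),
        ENNReal.ofReal_pow (by norm_num), ENNReal.ofReal_pow (by norm_num),
        ENNReal.ofReal_pow (by norm_num), ENNReal.ofReal_inv_of_pos (by norm_num),
        ENNReal.ofReal_ofNat]
    rw [e, e2]
    refine le_of_eq ?_
    have e3 : (2 : ℝ) ^ m * 2 ^ n * 2 ^ (-(k + 2 * m + 2 * n : ℝ))
        = 2⁻¹ ^ k * (2⁻¹ ^ m * 2⁻¹ ^ n) := by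
      rw [Real.rpow_neg (by norm_num)]
      have : (2 : ℝ) ^ (k + 2 * m + 2 * n : ℝ) = 2 ^ k * (2 ^ m * 2 ^ m) * (2 ^ n * 2 ^ n) := by
        have : (k + 2 * m + 2 * n : ℝ) = ((k + 2 * m + 2 * n : ℕ) : ℝ) := by push_cast; ring
        rw [this, Real.rpow_natCast]; ring
      rw [this, inv_pow, inv_pow, inv_pow]
      field_simp
    rw [← e3, ENNReal.ofReal_mul (by positivity) (q := 2 ^ (-(k + 2 * m + 2 * n : ℝ)))]
    ring
  obtain ⟨R, h1, h2, h3⟩ := exists_common_bound (P := P)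
    (ι := Σ q : ℕ × ℕ × ℕ, Fin (2 ^ q.2.1) × Fin (2 ^ q.2.2) × κ)
    (fun q ω => V q.1.1 q.1.2.1 q.1.2.2 q.2.1 q.2.2.1 q.2.2.2 ω)
    (fun q => hV _ _ _ _ _ _ q.2.1.2 q.2.2.1.2) hp (by
      rw [ENNReal.tsum_sigma']
      refine (ENNReal.tsum_le_tsum hterm).trans_lt ?_
      rw [ENNReal.tsum_mul_left, ENNReal.tsum_prod']
      simp_rw [ENNReal.tsum_mul_left]
      rw [ENNReal.tsum_mul_right, ENNReal.tsum_prod']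
      simp_rw [ENNReal.tsum_mul_left]
      rw [ENNReal.tsum_mul_right, ENNReal.tsum_geometric, ENNReal.one_sub_inv_two, inv_inv]
      exact ENNReal.mul_lt_top (ENNReal.mul_lt_top (by simp) hB.lt_top) (by norm_num))
  refine ⟨R, h1, h2, ?_⟩
  filter_upwards [h3] with ω hω k m n i j c hi hj
  exact hω ⟨(k, m, n), ⟨i, hi⟩, ⟨j, hj⟩, c⟩

/-- Bookkeeping of exponents: the weighted variance is at most D 2^e, and the power r multiplies e.
In the applications e is negative, and r is taken large enough to pay for the summation over all
rectangles. -/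
lemma lintegral_weighted_le {Ω : Type*} [MeasurableSpace Ω] {P : Measure Ω} {X : Ω → ℝ} {r : ℕ}
    {c : ℝ≥0∞} {B w D e s : ℝ} (h : ∫⁻ ω, ‖X ω‖ₑ ^ (2 * r) ∂P ≤ c * ENNReal.ofReal B ^ r)
    (hw : 0 ≤ w) (hD : 0 ≤ D) (hB : w ^ 2 * B ≤ D * 2 ^ e) (he : e * r ≤ s) :
    ∫⁻ ω, ‖w * X ω‖ₑ ^ (2 * r) ∂P
      ≤ c * ENNReal.ofReal (D ^ r) * ENNReal.ofReal (2 ^ s) := by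
  simp_rw [enorm_mul, mul_pow]
  rw [lintegral_const_mul' _ _ (by simp)]
  calc ‖w‖ₑ ^ (2 * r) * ∫⁻ ω, ‖X ω‖ₑ ^ (2 * r) ∂P
      ≤ ‖w‖ₑ ^ (2 * r) * (c * ENNReal.ofReal B ^ r) := by gcongr
    _ = c * ENNReal.ofReal (w ^ 2 * B) ^ r := by
        rw [ENNReal.ofReal_mul (by positivity), ENNReal.ofReal_pow hw, Real.enorm_of_nonneg hw]
        ring
    _ ≤ c * ENNReal.ofReal (D * 2 ^ e) ^ r := by gcongr
    _ = c * ENNReal.ofReal (D ^ r * 2 ^ (e * r)) := by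
        rw [← ENNReal.ofReal_pow (by positivity), mul_pow, Real.rpow_mul_natCast (by norm_num)]
    _ ≤ c * ENNReal.ofReal (D ^ r * 2 ^ s) := by
        gcongr
        norm_num
    _ = _ := by rw [ENNReal.ofReal_mul (by positivity)]; ring

lemma one_div_two_pow_rpow (m : ℕ) (β : ℝ) : ((1 : ℝ) / 2 ^ m) ^ β = 2 ^ (-(β * m)) := by
  rw [one_div, Real.inv_rpow (by positivity), Real.rpow_neg (by norm_num), mul_comm,
    Real.rpow_mul (by norm_num), Real.rpow_natCast]

lemma half_rpow_pow_eq (n : ℕ) (γ : ℝ) : ((1 / 2 : ℝ) ^ γ) ^ n = 2 ^ (-(γ * n)) := by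
  rw [← half_rpow_pow, one_div_two_pow_rpow]

lemma abs_le_of_weighted {w x R : ℝ} {e : ℝ} (hw : w = 2 ^ e) (h : |w * x| ≤ R) :
    |x| ≤ R * 2 ^ (-e) := by
  have h0 : 0 < w := by rw [hw]; positivity
  rw [abs_mul, abs_of_pos h0] at h
  rw [Real.rpow_neg (by norm_num), ← hw, ← div_eq_mul_inv, le_div_iff₀ h0, mul_comm]
  exact h

lemma norm_le_of_abs_le {ι : Type*} [Fintype ι] {v : EuclideanSpace ℝ ι} {B : ℝ} (hB : 0 ≤ B)
    (h : ∀ i, |v i| ≤ B) : ‖v‖ ≤ Fintype.card ι * B := by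
  have h1 : ‖v‖ ^ 2 ≤ (Fintype.card ι * B) ^ 2 := by
    rw [EuclideanSpace.norm_sq_eq]
    calc ∑ i, ‖v i‖ ^ 2 ≤ ∑ _i : ι, B ^ 2 := by
          gcongr with i; exact h i
      _ = Fintype.card ι * B ^ 2 := by simp
      _ ≤ (Fintype.card ι) ^ 2 * B ^ 2 := by
          gcongr
          have : Fintype.card ι ≤ Fintype.card ι ^ 2 := Nat.le_self_pow two_ne_zero _
          exact_mod_cast this
      _ = _ := by ring
  exact (pow_le_pow_iff_left₀ (norm_nonneg _) (by positivity) two_ne_zero).1 h1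

/-! ### Weighted moments over dyadic rectangles -/

section Moments

variable {Ω : Type*} [MeasurableSpace Ω] {P : Measure Ω} {T : ℝ} {d : ℕ}
  {ξ : Fin d → Lp ℝ 2 (spaceTime T) → Ω → ℝ} {ψ : ℝ → ℝ → Ω → Vec d}
  {g : ℝ → ℝ → Lp ℝ 2 (spaceTime T)}

lemma IsKernelMap.exists_norm_sub_time (hg : IsKernelMap T g) :
    ∃ C : ℝ, 0 ≤ C ∧ ∀ s ∈ Icc 0 T, ∀ t ∈ Icc 0 T, s ≤ t → ∀ x ∈ Icc (0 : ℝ) 1,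
      ‖g t x - g s x‖ ^ 2 ≤ C * (t - s) ^ (1 / 4 : ℝ) := by
  obtain ⟨C, hC, h⟩ := exists_norm_mildKernel_sub_time T
  exact ⟨C, hC, fun s hs t ht hst x hx => h s t x hs.1 hst ht.2 _ _ (hg t ht x hx) (hg s hs x hx)⟩

lemma norm_sub_sq_le_two {E : Type*} [SeminormedAddCommGroup E] {x y : E} {B : ℝ}
    (hx : ‖x‖ ^ 2 ≤ B) (hy : ‖y‖ ^ 2 ≤ B) : ‖x - y‖ ^ 2 ≤ 4 * B := by
  have := norm_sub_le x y
  nlinarith [norm_nonneg x, norm_nonneg y, norm_nonneg (x - y), sq_nonneg (‖x‖ - ‖y‖)]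

lemma time_grid_mem (hT : 0 < T) {n j : ℕ} (hj : j ≤ 2 ^ n) : (j : ℝ) * T / 2 ^ n ∈ Icc 0 T := by
  refine ⟨by positivity, ?_⟩
  rw [div_le_iff₀ (by positivity), mul_comm]
  have : (j : ℝ) ≤ 2 ^ n := by exact_mod_cast hj
  gcongr

lemma time_grid_le (hT : 0 < T) (n j : ℕ) : (j : ℝ) * T / 2 ^ n ≤ (j + 1 : ℕ) * T / 2 ^ n := by
  push_cast; gcongr; linarith

lemma time_grid_sub (n j : ℕ) : ((j + 1 : ℕ) : ℝ) * T / 2 ^ n - j * T / 2 ^ n = T * (1 / 2 ^ n) := by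
  push_cast; ring

/-- Weighted moments of the space-time increments of the solution over dyadic rectangles. -/
lemma lintegral_dyadic_increment_le (hξ : IsWhiteNoise P T ξ) (hg : IsKernelMap T g)
    (hr : IsRepresentedBy P ξ ψ g) (hT : 0 < T) {C : ℝ} (hC : 0 ≤ C)
    (hgC : ∀ s ∈ Icc 0 T, ∀ t ∈ Icc 0 T, s ≤ t → ∀ x ∈ Icc (0 : ℝ) 1,
      ‖g t x - g s x‖ ^ 2 ≤ C * (t - s) ^ (1 / 4 : ℝ))
    {δ : ℝ} (hδ : 0 < δ) (hδ1 : δ ≤ 1 / 24) {r : ℕ} (hδr : 16 ≤ δ * r) {m n i j : ℕ}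
    (hi : i < 2 ^ m) (hj : j < 2 ^ n) (p : Fin d) :
    ∫⁻ ω, ‖(2 : ℝ) ^ ((1 / 2 - 3 * δ) * m + δ / 16 * n)
      * ((ψ ((j + 1 : ℕ) * T / 2 ^ n) ((i + 1 : ℕ) / 2 ^ m) ω
          - ψ ((j + 1 : ℕ) * T / 2 ^ n) (i / 2 ^ m) ω) p
        - (ψ (j * T / 2 ^ n) ((i + 1 : ℕ) / 2 ^ m) ω - ψ (j * T / 2 ^ n) (i / 2 ^ m) ω) p)‖ₑ
        ^ (2 * r) ∂P
      ≤ gaussMoment (2 * r) * ENNReal.ofReal ((4 * (4 * (C * T ^ (1 / 4 : ℝ))) ^ δ) ^ r)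
        * ENNReal.ofReal (2 ^ (-(2 * m + 2 * n : ℝ))) := by
  set s := (j : ℝ) * T / 2 ^ n with hs
  set t := ((j + 1 : ℕ) : ℝ) * T / 2 ^ n with ht
  have hsm : s ∈ Icc 0 T := time_grid_mem hT hj.le
  have htm : t ∈ Icc 0 T := time_grid_mem hT hj
  have hx := grid_mem hi.le
  have hy := grid_mem hi
  have hxy : (i : ℝ) / 2 ^ m ≤ (i + 1 : ℕ) / 2 ^ m := grid_le (Nat.le_succ i)
  have hlen : ((i + 1 : ℕ) : ℝ) / 2 ^ m - i / 2 ^ m = 1 / 2 ^ m := by push_cast; ring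
  have hts : C * (t - s) ^ (1 / 4 : ℝ) = C * T ^ (1 / 4 : ℝ) * 2 ^ (-(1 / 4 * n : ℝ)) := by
    rw [ht, hs, time_grid_sub, Real.mul_rpow hT.le (by positivity), one_div_two_pow_rpow, mul_assoc]
  have h1 := lintegral_increment_le hξ hr hsm htm hx hy (B := 4 * 2 ^ (-(m : ℝ))) (by
    refine norm_sub_sq_le_two ?_ ?_
    · refine (hg.norm_sub_space htm hx.1 hxy hy.2).trans_eq ?_
      rw [hlen, Real.rpow_neg (by norm_num), Real.rpow_natCast, one_div]
    · refine (hg.norm_sub_space hsm hx.1 hxy hy.2).trans_eq ?_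
      rw [hlen, Real.rpow_neg (by norm_num), Real.rpow_natCast, one_div]) p r
  have h2 := lintegral_increment_le hξ hr hsm htm hx hy
    (B := 4 * (C * T ^ (1 / 4 : ℝ) * 2 ^ (-(1 / 4 * n : ℝ)))) (by
    rw [sub_sub_sub_comm]
    refine norm_sub_sq_le_two ?_ ?_
    · exact (hgC s hsm t htm (time_grid_le hT n j) _ hy).trans_eq hts
    · exact (hgC s hsm t htm (time_grid_le hT n j) _ hx).trans_eq hts) p r
  -- Interpolation with θ = δ bounds the variance by a constant times 2^(-(1-δ)m - δn/4). After
  -- multiplication by the squared weight the exponent -(5δm + δn/8) is left.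
  have h3 := le_of_le_of_le_interpolate (by positivity) (by positivity) hδ.le (by linarith) h1 h2
  refine lintegral_weighted_le (e := -(5 * δ * m + δ / 8 * n)) h3 (by positivity) (by positivity)
    ?_ ?_
  · rw [Real.mul_rpow (by norm_num) (by positivity), ← mul_assoc 4,
      Real.mul_rpow (x := 4 * (C * T ^ (1 / 4 : ℝ))) (by positivity) (by positivity),
      ← Real.rpow_mul (by norm_num), ← Real.rpow_mul (by norm_num), ← Real.rpow_mul_natCast
      (by norm_num)]
    have h4 : (4 : ℝ) ^ (1 - δ) ≤ 4 := by
      calc (4 : ℝ) ^ (1 - δ) ≤ 4 ^ (1 : ℝ) :=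
            Real.rpow_le_rpow_of_exponent_le (by norm_num) (by linarith)
        _ = 4 := Real.rpow_one 4
    calc _ = ((4 : ℝ) ^ (1 - δ) * (4 * (C * T ^ (1 / 4 : ℝ))) ^ δ)
          * (2 ^ (((1 / 2 - 3 * δ) * m + δ / 16 * n) * (2 : ℕ)) * 2 ^ (-(m : ℝ) * (1 - δ))
          * 2 ^ (-(1 / 4 * n : ℝ) * δ)) := by ring
      _ ≤ (4 * (4 * (C * T ^ (1 / 4 : ℝ))) ^ δ) * (2 ^ (((1 / 2 - 3 * δ) * m + δ / 16 * n) * (2 : ℕ))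
          * 2 ^ (-(m : ℝ) * (1 - δ)) * 2 ^ (-(1 / 4 * n : ℝ) * δ)) := by gcongr
      _ = _ := by
        rw [← Real.rpow_add (by norm_num), ← Real.rpow_add (by norm_num)]
        congr 2
        push_cast; ring
  -- The constant 16 is what makes r δ/8 at least 2 in the time direction; in space there is room to
  -- spare.
  · have hm0 : (0 : ℝ) ≤ m := Nat.cast_nonneg m
    have hn0 : (0 : ℝ) ≤ n := Nat.cast_nonneg n
    nlinarith [mul_le_mul_of_nonneg_right hδr hm0, mul_le_mul_of_nonneg_right hδr hn0]

/-- Weighted moments of the time increments of the areas. -/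
lemma lintegral_levelArea_le (hξ : IsWhiteNoise P T ξ) (hg : IsKernelMap T g)
    (hr : IsRepresentedBy P ξ ψ g) (hT : 0 < T) {C : ℝ} (hC : 0 ≤ C)
    (hgC : ∀ s ∈ Icc 0 T, ∀ t ∈ Icc 0 T, s ≤ t → ∀ x ∈ Icc (0 : ℝ) 1,
      ‖g t x - g s x‖ ^ 2 ≤ C * (t - s) ^ (1 / 4 : ℝ))
    {δ : ℝ} (hδ : 0 < δ) (hδ1 : δ ≤ 1 / 24) {r : ℕ} (hr0 : r ≠ 0) (hδr : 16 ≤ δ * r)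
    {k m n i j : ℕ} (hm : m ≤ k) (hi : i < 2 ^ m) (hj : j < 2 ^ n) (p : Fin d × Fin d) :
    ∫⁻ ω, ‖(2 : ℝ) ^ (δ * k + (1 - 8 * δ) * m + δ / 16 * n)
      * (levelArea k m i (fun x => ψ ((j + 1 : ℕ) * T / 2 ^ n) x ω) p
        - levelArea k m i (fun x => ψ (j * T / 2 ^ n) x ω) p)‖ₑ ^ (2 * r) ∂P
      ≤ (2 ^ (2 * r) * 2 * gaussMoment (2 * r) ^ 2)
        * ENNReal.ofReal ((2 * (64 * (C * T ^ (1 / 4 : ℝ))) ^ δ) ^ r)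
        * ENNReal.ofReal (2 ^ (-(k + 2 * m + 2 * n : ℝ))) := by
  obtain ⟨p, p'⟩ := p
  set s := (j : ℝ) * T / 2 ^ n with hs
  set t := ((j + 1 : ℕ) : ℝ) * T / 2 ^ n with ht
  have hsm : s ∈ Icc 0 T := time_grid_mem hT hj.le
  have htm : t ∈ Icc 0 T := time_grid_mem hT hj
  have hts : C * (t - s) ^ (1 / 4 : ℝ) = C * T ^ (1 / 4 : ℝ) * 2 ^ (-(1 / 4 * n : ℝ)) := by
    rw [ht, hs, time_grid_sub, Real.mul_rpow hT.le (by positivity), one_div_two_pow_rpow, mul_assoc]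
  have hn : Monotone fun l : ℕ => 2 * (i * 2 ^ (k - m) + l) := fun a b h => by
    simp only; omega
  have hL : 2 * (i * 2 ^ (k - m) + 2 ^ (k - m)) ≤ 2 ^ (k + 1) := by
    have := levelArea_index_le hm hi (l := 2 ^ (k - m) - 1)
      (Nat.sub_lt (by positivity) one_pos)
    rwa [Nat.sub_add_cancel Nat.one_le_two_pow] at this
  have h1 := lintegral_blockArea_sub_le' hξ hg hr hsm htm (k + 1) hn hL p p' hr0
  have h2 := (lintegral_blockArea_sub_le hξ hg hr hsm htm
    (fun x hx => (hgC s hsm t htm (time_grid_le hT n j) x hx).trans_eq hts) (k + 1) hn hL p p'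
    hr0).trans (show _ ≤ 2 ^ (2 * r) * 2 * gaussMoment (2 * r) ^ 2 * ENNReal.ofReal
      (16 * 4 ^ (k + 1) * (C * T ^ (1 / 4 : ℝ) * 2 ^ (-(1 / 4 * n : ℝ)))) ^ r by
      gcongr
      refine le_mul_of_one_le_left zero_le ?_
      exact one_le_mul (one_le_pow₀ (by norm_num)) (by norm_num))
  have hsum : (2 * ∑ l ∈ Finset.range (2 ^ (k - m)),
      ((((2 * (i * 2 ^ (k - m) + (l + 1)) : ℕ) : ℝ) - (2 * (i * 2 ^ (k - m) + l) : ℕ))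
        / 2 ^ (k + 1)) ^ 2) = 2 * 2 ^ (-(k + m : ℝ)) := by
    have : ∀ l : ℕ, ((((2 * (i * 2 ^ (k - m) + (l + 1)) : ℕ) : ℝ) - (2 * (i * 2 ^ (k - m) + l) : ℕ))
        / 2 ^ (k + 1)) ^ 2 = (1 / 2 ^ k) ^ 2 := fun l => by
      rw [pow_succ _ k]; push_cast; field_simp; ring
    simp_rw [this]
    obtain ⟨e, rfl⟩ := Nat.exists_eq_add_of_le hm
    have e1 : (2 : ℝ) ^ (-((m + e : ℕ) + m : ℝ)) = (2 ^ (m + e + m))⁻¹ := by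
      rw [Real.rpow_neg (by norm_num), ← Nat.cast_add, Real.rpow_natCast]
    rw [e1]
    simp only [Finset.sum_const, Finset.card_range, nsmul_eq_mul, Nat.add_sub_cancel_left]
    push_cast
    rw [pow_add, pow_add]
    field_simp
    ring
  rw [hsum] at h1
  -- The bounds are of order 2^(-(k+m)) and 2^(2k - n/4). Interpolation with θ = δ yields the
  -- exponent -(1-3δ)k - (1-δ)m - δn/4: the growth in k of the crude bound costs only 2δk.
  have h3 := le_of_le_of_le_interpolate (by positivity) (by positivity) hδ.le (by linarith) h1 h2
  have hmk : (m : ℝ) ≤ k := by exact_mod_cast hm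
  have hm0 : (0 : ℝ) ≤ m := Nat.cast_nonneg m
  have hn0 : (0 : ℝ) ≤ n := Nat.cast_nonneg n
  refine lintegral_weighted_le (e := -(δ * k + 9 * δ * m + δ / 8 * n)) h3 (by positivity)
    (by positivity) ?_ ?_
  · have e4 : (16 : ℝ) * 4 ^ (k + 1) * (C * T ^ (1 / 4 : ℝ) * 2 ^ (-(1 / 4 * n : ℝ)))
        = (64 * (C * T ^ (1 / 4 : ℝ))) * 2 ^ (2 * k - 1 / 4 * n : ℝ) := by
      have : (2 : ℝ) ^ (2 * k - 1 / 4 * n : ℝ) = 4 ^ k * 2 ^ (-(1 / 4 * n : ℝ)) := by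
        rw [sub_eq_add_neg, Real.rpow_add (by norm_num), Real.rpow_mul (by norm_num)]
        norm_num
      rw [this, pow_succ]; ring
    rw [e4, Real.mul_rpow (by norm_num) (by positivity),
      Real.mul_rpow (x := 64 * (C * T ^ (1 / 4 : ℝ))) (by positivity) (by positivity),
      ← Real.rpow_mul (by norm_num), ← Real.rpow_mul (by norm_num), ← Real.rpow_mul_natCast
      (by norm_num)]
    have h4 : (2 : ℝ) ^ (1 - δ) ≤ 2 := by
      calc (2 : ℝ) ^ (1 - δ) ≤ 2 ^ (1 : ℝ) :=
            Real.rpow_le_rpow_of_exponent_le (by norm_num) (by linarith)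
        _ = 2 := Real.rpow_one 2
    calc _ = ((2 : ℝ) ^ (1 - δ) * (64 * (C * T ^ (1 / 4 : ℝ))) ^ δ)
          * (2 ^ ((δ * k + (1 - 8 * δ) * m + δ / 16 * n) * (2 : ℕ)) * 2 ^ (-(k + m : ℝ) * (1 - δ))
          * 2 ^ ((2 * k - 1 / 4 * n : ℝ) * δ)) := by ring
      _ ≤ (2 * (64 * (C * T ^ (1 / 4 : ℝ))) ^ δ)
          * (2 ^ ((δ * k + (1 - 8 * δ) * m + δ / 16 * n) * (2 : ℕ)) * 2 ^ (-(k + m : ℝ) * (1 - δ))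
          * 2 ^ ((2 * k - 1 / 4 * n : ℝ) * δ)) := by gcongr
      _ ≤ _ := by
        rw [← Real.rpow_add (by norm_num), ← Real.rpow_add (by norm_num)]
        gcongr
        · norm_num
        · push_cast
          -- The squared weight exceeds the decay in m; the excess is paid by the decay in k,
          -- through (1 - 6δ)(k - m) ≥ 0.
          nlinarith [mul_nonneg (sub_nonneg.2 hmk) (by linarith : 0 ≤ 1 - 6 * δ)]
  · have hk0 : (0 : ℝ) ≤ k := Nat.cast_nonneg k
    nlinarith [mul_le_mul_of_nonneg_right hδr hm0, mul_le_mul_of_nonneg_right hδr hn0,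
      mul_le_mul_of_nonneg_right hδr hk0]

end Moments

/-! ### One random constant for all increments and areas -/

section Control

variable {Ω : Type*} [MeasurableSpace Ω] {P : Measure Ω} {T : ℝ} {d : ℕ}
  {ξ : Fin d → Lp ℝ 2 (spaceTime T) → Ω → ℝ} {ψ : ℝ → ℝ → Ω → Vec d}
  {g : ℝ → ℝ → Lp ℝ 2 (spaceTime T)}

lemma IsRepresentedBy.aemeasurable (hr : IsRepresentedBy P ξ ψ g) (hξ : IsWhiteNoise P T ξ)
    {t x : ℝ} (ht : t ∈ Icc 0 T) (hx : x ∈ Icc (0 : ℝ) 1) (p : Fin d) :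
    AEMeasurable (fun ω => ψ t x ω p) P :=
  (hξ.aemeasurable p (g t x)).congr (hr t ht x hx p).symm

lemma IsRepresentedBy.initial_ae (hr : IsRepresentedBy P ξ ψ g) (hξ : IsWhiteNoise P T ξ)
    (hg : IsKernelMap T g) (hT : 0 < T) :
    ∀ᵐ ω ∂P, ∀ m i : ℕ, i ≤ 2 ^ m → ψ 0 (i / 2 ^ m) ω = 0 := by
  rw [ae_all_iff]; intro m
  rw [ae_all_iff]; intro i
  by_cases hi : i ≤ 2 ^ m
  · have h1 : ∀ᵐ ω ∂P, ∀ p, ψ 0 (i / 2 ^ m) ω p = 0 := ae_all_iff.2 fun p => by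
      filter_upwards [hr 0 ⟨le_rfl, hT.le⟩ _ (grid_mem hi) p, hξ.zero_ae p] with ω h1 h2
      rw [h1, hg.apply_zero hT.le (grid_mem hi), h2]; rfl
    filter_upwards [h1] with ω hω _
    ext p; exact hω p
  · exact ae_of_all _ fun ω h => absurd h hi

/-- The weighted components of the increments and areas that are controlled. -/
def controlled (T δ : ℝ) (ψ : ℝ → ℝ → Ω → Vec d) (k m n i j : ℕ) :
    Fin d ⊕ (Fin d × Fin d) → Ω → ℝ
  -- Increments do not depend on k. They are counted for k = 0 only, so that the sum over k stays
  -- finite.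
  | Sum.inl p => fun ω => if k = 0 then (2 : ℝ) ^ ((1 / 2 - 3 * δ) * m + δ / 16 * n)
      * ((ψ ((j + 1 : ℕ) * T / 2 ^ n) ((i + 1 : ℕ) / 2 ^ m) ω
          - ψ ((j + 1 : ℕ) * T / 2 ^ n) (i / 2 ^ m) ω) p
        - (ψ (j * T / 2 ^ n) ((i + 1 : ℕ) / 2 ^ m) ω - ψ (j * T / 2 ^ n) (i / 2 ^ m) ω) p) else 0
  | Sum.inr p => fun ω => if m ≤ k then (2 : ℝ) ^ (δ * k + (1 - 8 * δ) * m + δ / 16 * n)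
      * (levelArea k m i (fun x => ψ ((j + 1 : ℕ) * T / 2 ^ n) x ω) p
        - levelArea k m i (fun x => ψ (j * T / 2 ^ n) x ω) p) else 0

lemma aemeasurable_controlled (hξ : IsWhiteNoise P T ξ) (hr : IsRepresentedBy P ξ ψ g)
    (hT : 0 < T) (δ : ℝ) {k m n i j : ℕ} (hi : i < 2 ^ m) (hj : j < 2 ^ n)
    (c : Fin d ⊕ (Fin d × Fin d)) : AEMeasurable (controlled T δ ψ k m n i j c) P := by
  have hs := time_grid_mem hT hj.le
  have ht := time_grid_mem hT hj
  rcases c with p | ⟨p, p'⟩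
  · simp only [controlled]
    split_ifs with hk
    · have h := fun t ht x hx => hr.aemeasurable hξ (t := t) (x := x) ht hx p
      exact (((h _ ht _ (grid_mem hi)).sub (h _ ht _ (grid_mem hi.le))).sub
        ((h _ hs _ (grid_mem hi)).sub (h _ hs _ (grid_mem hi.le)))).const_mul _
    · exact aemeasurable_const
  · simp only [controlled]
    split_ifs with hm
    · have hn : Monotone fun l : ℕ => 2 * (i * 2 ^ (k - m) + l) := fun a b h => by
        simp only; omega
      have hL : 2 * (i * 2 ^ (k - m) + 2 ^ (k - m)) ≤ 2 ^ (k + 1) := by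
        have := levelArea_index_le hm hi (l := 2 ^ (k - m) - 1)
          (Nat.sub_lt (by positivity) one_pos)
        rwa [Nat.sub_add_cancel Nat.one_le_two_pow] at this
      exact ((aemeasurable_blockArea hξ hr ht (k + 1) hn hL p p').sub
        (aemeasurable_blockArea hξ hr hs (k + 1) hn hL p p')).const_mul _
    · exact aemeasurable_const

/-- The solution is controlled by a random variable with moments of any prescribed order. -/
theorem exists_isControlled (hξ : IsWhiteNoise P T ξ) (hψ : IsHeatSolution P T ξ ψ)
    (hg : IsKernelMap T g) (hr : IsRepresentedBy P ξ ψ g) (hT : 0 < T) {α δ : ℝ} (hδ : 0 < δ)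
    (hδ1 : δ ≤ 1 / 24) (hαδ : α = 1 / 2 - 4 * δ) {r : ℕ} (hδr : 16 ≤ δ * r) :
    ∃ R : Ω → ℝ, (∀ ω, 0 ≤ R ω) ∧ ∫⁻ ω, ENNReal.ofReal (R ω) ^ (2 * r) ∂P < ⊤ ∧
      ∀ᵐ ω ∂P, IsControlled T α δ ((1 / 2 : ℝ) ^ (δ / 16)) (R ω) fun t x => ψ t x ω := by
  have hr0 : r ≠ 0 := by rintro rfl; norm_num at hδr
  obtain ⟨C, hC, hgC⟩ := hg.exists_norm_sub_time
  set B₁ := gaussMoment (2 * r) * ENNReal.ofReal ((4 * (4 * (C * T ^ (1 / 4 : ℝ))) ^ δ) ^ r)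
    with hB₁
  set B₂ := (2 ^ (2 * r) * 2 * gaussMoment (2 * r) ^ 2)
    * ENNReal.ofReal ((2 * (64 * (C * T ^ (1 / 4 : ℝ))) ^ δ) ^ r) with hB₂
  have hgm := gaussMoment_lt_top (2 * r)
  have hB : B₁ + B₂ ≠ ⊤ := by
    refine (ENNReal.add_lt_top.2 ⟨ENNReal.mul_lt_top hgm ENNReal.ofReal_lt_top,
      ENNReal.mul_lt_top ?_ ENNReal.ofReal_lt_top⟩).ne
    exact ENNReal.mul_lt_top (ENNReal.mul_lt_top (by simp) (by simp)) (ENNReal.pow_lt_top hgm)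
  obtain ⟨R, hR0, hRi, hRb⟩ := exists_dyadic_bound (P := P) (controlled T δ ψ)
    (fun k m n i j c hi hj => aemeasurable_controlled hξ hr hT δ hi hj c) (p := 2 * r)
    (by omega) hB (fun k m n i j c hi hj => by
      rcases c with p | p
      · simp only [controlled]
        split_ifs with hk
        · refine (lintegral_dyadic_increment_le hξ hg hr hT hC hgC hδ hδ1 hδr hi hj p).trans ?_
          rw [hk, Nat.cast_zero, zero_add]
          exact mul_le_mul' le_self_add le_rfl
        · simp [hr0]
      · simp only [controlled]
        split_ifs with hm
        · exact (lintegral_levelArea_le hξ hg hr hT hC hgC hδ hδ1 hr0 hδr hm hi hj p).trans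
            (mul_le_mul' le_add_self le_rfl)
        · simp [hr0])
  -- The factor turns bounds on the d, respectively d², components into bounds on the norms.
  refine ⟨fun ω => (d + d * d : ℕ) * R ω, fun ω => mul_nonneg (Nat.cast_nonneg _) (hR0 ω), ?_, ?_⟩
  · simp_rw [ENNReal.ofReal_mul (Nat.cast_nonneg _), mul_pow]
    rw [lintegral_const_mul' _ _ (by simp)]
    exact ENNReal.mul_lt_top (by simp) hRi
  filter_upwards [hRb, hψ.continuous, hr.initial_ae hξ hg hT] with ω hω hc h0
  have hd1 : (d : ℝ) ≤ (d + d * d : ℕ) := by push_cast; nlinarith [Nat.cast_nonneg (α := ℝ) d]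
  have hd2 : (d * d : ℝ) ≤ (d + d * d : ℕ) := by push_cast; nlinarith [Nat.cast_nonneg (α := ℝ) d]
  refine ⟨hc, h0, fun m n i j hi hj => ?_, fun k m n i j hm hi hj => ?_⟩
  · have h1 : ∀ p, |((ψ ((j + 1 : ℕ) * T / 2 ^ n) ((i + 1 : ℕ) / 2 ^ m) ω
        - ψ ((j + 1 : ℕ) * T / 2 ^ n) (i / 2 ^ m) ω)
        - (ψ (j * T / 2 ^ n) ((i + 1 : ℕ) / 2 ^ m) ω - ψ (j * T / 2 ^ n) (i / 2 ^ m) ω)) p|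
        ≤ R ω * 2 ^ (-((1 / 2 - 3 * δ) * m + δ / 16 * n)) := fun p => by
      have := hω 0 m n i j (Sum.inl p) hi hj
      simp only [controlled, if_true] at this
      exact abs_le_of_weighted rfl this
    refine (norm_le_of_abs_le (mul_nonneg (hR0 ω) (by positivity)) h1).trans ?_
    have e : (2 : ℝ) ^ (-((1 / 2 - 3 * δ) * m + δ / 16 * n))
        = ((1 : ℝ) / 2 ^ m) ^ (α + δ) * ((1 / 2 : ℝ) ^ (δ / 16)) ^ n := by
      rw [one_div_two_pow_rpow, half_rpow_pow_eq, ← Real.rpow_add (by norm_num)]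
      congr 1; rw [hαδ]; ring
    rw [e, Fintype.card_fin]
    have h2 := hR0 ω
    calc (d : ℝ) * (R ω * (((1 : ℝ) / 2 ^ m) ^ (α + δ) * ((1 / 2 : ℝ) ^ (δ / 16)) ^ n))
        ≤ (d + d * d : ℕ) * (R ω * (((1 : ℝ) / 2 ^ m) ^ (α + δ) * ((1 / 2 : ℝ) ^ (δ / 16)) ^ n)) := by
          gcongr
      _ = _ := by ring
  · have h1 : ∀ p, |(levelArea k m i (fun x => ψ ((j + 1 : ℕ) * T / 2 ^ n) x ω)
        - levelArea k m i (fun x => ψ (j * T / 2 ^ n) x ω)) p|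
        ≤ R ω * 2 ^ (-(δ * k + (1 - 8 * δ) * m + δ / 16 * n)) := fun p => by
      have := hω k m n i j (Sum.inr p) hi hj
      simp only [controlled, if_pos hm] at this
      exact abs_le_of_weighted rfl this
    refine (norm_le_of_abs_le (mul_nonneg (hR0 ω) (by positivity)) h1).trans ?_
    have e : (2 : ℝ) ^ (-(δ * k + (1 - 8 * δ) * m + δ / 16 * n))
        = ((1 / 2 : ℝ) ^ δ) ^ k * ((1 : ℝ) / 2 ^ m) ^ (2 * α) * ((1 / 2 : ℝ) ^ (δ / 16)) ^ n := by
      rw [one_div_two_pow_rpow, half_rpow_pow_eq, half_rpow_pow_eq, ← Real.rpow_add (by norm_num),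
        ← Real.rpow_add (by norm_num)]
      congr 1; rw [hαδ]; ring
    rw [e, Fintype.card_prod, Fintype.card_fin]
    have h2 := hR0 ω
    push_cast at hd2 ⊢
    calc (d * d : ℝ) * (R ω * (((1 / 2 : ℝ) ^ δ) ^ k * ((1 : ℝ) / 2 ^ m) ^ (2 * α)
          * ((1 / 2 : ℝ) ^ (δ / 16)) ^ n))
        ≤ (d + d * d) * (R ω * (((1 / 2 : ℝ) ^ δ) ^ k * ((1 : ℝ) / 2 ^ m) ^ (2 * α)
          * ((1 / 2 : ℝ) ^ (δ / 16)) ^ n)) := by gcongr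
      _ = _ := by ring

end Control

section Stratonovich

/-! ### The limit as a Stratonovich integral -/

lemma IsControlled.norm_snd_sub_limitLift_le {d : ℕ} {T α δ q R : ℝ} {ψ : ℝ → ℝ → Vec d}
    (h : IsControlled T α δ q R ψ) (hT : 0 < T) (hα : 0 < α) (hδ : 0 < δ)
    (hαδ : α + δ ≤ 1) (hq : 0 ≤ q) (hq1 : q < 1) (hR : 0 ≤ R) {t : ℝ} (ht : t ∈ Icc 0 T) (k : ℕ)
    {x y : ℝ} (hxy : (x, y) ∈ simplex) :
    ‖(naturalLift (dyadicInterp k (ψ t))).snd x y - (limitLift (ψ t)).snd x y‖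
      ≤ levelConst α q * (R + R ^ 2) * ((1 / 2 : ℝ) ^ δ) ^ k / (1 - (1 / 2 : ℝ) ^ δ) := by
  refine norm_sub_le_of_geometric (half_rpow_lt_one hδ) (fun k => ?_)
    (h.tendsto_snd hT hα hδ hαδ hq hq1 hR ht hxy) k
  have h1 := h.norm_snd_sub_le hT hα hδ hαδ hq hq1 hR ht k hxy.1 hxy.2.1 hxy.2.2
  have h2 : (y - x) ^ (2 * α) ≤ 1 := Real.rpow_le_one (by linarith [hxy.2.1])
    (by linarith [hxy.1, hxy.2.2]) (by linarith)
  have h3 := (chainConst_pos hα).le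
  have h4 := (chainConst_pos (β := 2 * α) (by positivity)).le
  have h5 : 0 ≤ 1 / (1 - q) := by rw [one_div_nonneg]; linarith
  have h6 : 0 ≤ levelConst α q := by unfold levelConst; positivity
  have h7 := half_rpow_pos δ
  exact h1.trans (mul_le_of_le_one_right (by positivity) h2)

/-- Convergence of the second levels is uniform on the simplex and the limit is continuous, so the
end points may move with k. -/
lemma IsControlled.tendsto_snd_of_tendsto {d : ℕ} {T α δ q R : ℝ} {ψ : ℝ → ℝ → Vec d}
    (h : IsControlled T α δ q R ψ) (hT : 0 < T) (hα : 0 < α) (hδ : 0 < δ)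
    (hαδ : α + δ ≤ 1) (hq : 0 ≤ q) (hq1 : q < 1) (hR : 0 ≤ R) {t : ℝ} (ht : t ∈ Icc 0 T)
    {x y : ℝ} (hxy : (x, y) ∈ simplex) {v : ℕ → ℝ × ℝ} (hv : ∀ k, v k ∈ simplex)
    (hlim : Tendsto v atTop (𝓝 (x, y))) :
    Tendsto (fun k => (naturalLift (dyadicInterp k (ψ t))).snd (v k).1 (v k).2) atTop
      (𝓝 ((limitLift (ψ t)).snd x y)) := by
  have h1 : Tendsto (fun k => (limitLift (ψ t)).snd (v k).1 (v k).2) atTop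
      (𝓝 ((limitLift (ψ t)).snd x y)) :=
    (((h.isGeometricPath_limitLift hT hα hδ hαδ hq hq1 hR).1 t ht).1.continuousOn_snd (x, y)
      hxy).tendsto.comp (tendsto_nhdsWithin_iff.2 ⟨hlim, Eventually.of_forall hv⟩)
  have h2 : Tendsto (fun k => (naturalLift (dyadicInterp k (ψ t))).snd (v k).1 (v k).2
      - (limitLift (ψ t)).snd (v k).1 (v k).2) atTop (𝓝 0) := by
    refine squeeze_zero_norm (fun k => h.norm_snd_sub_limitLift_le hT hα hδ hαδ hq hq1 hR ht k
      (x := (v k).1) (y := (v k).2) (hv k)) ?_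
    have h3 := ((tendsto_pow_atTop_nhds_zero_of_lt_one (half_rpow_pos δ).le
      (half_rpow_lt_one hδ)).const_mul (levelConst α q * (R + R ^ 2))).div_const
      (1 - (1 / 2 : ℝ) ^ δ)
    simpa using h3
  simpa using h2.add h1

lemma tendsto_stratonovichSum {d : ℕ} {a : ℝ → Vec d} (ha : ContinuousOn a (Icc 0 1)) {n : ℕ}
    {u : ℕ → ℝ} {v : ℕ → ℕ → ℝ} (hu : ∀ l ≤ n, u l ∈ Icc (0 : ℝ) 1)
    (hv : ∀ k, ∀ l ≤ n, v k l ∈ Icc (0 : ℝ) 1)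
    (hlim : ∀ l ≤ n, Tendsto (fun k => v k l) atTop (𝓝 (u l))) :
    Tendsto (fun k => stratonovichSum a n (v k)) atTop (𝓝 (stratonovichSum a n u)) := by
  have h : ∀ l ≤ n, Tendsto (fun k => a (v k l)) atTop (𝓝 (a (u l))) := fun l hl =>
    (ha _ (hu l hl)).tendsto.comp (tendsto_nhdsWithin_iff.2 ⟨hlim l hl,
      Eventually.of_forall fun k => hv k l hl⟩)
  unfold stratonovichSum
  refine tendsto_finsetSum _ fun l hl => ?_
  have hl := Finset.mem_range.1 hl
  exact (continuous_tensor.tendsto _).comp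
    (((((h l hl.le).add (h (l + 1) hl)).const_smul (1 / 2 : ℝ)).sub
      (h 0 (Nat.zero_le _))).prodMk_nhds ((h (l + 1) hl).sub (h l hl.le)))

lemma floor_dyadic_mem {z : ℝ} (hz : z ∈ Icc (0 : ℝ) 1) (k : ℕ) : ⌊2 ^ k * z⌋₊ ≤ 2 ^ k := by
  have : (⌊2 ^ k * z⌋₊ : ℝ) ≤ 2 ^ k :=
    (Nat.floor_le (mul_nonneg (by positivity) hz.1)).trans
      (mul_le_of_le_one_right (by positivity) hz.2)
  exact_mod_cast this

lemma floor_dyadic_monotone {u : ℕ → ℝ} (hu : Monotone u) (k : ℕ) :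
    Monotone fun l => ⌊2 ^ k * u l⌋₊ := fun a b hab =>
  Nat.floor_le_floor (mul_le_mul_of_nonneg_left (hu hab) (by positivity))

/-- The sums of the discrete areas converge to the difference of the limit and the symmetric
Riemann sum. -/
lemma IsControlled.tendsto_sum_gridArea {d : ℕ} {T α δ q R : ℝ} {ψ : ℝ → ℝ → Vec d}
    (h : IsControlled T α δ q R ψ) (hT : 0 < T) (hα : 0 < α) (hδ : 0 < δ)
    (hαδ : α + δ ≤ 1) (hq : 0 ≤ q) (hq1 : q < 1) (hR : 0 ≤ R) {t : ℝ} (ht : t ∈ Icc 0 T)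
    {n : ℕ} {u : ℕ → ℝ} (hu : Monotone u) (hu0 : 0 ≤ u 0) (hun : u n ≤ 1) :
    Tendsto (fun k => ∑ l ∈ Finset.range n,
        gridArea k ⌊2 ^ k * u l⌋₊ ⌊2 ^ k * u (l + 1)⌋₊ (ψ t)) atTop
      (𝓝 ((limitLift (ψ t)).snd (u 0) (u n) - stratonovichSum (ψ t) n u)) := by
  have hmem : ∀ l ≤ n, u l ∈ Icc (0 : ℝ) 1 := fun l hl =>
    ⟨hu0.trans (hu (Nat.zero_le l)), (hu hl).trans hun⟩
  -- Arbitrary partition points are rounded down to level k, where the area of the interpolation is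
  -- a discrete area. Rounding may merge points but keeps the sequence monotone.
  set v : ℕ → ℕ → ℝ := fun k l => (⌊2 ^ k * u l⌋₊ : ℝ) / 2 ^ k with hv
  have hvm : ∀ k, Monotone (v k) := fun k a b hab => grid_le (floor_dyadic_monotone hu k hab)
  have hvmem : ∀ k, ∀ l ≤ n, v k l ∈ Icc (0 : ℝ) 1 := fun k l hl =>
    grid_mem (floor_dyadic_mem (hmem l hl) k)
  have hvlim : ∀ l ≤ n, Tendsto (fun k => v k l) atTop (𝓝 (u l)) := fun l hl =>
    tendsto_floor_dyadic (hmem l hl).1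
  have h1 := h.tendsto_snd_of_tendsto hT hα hδ hαδ hq hq1 hR ht (x := u 0) (y := u n)
    ⟨hu0, hu (Nat.zero_le n), hun⟩ (v := fun k => (v k 0, v k n))
    (fun k => ⟨(hvmem k 0 (Nat.zero_le n)).1, hvm k (Nat.zero_le n), (hvmem k n le_rfl).2⟩)
    ((hvlim 0 (Nat.zero_le n)).prodMk_nhds (hvlim n le_rfl))
  have h2 := tendsto_stratonovichSum (h.continuousOn_space ht) hmem hvmem hvlim
  refine (h1.sub h2).congr fun k => ?_
  have h3 := snd_dyadicInterp_sub_stratonovichSum k (ψ t) (n := n) (hvm k)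
    (hvmem k 0 (Nat.zero_le n)).1 (hvmem k n le_rfl).2
  rw [stratonovichSum_congr (c := ψ t) fun l _ => dyadicInterp_grid k (ψ t) _] at h3
  rw [h3]
  refine Finset.sum_congr rfl fun l hl => ?_
  have hl := Finset.mem_range.1 hl
  exact area_dyadicInterp_grid k (ψ t) (floor_dyadic_monotone hu k (Nat.le_succ l))
    (floor_dyadic_mem (hmem (l + 1) hl) k)

variable {Ω : Type*} [MeasurableSpace Ω] {P : Measure Ω} {T : ℝ} {d : ℕ}
  {ξ : Fin d → Lp ℝ 2 (spaceTime T) → Ω → ℝ} {ψ : ℝ → ℝ → Ω → Vec d}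
  {g : ℝ → ℝ → Lp ℝ 2 (spaceTime T)}

lemma aestronglyMeasurable_of_apply {ι : Type*} [Fintype ι] {f : Ω → EuclideanSpace ℝ ι}
    (h : ∀ i, AEMeasurable (fun ω => f ω i) P) : AEStronglyMeasurable f P := by
  have h1 : AEMeasurable (fun ω => WithLp.toLp 2 fun i => f ω i) P :=
    (WithLp.measurable_toLp 2 (ι → ℝ)).comp_aemeasurable (aemeasurable_pi_lambda _ h)
  exact h1.aestronglyMeasurable

lemma aestronglyMeasurable_tensor {f h : Ω → Vec d} (hf : AEStronglyMeasurable f P)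
    (hh : AEStronglyMeasurable h P) : AEStronglyMeasurable (fun ω => tensor (f ω) (h ω)) P :=
  continuous_tensor.comp_aestronglyMeasurable (hf.prodMk hh)

lemma aestronglyMeasurable_stratonovichSum {a : ℝ → Ω → Vec d} {n : ℕ} {u : ℕ → ℝ}
    (h : ∀ l ≤ n, AEStronglyMeasurable (a (u l)) P) :
    AEStronglyMeasurable (fun ω => stratonovichSum (fun z => a z ω) n u) P := by
  unfold stratonovichSum
  refine Finset.aestronglyMeasurable_fun_sum _ fun l hl => ?_
  have hl := Finset.mem_range.1 hl
  exact aestronglyMeasurable_tensor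
    ((((h l hl.le).add (h (l + 1) hl)).const_smul (1 / 2 : ℝ)).sub (h 0 (Nat.zero_le _)))
    ((h (l + 1) hl).sub (h l hl.le))

lemma lintegral_enorm_sq_eq {ι : Type*} [Fintype ι] {f : Ω → EuclideanSpace ℝ ι}
    (h : ∀ i, AEMeasurable (fun ω => f ω i) P) :
    ∫⁻ ω, ‖f ω‖ₑ ^ 2 ∂P = ∑ i, ∫⁻ ω, ‖f ω i‖ₑ ^ 2 ∂P := by
  rw [← lintegral_finsetSum' _ fun i _ => (h i).enorm.pow_const 2]
  refine lintegral_congr fun ω => ?_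
  rw [← ofReal_norm, ← ENNReal.ofReal_pow (norm_nonneg _), EuclideanSpace.norm_sq_eq,
    ENNReal.ofReal_sum_of_nonneg fun i _ => by positivity]
  refine Finset.sum_congr rfl fun i _ => ?_
  rw [ENNReal.ofReal_pow (norm_nonneg _), ofReal_norm]

lemma sum_sq_increment_le {n : ℕ} {u : ℕ → ℝ} (hu : Monotone u) {η : ℝ}
    (h : ∀ l < n, u (l + 1) - u l ≤ η) :
    ∑ l ∈ Finset.range n, (u (l + 1) - u l) ^ 2 ≤ η * (u n - u 0) := by
  rw [← Finset.sum_range_sub, Finset.mul_sum]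
  refine Finset.sum_le_sum fun l hl => ?_
  rw [sq]
  exact mul_le_mul_of_nonneg_right (h l (Finset.mem_range.1 hl)) (sub_nonneg.2 (hu (Nat.le_succ l)))

/-- The almost sure limit of sums of discrete areas is small in `L²`. -/
lemma lintegral_limit_sq_le (hξ : IsWhiteNoise P T ξ) (hg : IsKernelMap T g)
    (hr : IsRepresentedBy P ξ ψ g) {t : ℝ} (ht : t ∈ Icc 0 T) {n : ℕ} {u : ℕ → ℝ}
    (hu : Monotone u) (hu0 : 0 ≤ u 0) (hun : u n ≤ 1) {D : Ω → Tens d}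
    (hD : ∀ᵐ ω ∂P, Tendsto (fun k => ∑ l ∈ Finset.range n,
        gridArea k ⌊2 ^ k * u l⌋₊ ⌊2 ^ k * u (l + 1)⌋₊ (fun x => ψ t x ω)) atTop (𝓝 (D ω)))
    {η : ℝ} (hη : ∀ l < n, u (l + 1) - u l ≤ η) (hη0 : 0 ≤ η) :
    AEStronglyMeasurable D P ∧ ∫⁻ ω, ‖D ω‖ₑ ^ 2 ∂P
      ≤ (d * d : ℕ) * gaussMoment 2 ^ 2 * ENNReal.ofReal (2 * η) := by
  have hmem : ∀ l ≤ n, u l ∈ Icc (0 : ℝ) 1 := fun l hl =>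
    ⟨hu0.trans (hu (Nat.zero_le l)), (hu hl).trans hun⟩
  have hL : ∀ k, ⌊2 ^ k * u n⌋₊ ≤ 2 ^ k := fun k => floor_dyadic_mem (hmem n le_rfl) k
  have hF : ∀ k (p : Fin d × Fin d), AEMeasurable (fun ω => (∑ l ∈ Finset.range n,
      gridArea k ⌊2 ^ k * u l⌋₊ ⌊2 ^ k * u (l + 1)⌋₊ (fun x => ψ t x ω)) p) P := fun k p =>
    aemeasurable_blockArea hξ hr ht k (floor_dyadic_monotone hu k) (hL k) p.1 p.2
  have hDm : AEStronglyMeasurable D P := aestronglyMeasurable_of_tendsto_ae atTop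
    (fun k => aestronglyMeasurable_of_apply (hF k)) hD
  have hDp : ∀ p, AEMeasurable (fun ω => D ω p) P := fun p =>
    ((EuclideanSpace.proj p : Tens d →L[ℝ] ℝ).continuous.comp_aestronglyMeasurable hDm).aemeasurable
  refine ⟨hDm, ?_⟩
  rw [lintegral_enorm_sq_eq hDp]
  have hsum : Tendsto (fun k : ℕ => gaussMoment 2 ^ 2 * ENNReal.ofReal (2 * ∑ l ∈ Finset.range n,
      (((⌊2 ^ k * u (l + 1)⌋₊ : ℝ) - ⌊2 ^ k * u l⌋₊) / 2 ^ k) ^ 2)) atTop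
      (𝓝 (gaussMoment 2 ^ 2 * ENNReal.ofReal (2 * ∑ l ∈ Finset.range n, (u (l + 1) - u l) ^ 2))) := by
    refine ENNReal.Tendsto.const_mul (ENNReal.tendsto_ofReal (Tendsto.const_mul _
      (tendsto_finsetSum _ fun l hl => ?_))) (Or.inr (ENNReal.pow_ne_top (gaussMoment_lt_top 2).ne))
    have hl := Finset.mem_range.1 hl
    simp_rw [sub_div]
    exact ((tendsto_floor_dyadic (hmem (l + 1) hl).1).sub
      (tendsto_floor_dyadic (hmem l hl.le).1)).pow 2
  have hp : ∀ p : Fin d × Fin d, ∫⁻ ω, ‖D ω p‖ₑ ^ 2 ∂P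
      ≤ gaussMoment 2 ^ 2 * ENNReal.ofReal (2 * η) := fun p => by
    -- Fatou's lemma carries the moment bound over to the limit. The rounded block lengths converge
    -- to those of the partition, whose squares sum to at most η.
    calc ∫⁻ ω, ‖D ω p‖ₑ ^ 2 ∂P
        = ∫⁻ ω, liminf (fun k => ‖(∑ l ∈ Finset.range n,
            gridArea k ⌊2 ^ k * u l⌋₊ ⌊2 ^ k * u (l + 1)⌋₊ (fun x => ψ t x ω)) p‖ₑ ^ 2) atTop ∂P := by
          refine lintegral_congr_ae (hD.mono fun ω hω => ?_)
          have h1 : Continuous fun v : Tens d => ‖v p‖ₑ ^ 2 :=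
            (ENNReal.continuous_pow 2).comp
              ((EuclideanSpace.proj p : Tens d →L[ℝ] ℝ).continuous.enorm)
          exact (((h1.tendsto _).comp hω).liminf_eq).symm
      _ ≤ liminf (fun k => ∫⁻ ω, ‖(∑ l ∈ Finset.range n,
            gridArea k ⌊2 ^ k * u l⌋₊ ⌊2 ^ k * u (l + 1)⌋₊ (fun x => ψ t x ω)) p‖ₑ ^ 2 ∂P) atTop :=
          lintegral_liminf_le' fun k => (hF k p).enorm.pow_const 2
      _ ≤ liminf (fun k : ℕ => gaussMoment 2 ^ 2 * ENNReal.ofReal (2 * ∑ l ∈ Finset.range n,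
            (((⌊2 ^ k * u (l + 1)⌋₊ : ℝ) - ⌊2 ^ k * u l⌋₊) / 2 ^ k) ^ 2)) atTop := by
          refine liminf_le_liminf (Eventually.of_forall fun k => ?_)
          have := lintegral_blockArea_le hξ hg hr ht k (floor_dyadic_monotone hu k) (hL k) p.1 p.2
            one_ne_zero
          simpa using this
      _ = gaussMoment 2 ^ 2 * ENNReal.ofReal (2 * ∑ l ∈ Finset.range n, (u (l + 1) - u l) ^ 2) :=
          hsum.liminf_eq
      _ ≤ gaussMoment 2 ^ 2 * ENNReal.ofReal (2 * η) := by
          gcongr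
          refine (sum_sq_increment_le hu hη).trans (mul_le_of_le_one_right hη0 ?_)
          linarith
  refine (Finset.sum_le_sum fun p _ => hp p).trans_eq ?_
  simp [mul_assoc]

/-- For `d = 0` as well as for `d > 0` the solution is controlled. -/
theorem IsHeatSolution.exists_isControlled (hψ : IsHeatSolution P T ξ ψ) (hξ : IsWhiteNoise P T ξ)
    (hT : 0 < T) {α δ : ℝ} (hδ : 0 < δ) (hδ1 : δ ≤ 1 / 24) (hαδ : α = 1 / 2 - 4 * δ) {r : ℕ}
    (hδr : 16 ≤ δ * r) :
    ∃ R : Ω → ℝ, (∀ ω, 0 ≤ R ω) ∧ ∫⁻ ω, ENNReal.ofReal (R ω) ^ (2 * r) ∂P < ⊤ ∧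
      ∀ᵐ ω ∂P, IsControlled T α δ ((1 / 2 : ℝ) ^ (δ / 16)) (R ω) fun t x => ψ t x ω := by
  -- For d = 0 there is no component from which to obtain a kernel map, but then all vectors are
  -- equal.
  rcases isEmpty_or_nonempty (Fin d) with hd | ⟨⟨i₀⟩⟩
  · have hr0 : r ≠ 0 := by rintro rfl; norm_num at hδr
    refine ⟨fun _ => 0, fun _ => le_rfl, by simp [hr0], ?_⟩
    filter_upwards [hψ.continuous] with ω hω
    refine ⟨hω, fun _ _ _ => Subsingleton.elim _ _, fun m n i j _ _ => ?_,
      fun k m n i j _ _ _ => ?_⟩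
    · rw [Subsingleton.elim (_ - _ : Vec d) 0]; simp
    · rw [Subsingleton.elim (_ - _ : Tens d) 0]; simp
  · obtain ⟨g, hg, hr⟩ := hψ.exists_kernelMap i₀
    exact SpatialLift.exists_isControlled hξ hψ hg hr hT hδ hδ1 hαδ hδr

end Stratonovich

/-! ### Reduction to dyadic points -/

section Dense

variable {E : Type*} [NormedAddCommGroup E]

lemma tendsto_of_holderNorm {X : Type*} {l : Filter X} {β : ℝ} {A : X → ℝ → ℝ → E}
    {B : ℝ → ℝ → E} (h : Tendsto (fun s => holderNorm β (fun x y => A s x y - B x y)) l (𝓝 0))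
    {x y : ℝ} (hx : 0 ≤ x) (hxy : x < y) (hy : y ≤ 1) :
    Tendsto (fun s => A s x y) l (𝓝 (B x y)) := by
  have hp : 0 < (y - x) ^ β := Real.rpow_pos_of_pos (by linarith) _
  have h1 : Tendsto (fun s => ENNReal.ofReal (‖A s x y - B x y‖ / (y - x) ^ β)) l (𝓝 0) :=
    tendsto_of_tendsto_of_tendsto_of_le_of_le tendsto_const_nhds h (fun _ => zero_le)
      fun s => le_holderNorm (A := fun x y => A s x y - B x y) hx hxy hy
  have h2 := ((ENNReal.tendsto_toReal ENNReal.zero_ne_top).comp h1).mul_const ((y - x) ^ β)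
  rw [ENNReal.toReal_zero, zero_mul] at h2
  rw [tendsto_iff_norm_sub_tendsto_zero]
  refine h2.congr fun s => ?_
  simp only [Function.comp]
  rw [ENNReal.toReal_ofReal (by positivity), div_mul_cancel₀ _ hp.ne']

/-- Dyadic subintervals of `[0,1]`. -/
abbrev DyadicInterval : Type := {q : ℕ × ℕ × ℕ // q.2.1 < q.2.2 ∧ q.2.2 ≤ 2 ^ q.1}

/-- Dyadic points of `[0,1]`. -/
abbrev DyadicPoint : Type := {q : ℕ × ℕ // q.2 ≤ 2 ^ q.1}

/-- The left end point. -/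
def DyadicInterval.left (q : DyadicInterval) : ℝ := q.1.2.1 / 2 ^ q.1.1

/-- The right end point. -/
def DyadicInterval.right (q : DyadicInterval) : ℝ := q.1.2.2 / 2 ^ q.1.1

/-- The point of `[0,T]` at the given proportion. -/
def DyadicPoint.time (T : ℝ) (q : DyadicPoint) : ℝ := q.1.2 * T / 2 ^ q.1.1

lemma DyadicInterval.left_nonneg (q : DyadicInterval) : 0 ≤ q.left := by
  unfold left; positivity

lemma DyadicInterval.left_lt_right (q : DyadicInterval) : q.left < q.right := by
  unfold left right
  have : (q.1.2.1 : ℝ) < q.1.2.2 := by exact_mod_cast q.2.1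
  gcongr

lemma DyadicInterval.right_le_one (q : DyadicInterval) : q.right ≤ 1 := (grid_mem q.2.2).2

lemma DyadicInterval.mem_simplex (q : DyadicInterval) : (q.left, q.right) ∈ simplex :=
  ⟨q.left_nonneg, q.left_lt_right.le, q.right_le_one⟩

lemma DyadicPoint.time_mem {T : ℝ} (hT : 0 < T) (q : DyadicPoint) : q.time T ∈ Icc 0 T :=
  time_grid_mem hT q.2

lemma exists_dyadicInterval_tendsto {x y : ℝ} (hx : 0 ≤ x) (hxy : x < y) (hy : y ≤ 1) :
    ∃ v : ℕ → DyadicInterval,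
      Tendsto (fun n => ((v n).left, (v n).right)) atTop (𝓝[simplex] (x, y)) := by
  have hx' : x ∈ Icc (0 : ℝ) 1 := ⟨hx, by linarith⟩
  have hy' : y ∈ Icc (0 : ℝ) 1 := ⟨by linarith, hy⟩
  have h1 := tendsto_floor_dyadic hx
  have h2 := tendsto_floor_dyadic hy'.1
  obtain ⟨N, hN⟩ := eventually_atTop.1 (h1.eventually_lt h2 hxy)
  have hlt : ∀ n, ⌊2 ^ (n + N) * x⌋₊ < ⌊2 ^ (n + N) * y⌋₊ := fun n => by
    have := hN (n + N) (Nat.le_add_left _ _)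
    rw [div_lt_div_iff_of_pos_right (by positivity)] at this
    exact_mod_cast this
  refine ⟨fun n => ⟨(n + N, ⌊2 ^ (n + N) * x⌋₊, ⌊2 ^ (n + N) * y⌋₊), hlt n,
    floor_dyadic_mem hy' _⟩, tendsto_nhdsWithin_iff.2 ⟨?_, Eventually.of_forall fun n =>
    DyadicInterval.mem_simplex _⟩⟩
  exact (h1.comp (tendsto_add_atTop_nat N)).prodMk_nhds (h2.comp (tendsto_add_atTop_nat N))

lemma exists_dyadicPoint_tendsto {T : ℝ} (hT : 0 < T) {t : ℝ} (ht : t ∈ Icc 0 T) :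
    ∃ v : ℕ → DyadicPoint, Tendsto (fun n => (v n).time T) atTop (𝓝[Icc 0 T] t) := by
  have hu : t / T ∈ Icc (0 : ℝ) 1 := ⟨div_nonneg ht.1 hT.le, (div_le_one hT).2 ht.2⟩
  refine ⟨fun n => ⟨(n, ⌊2 ^ n * (t / T)⌋₊), floor_dyadic_mem hu n⟩,
    tendsto_nhdsWithin_iff.2 ⟨?_, Eventually.of_forall fun n => DyadicPoint.time_mem hT _⟩⟩
  have := (tendsto_floor_dyadic hu.1).mul_const T
  rw [div_mul_cancel₀ _ hT.ne'] at this
  refine this.congr fun n => ?_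
  simp only [DyadicPoint.time]; ring

lemma holderNorm_eq_iSup_dyadic {β : ℝ} {h : ℝ → ℝ → E}
    (hc : ContinuousOn (fun p : ℝ × ℝ => h p.1 p.2) simplex) :
    holderNorm β h = ⨆ q : DyadicInterval,
      ENNReal.ofReal (‖h q.left q.right‖ / (q.right - q.left) ^ β) := by
  refine le_antisymm (iSup_le fun x => iSup_le fun y => iSup_le fun ⟨hx, hxy, hy⟩ => ?_)
    (iSup_le fun q => le_holderNorm q.left_nonneg q.left_lt_right q.right_le_one)
  obtain ⟨v, hv⟩ := exists_dyadicInterval_tendsto hx hxy hy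
  have h1 := ((hc (x, y) ⟨hx, hxy.le, hy⟩).tendsto.comp hv).norm
  have h2 : Tendsto (fun n => ((v n).right - (v n).left) ^ β) atTop (𝓝 ((y - x) ^ β)) := by
    have h3 := tendsto_nhds_of_tendsto_nhdsWithin hv
    have h4 : Tendsto (fun n => (v n).right - (v n).left) atTop (𝓝 (y - x)) :=
      ((continuous_snd.sub continuous_fst).tendsto (x, y)).comp h3
    exact h4.rpow_const (Or.inl (by linarith))
  have h5 := ENNReal.tendsto_ofReal (h1.div h2 (Real.rpow_pos_of_pos (by linarith) β).ne')
  exact le_of_tendsto h5 (Eventually.of_forall fun n => le_iSup (fun q : DyadicInterval =>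
    ENNReal.ofReal (‖h q.left q.right‖ / (q.right - q.left) ^ β)) (v n))

/-- Continuity on the simplex reduces the intervals to dyadic ones, and continuity in time for the
Hölder norm reduces the times. The point of the lemma is a countable supremum, from which
measurability of `levelDist` follows. -/
lemma iSup_holderNorm_eq_iSup_dyadic {T : ℝ} (hT : 0 < T) {β : ℝ} {A B : ℝ → ℝ → ℝ → E}
    (hA : ∀ t ∈ Icc 0 T, ContinuousOn (fun p : ℝ × ℝ => A t p.1 p.2) simplex)
    (hB : ∀ t ∈ Icc 0 T, ContinuousOn (fun p : ℝ × ℝ => B t p.1 p.2) simplex)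
    (hA' : ∀ t ∈ Icc 0 T, Tendsto (fun s => holderNorm β (fun x y => A s x y - A t x y))
      (𝓝[Icc 0 T] t) (𝓝 0))
    (hB' : ∀ t ∈ Icc 0 T, Tendsto (fun s => holderNorm β (fun x y => B s x y - B t x y))
      (𝓝[Icc 0 T] t) (𝓝 0)) :
    ⨆ t ∈ Icc 0 T, holderNorm β (fun x y => A t x y - B t x y)
      = ⨆ (s : DyadicPoint) (q : DyadicInterval), ENNReal.ofReal
        (‖A (s.time T) q.left q.right - B (s.time T) q.left q.right‖
          / (q.right - q.left) ^ β) := by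
  have hdy : ∀ s : DyadicPoint, holderNorm β (fun x y => A (s.time T) x y - B (s.time T) x y)
      = ⨆ q : DyadicInterval, ENNReal.ofReal
        (‖A (s.time T) q.left q.right - B (s.time T) q.left q.right‖
          / (q.right - q.left) ^ β) := fun s =>
    holderNorm_eq_iSup_dyadic ((hA _ (s.time_mem hT)).sub (hB _ (s.time_mem hT)))
  simp_rw [← hdy]
  refine le_antisymm (iSup₂_le fun t ht => iSup_le fun x => iSup_le fun y =>
    iSup_le fun ⟨hx, hxy, hy⟩ => ?_) (iSup_le fun s => le_iSup₂ (f := fun t (_ : t ∈ Icc 0 T) =>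
      holderNorm β (fun x y => A t x y - B t x y)) (s.time T) (s.time_mem hT))
  obtain ⟨v, hv⟩ := exists_dyadicPoint_tendsto hT ht
  have h1 := (((tendsto_of_holderNorm (hA' t ht) hx hxy hy).comp hv).sub
    ((tendsto_of_holderNorm (hB' t ht) hx hxy hy).comp hv)).norm.div_const ((y - x) ^ β)
  refine le_of_tendsto (ENNReal.tendsto_ofReal h1) (Eventually.of_forall fun n => ?_)
  exact (le_holderNorm (A := fun x y => A ((v n).time T) x y - B ((v n).time T) x y) hx hxy
    hy).trans (le_iSup (fun s : DyadicPoint =>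
      holderNorm β (fun x y => A (s.time T) x y - B (s.time T) x y)) (v n))

end Dense

/-! ### Paths of rough paths, seen through their values at dyadic points -/

section Paths

variable {d : ℕ} {α T : ℝ} {A B : ℝ → RoughData d}

lemma IsGeometricPath.tendsto_holderNorm_fst (hA : IsGeometricPath α T A) {t : ℝ}
    (ht : t ∈ Icc 0 T) : Tendsto (fun s => holderNorm α (fun x y => (A s).fst x y - (A t).fst x y))
      (𝓝[Icc 0 T] t) (𝓝 0) :=
  tendsto_of_tendsto_of_tendsto_of_le_of_le tendsto_const_nhds (hA.2 t ht) (fun _ => zero_le)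
    fun _ => le_add_right le_add_self

lemma IsGeometricPath.tendsto_holderNorm_snd (hA : IsGeometricPath α T A) {t : ℝ}
    (ht : t ∈ Icc 0 T) :
    Tendsto (fun s => holderNorm (2 * α) (fun x y => (A s).snd x y - (A t).snd x y))
      (𝓝[Icc 0 T] t) (𝓝 0) :=
  tendsto_of_tendsto_of_tendsto_of_le_of_le tendsto_const_nhds (hA.2 t ht) (fun _ => zero_le)
    fun _ => le_add_self

/-- The distance of two paths, from their values at dyadic points. -/
lemma levelDist_eq_iSup_dyadic (hT : 0 < T) (hA : IsGeometricPath α T A)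
    (hB : IsGeometricPath α T B) : levelDist α T A B
      = (⨆ (s : DyadicPoint) (q : DyadicInterval), ENNReal.ofReal
          (‖(A (s.time T)).fst q.left q.right - (B (s.time T)).fst q.left q.right‖
            / (q.right - q.left) ^ α))
        + ⨆ (s : DyadicPoint) (q : DyadicInterval), ENNReal.ofReal
          (‖(A (s.time T)).snd q.left q.right - (B (s.time T)).snd q.left q.right‖
            / (q.right - q.left) ^ (2 * α)) := by
  unfold levelDist
  rw [iSup_holderNorm_eq_iSup_dyadic hT (A := fun t => (A t).fst) (B := fun t => (B t).fst)
      (fun t ht => (hA.1 t ht).1.continuousOn_fst) (fun t ht => (hB.1 t ht).1.continuousOn_fst)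
      (fun t ht => hA.tendsto_holderNorm_fst ht) fun t ht => hB.tendsto_holderNorm_fst ht,
    iSup_holderNorm_eq_iSup_dyadic hT (A := fun t => (A t).snd) (B := fun t => (B t).snd)
      (fun t ht => (hA.1 t ht).1.continuousOn_snd) (fun t ht => (hB.1 t ht).1.continuousOn_snd)
      (fun t ht => hA.tendsto_holderNorm_snd ht) fun t ht => hB.tendsto_holderNorm_snd ht]

lemma IsRoughPath.snd_self {A : RoughData d} (hA : IsRoughPath α A) {x : ℝ}
    (hx : x ∈ Icc (0 : ℝ) 1) : A.snd x x = 0 := by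
  have h1 := hA.chen_fst x x x hx.1 le_rfl le_rfl hx.2
  have h2 := hA.chen_snd x x x hx.1 le_rfl le_rfl hx.2
  rw [show A.fst x x = 0 by simpa using h1, tensor_zero_left] at h2
  simpa using h2

/-- Paths whose second levels agree at dyadic points have the same second level. -/
lemma IsGeometricPath.snd_eq_of_dyadic (hT : 0 < T) (hA : IsGeometricPath α T A)
    (hB : IsGeometricPath α T B)
    (h : ∀ (s : DyadicPoint) (q : DyadicInterval),
      (A (s.time T)).snd q.left q.right = (B (s.time T)).snd q.left q.right)
    {t : ℝ} (ht : t ∈ Icc 0 T) {x y : ℝ} (hxy : (x, y) ∈ simplex) :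
    (A t).snd x y = (B t).snd x y := by
  have h1 : ∀ q : DyadicInterval, (A t).snd q.left q.right = (B t).snd q.left q.right := fun q => by
    obtain ⟨v, hv⟩ := exists_dyadicPoint_tendsto hT ht
    have hq := And.intro q.left_nonneg (And.intro q.left_lt_right q.right_le_one)
    refine tendsto_nhds_unique
      ((tendsto_of_holderNorm (hA.tendsto_holderNorm_snd ht) hq.1 hq.2.1 hq.2.2).comp hv) ?_
    refine ((tendsto_of_holderNorm (hB.tendsto_holderNorm_snd ht) hq.1 hq.2.1 hq.2.2).comp
      hv).congr fun n => ?_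
    exact (h (v n) q).symm
  rcases eq_or_lt_of_le hxy.2.1 with h2 | h2
  · simp only at h2
    subst h2
    rw [(hA.1 t ht).1.snd_self ⟨hxy.1, hxy.2.2⟩, (hB.1 t ht).1.snd_self ⟨hxy.1, hxy.2.2⟩]
  · obtain ⟨v, hv⟩ := exists_dyadicInterval_tendsto hxy.1 h2 hxy.2.2
    refine tendsto_nhds_unique (((hA.1 t ht).1.continuousOn_snd (x, y) hxy).tendsto.comp hv) ?_
    refine (((hB.1 t ht).1.continuousOn_snd (x, y) hxy).tendsto.comp hv).congr fun n => ?_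
    exact (h1 (v n)).symm

lemma aemeasurable_levelDist {Ω : Type*} [MeasurableSpace Ω] {P : Measure Ω}
    (hT : 0 < T) {Φ Ψ : Ω → ℝ → RoughData d} (hΦ : ∀ᵐ ω ∂P, IsGeometricPath α T (Φ ω))
    (hΨ : ∀ᵐ ω ∂P, IsGeometricPath α T (Ψ ω))
    (h1 : ∀ (s : DyadicPoint) (q : DyadicInterval),
      AEStronglyMeasurable (fun ω => (Φ ω (s.time T)).fst q.left q.right) P)
    (h2 : ∀ (s : DyadicPoint) (q : DyadicInterval),
      AEStronglyMeasurable (fun ω => (Φ ω (s.time T)).snd q.left q.right) P)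
    (h3 : ∀ (s : DyadicPoint) (q : DyadicInterval),
      AEStronglyMeasurable (fun ω => (Ψ ω (s.time T)).fst q.left q.right) P)
    (h4 : ∀ (s : DyadicPoint) (q : DyadicInterval),
      AEStronglyMeasurable (fun ω => (Ψ ω (s.time T)).snd q.left q.right) P) :
    AEMeasurable (fun ω => levelDist α T (Φ ω) (Ψ ω)) P := by
  have key : AEMeasurable (fun ω =>
      (⨆ (s : DyadicPoint) (q : DyadicInterval), ENNReal.ofReal
          (‖(Φ ω (s.time T)).fst q.left q.right - (Ψ ω (s.time T)).fst q.left q.right‖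
            / (q.right - q.left) ^ α))
        + ⨆ (s : DyadicPoint) (q : DyadicInterval), ENNReal.ofReal
          (‖(Φ ω (s.time T)).snd q.left q.right - (Ψ ω (s.time T)).snd q.left q.right‖
            / (q.right - q.left) ^ (2 * α))) P :=
    (AEMeasurable.iSup fun s => AEMeasurable.iSup fun q =>
      (((h1 s q).sub (h3 s q)).norm.aemeasurable.div_const _).ennreal_ofReal).add
    (AEMeasurable.iSup fun s => AEMeasurable.iSup fun q =>
      (((h2 s q).sub (h4 s q)).norm.aemeasurable.div_const _).ennreal_ofReal)
  refine key.congr ?_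
  filter_upwards [hΦ, hΨ] with ω hA hB
  exact (levelDist_eq_iSup_dyadic hT hA hB).symm

end Paths

/-! ### Measurability -/

section Measurability

variable {Ω : Type*} [MeasurableSpace Ω] {P : Measure Ω} {T : ℝ} {d : ℕ}
  {ξ : Fin d → Lp ℝ 2 (spaceTime T) → Ω → ℝ} {ψ : ℝ → ℝ → Ω → Vec d}

lemma IsHeatSolution.aestronglyMeasurable (hψ : IsHeatSolution P T ξ ψ) (hξ : IsWhiteNoise P T ξ)
    {t x : ℝ} (ht : t ∈ Icc 0 T) (hx : x ∈ Icc (0 : ℝ) 1) : AEStronglyMeasurable (ψ t x) P :=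
  aestronglyMeasurable_of_apply fun i => by
    obtain ⟨f, _, hf⟩ := hψ.mild t ht x hx i
    exact (hξ.aemeasurable i f).congr hf.symm

lemma aestronglyMeasurable_dyadicInterp {a : ℝ → Ω → Vec d}
    (ha : ∀ x ∈ Icc (0 : ℝ) 1, AEStronglyMeasurable (a x) P) (k : ℕ) {m i : ℕ} (hi : i ≤ 2 ^ m) :
    AEStronglyMeasurable (fun ω => dyadicInterp k (fun x => a x ω) (i / 2 ^ m)) P := by
  rcases eq_or_lt_of_le hi with h | h
  · have e : (i : ℝ) / 2 ^ m = ((2 ^ k : ℕ) : ℝ) / 2 ^ k := by rw [h]; push_cast; field_simp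
    rw [e]
    simp_rw [dyadicInterp_grid]
    exact ha _ (grid_mem le_rfl)
  rcases le_total m k with hm | hm
  · simp_rw [dyadicInterp_coarse hm]
    exact ha _ (grid_mem hi)
  · obtain ⟨j, hj, h1, h2⟩ := exists_coarse_interval hm h
    have h3 : (i : ℝ) / 2 ^ m ≤ (i + 1 : ℕ) / 2 ^ m := grid_le (Nat.le_succ i)
    simp_rw [dyadicInterp_eq ⟨h1, h3.trans h2⟩]
    have h4 := ha _ (grid_mem hj.le)
    exact h4.add (((ha ((j + 1 : ℕ) / 2 ^ k) (grid_mem hj)).sub h4).const_smul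
      (2 ^ k * (i / 2 ^ m) - j : ℝ))

/-- The interpolation is affine on the cells of the common refinement of level m + k, so its second
level is a finite Stratonovich sum there, an explicit function of finitely many values of a. -/
lemma aestronglyMeasurable_snd_dyadicInterp {a : ℝ → Ω → Vec d}
    (ha : ∀ x ∈ Icc (0 : ℝ) 1, AEStronglyMeasurable (a x) P) (k : ℕ) (q : DyadicInterval) :
    AEStronglyMeasurable
      (fun ω => (naturalLift (dyadicInterp k fun x => a x ω)).snd q.left q.right) P := by
  obtain ⟨⟨m, i, i'⟩, hi, hi'⟩ := q
  simp only at hi hi'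
  obtain ⟨L, rfl⟩ := Nat.exists_eq_add_of_le hi.le
  set u : ℕ → ℝ := fun l => ((i * 2 ^ k + l : ℕ) : ℝ) / 2 ^ (m + k) with hu
  have hum : Monotone u := grid_monotone (m + k) (i * 2 ^ k)
  have hle : i * 2 ^ k + L * 2 ^ k ≤ 2 ^ (m + k) := by
    rw [pow_add, ← add_mul]; exact Nat.mul_le_mul_right _ hi'
  have e0 : (i : ℝ) / 2 ^ m = u 0 := by simp only [hu]; push_cast; rw [pow_add]; field_simp; ring
  have e1 : ((i + L : ℕ) : ℝ) / 2 ^ m = u (L * 2 ^ k) := by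
    simp only [hu]; push_cast; rw [pow_add]; field_simp
  have h1 : ∀ ω, (naturalLift (dyadicInterp k fun x => a x ω)).snd (u 0) (u (L * 2 ^ k))
      = stratonovichSum (dyadicInterp k fun x => a x ω) (L * 2 ^ k) u := fun ω => by
    have := snd_dyadicInterp_sub_stratonovichSum k (fun x => a x ω) (n := L * 2 ^ k) hum
      (by positivity) (grid_mem hle).2
    rwa [Finset.sum_eq_zero, sub_eq_zero] at this
    intro l hl
    have hl := Finset.mem_range.1 hl
    obtain ⟨j, hj, h1, h2⟩ := exists_coarse_interval (k := k) (m := m + k) (i := i * 2 ^ k + l)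
      (Nat.le_add_left _ _) (by omega)
    exact area_dyadicInterp_of_mem h1 (hum (Nat.le_succ l)) h2
  simp only [DyadicInterval.left, DyadicInterval.right, e0, e1, h1]
  exact aestronglyMeasurable_stratonovichSum (a := fun z ω => dyadicInterp k (fun x => a x ω) z)
    fun l hl => aestronglyMeasurable_dyadicInterp ha k (by omega)

end Measurability

/-! ### Uniqueness of the spatial lift -/

section Uniqueness

variable {Ω : Type*} [MeasurableSpace Ω] {P : Measure Ω} {α T : ℝ} {d : ℕ}
  {ψ : ℝ → ℝ → Ω → Vec d} {Ψ Φ : Ω → ℝ → RoughData d}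

lemma exists_partition {x y δ : ℝ} (hxy : x ≤ y) (hδ : 0 < δ) : ∃ (n : ℕ) (u : ℕ → ℝ), Monotone u ∧
    u 0 = x ∧ u n = y ∧ ∀ l < n, u (l + 1) - u l < δ := by
  obtain ⟨N, hN⟩ := exists_nat_gt ((y - x) / δ)
  have hN' : (y - x) / δ < (N + 1 : ℕ) := hN.trans (by push_cast; linarith)
  have hp : (0 : ℝ) < (N + 1 : ℕ) := by positivity
  refine ⟨N + 1, fun l => x + (y - x) * (l / (N + 1 : ℕ)), fun a b hab => ?_, by simp, ?_,
    fun l _ => ?_⟩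
  · have : (a : ℝ) ≤ b := by exact_mod_cast hab
    have h2 : 0 ≤ y - x := by linarith
    simp only
    gcongr
  · simp only; rw [div_self hp.ne']; ring
  · have e : x + (y - x) * (((l + 1 : ℕ) : ℝ) / (N + 1 : ℕ)) - (x + (y - x) * (l / (N + 1 : ℕ)))
        = (y - x) / (N + 1 : ℕ) := by push_cast; ring
    rw [e, div_lt_iff₀ hp]
    rw [div_lt_iff₀ hδ] at hN'
    linarith

/-- A sufficiently fine partition has a Stratonovich sum close in L² to both second levels. -/
lemma IsSpatialLift.snd_ae_eq (hΨ : IsSpatialLift P α T ψ Ψ) (hΦ : IsSpatialLift P α T ψ Φ)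
    (hm : ∀ t ∈ Icc 0 T, ∀ x ∈ Icc (0 : ℝ) 1, AEStronglyMeasurable (ψ t x) P) {t : ℝ}
    (ht : t ∈ Icc 0 T) {x y : ℝ} (hxy : (x, y) ∈ simplex) :
    (fun ω => (Ψ ω t).snd x y) =ᵐ[P] fun ω => (Φ ω t).snd x y := by
  have m1 := hΨ.measurable_snd t ht x y hxy
  have m2 := hΦ.measurable_snd t ht x y hxy
  have key : eLpNorm (fun ω => (Ψ ω t).snd x y - (Φ ω t).snd x y) 2 P = 0 := by
    refine nonpos_iff_eq_zero.1 (ENNReal.le_of_forall_pos_le_add fun ε hε _ => ?_)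
    have hε2 : (0 : ℝ≥0∞) < (ε : ℝ≥0∞) / 2 := ENNReal.half_pos (by simpa using hε.ne')
    obtain ⟨δ₁, hδ₁, h1⟩ := hΨ.snd_limit t ht x y hxy _ hε2
    obtain ⟨δ₂, hδ₂, h2⟩ := hΦ.snd_limit t ht x y hxy _ hε2
    obtain ⟨n, u, hu, hu0, hun, hmesh⟩ := exists_partition hxy.2.1 (lt_min hδ₁ hδ₂)
    have h1 := h1 n u hu hu0 hun fun l hl => (hmesh l hl).trans_le (min_le_left _ _)
    have h2 := h2 n u hu hu0 hun fun l hl => (hmesh l hl).trans_le (min_le_right _ _)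
    have mS : AEStronglyMeasurable (fun ω => stratonovichSum (fun z => ψ t z ω) n u) P :=
      aestronglyMeasurable_stratonovichSum fun l hl => hm t ht _
        ⟨hxy.1.trans (hu0.symm.trans_le (hu (Nat.zero_le l))),
          ((hu hl).trans_eq hun).trans hxy.2.2⟩
    have e : (fun ω => (Ψ ω t).snd x y - (Φ ω t).snd x y)
        = (fun ω => stratonovichSum (fun z => ψ t z ω) n u - (Φ ω t).snd x y)
          - fun ω => stratonovichSum (fun z => ψ t z ω) n u - (Ψ ω t).snd x y := by
      ext1 ω; simp only [Pi.sub_apply]; abel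
    rw [e, zero_add, ← ENNReal.add_halves (ε : ℝ≥0∞)]
    exact (eLpNorm_sub_le (mS.sub m2) (mS.sub m1) (by norm_num)).trans (add_le_add h2.le h1.le)
  replace key := (eLpNorm_eq_zero_iff (m1.sub m2) (by norm_num)).1 key
  filter_upwards [key] with ω hω
  exact sub_eq_zero.1 hω

/-- Two spatial lifts are indistinguishable. -/
theorem IsSpatialLift.indistinguishable (hT : 0 < T) (hΨ : IsSpatialLift P α T ψ Ψ)
    (hΦ : IsSpatialLift P α T ψ Φ)
    (hm : ∀ t ∈ Icc 0 T, ∀ x ∈ Icc (0 : ℝ) 1, AEStronglyMeasurable (ψ t x) P) :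
    ∀ᵐ ω ∂P, ∀ t ∈ Icc 0 T, (Ψ ω t).init = (Φ ω t).init ∧ ∀ x y, (x, y) ∈ simplex →
      (Ψ ω t).fst x y = (Φ ω t).fst x y ∧ (Ψ ω t).snd x y = (Φ ω t).snd x y := by
  have h : ∀ᵐ ω ∂P, ∀ (s : DyadicPoint) (q : DyadicInterval),
      (Ψ ω (s.time T)).snd q.left q.right = (Φ ω (s.time T)).snd q.left q.right :=
    ae_all_iff.2 fun s => ae_all_iff.2 fun q =>
      hΨ.snd_ae_eq hΦ hm (s.time_mem hT) q.mem_simplex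
  filter_upwards [h, hΨ.path, hΦ.path, hΨ.init_eq, hΦ.init_eq, hΨ.fst_eq, hΦ.fst_eq]
    with ω h1 h2 h3 h4 h5 h6 h7 t ht
  exact ⟨(h4 t ht).trans (h5 t ht).symm, fun x y hxy =>
    ⟨(h6 t ht x y hxy).trans (h7 t ht x y hxy).symm, h2.snd_eq_of_dyadic hT h3 h1 ht hxy⟩⟩

lemma levelDist_congr {A B C : ℝ → RoughData d} (h : ∀ t ∈ Icc 0 T, ∀ x y, (x, y) ∈ simplex →
      (B t).fst x y = (C t).fst x y ∧ (B t).snd x y = (C t).snd x y) :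
    levelDist α T A B = levelDist α T A C := by
  unfold levelDist
  congr 1
  · exact iSup_congr fun t => iSup_congr fun ht => holderNorm_congr fun x y hx hxy hy => by
      rw [(h t ht x y ⟨hx, hxy.le, hy⟩).1]
  · exact iSup_congr fun t => iSup_congr fun ht => holderNorm_congr fun x y hx hxy hy => by
      rw [(h t ht x y ⟨hx, hxy.le, hy⟩).2]

lemma pathDist_congr {A B C : ℝ → RoughData d} (h0 : ∀ t ∈ Icc 0 T, (B t).init = (C t).init)
    (h : ∀ t ∈ Icc 0 T, ∀ x y, (x, y) ∈ simplex →
      (B t).fst x y = (C t).fst x y ∧ (B t).snd x y = (C t).snd x y) :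
    pathDist α T A B = pathDist α T A C := by
  unfold pathDist
  rw [levelDist_congr h]
  congr 1
  exact iSup_congr fun t => iSup_congr fun ht => by rw [h0 t ht]

end Uniqueness

/-! ### Existence of the spatial lift -/

section Existence

variable {Ω : Type*} [MeasurableSpace Ω] {P : Measure Ω} [IsProbabilityMeasure P] {T : ℝ} {d : ℕ}
  {ξ : Fin d → Lp ℝ 2 (spaceTime T) → Ω → ℝ} {ψ : ℝ → ℝ → Ω → Vec d}

/-- The symmetric Riemann sums converge in `L²` to the second level of the limit. -/
lemma IsHeatSolution.lintegral_limitLift_sub_le (hψ : IsHeatSolution P T ξ ψ)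
    (hξ : IsWhiteNoise P T ξ) (hT : 0 < T) {α δ q : ℝ} (hα : 0 < α) (hδ : 0 < δ)
    (hαδ : α + δ ≤ 1) (hq : 0 ≤ q) (hq1 : q < 1)
    (hc : ∀ᵐ ω ∂P, ∃ R, 0 ≤ R ∧ IsControlled T α δ q R fun t x => ψ t x ω) {t : ℝ}
    (ht : t ∈ Icc 0 T) {n : ℕ} {u : ℕ → ℝ} (hu : Monotone u) (hu0 : 0 ≤ u 0) (hun : u n ≤ 1)
    {η : ℝ} (hη : ∀ l < n, u (l + 1) - u l ≤ η) (hη0 : 0 ≤ η) :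
    AEStronglyMeasurable (fun ω => (limitLift fun z => ψ t z ω).snd (u 0) (u n)
        - stratonovichSum (fun z => ψ t z ω) n u) P ∧
      ∫⁻ ω, ‖(limitLift fun z => ψ t z ω).snd (u 0) (u n)
        - stratonovichSum (fun z => ψ t z ω) n u‖ₑ ^ 2 ∂P
      ≤ (d * d : ℕ) * gaussMoment 2 ^ 2 * ENNReal.ofReal (2 * η) := by
  rcases isEmpty_or_nonempty (Fin d) with hd | ⟨⟨i₀⟩⟩
  · have : (fun ω => (limitLift fun z => ψ t z ω).snd (u 0) (u n)
        - stratonovichSum (fun z => ψ t z ω) n u) = fun _ => (0 : Tens d) :=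
      funext fun ω => Subsingleton.elim _ _
    refine ⟨this ▸ aestronglyMeasurable_const, ?_⟩
    have h2 : ∀ ω, (limitLift fun z => ψ t z ω).snd (u 0) (u n)
        - stratonovichSum (fun z => ψ t z ω) n u = (0 : Tens d) := fun ω => Subsingleton.elim _ _
    simp [h2]
  · obtain ⟨g, hg, hr⟩ := hψ.exists_kernelMap i₀
    refine lintegral_limit_sq_le hξ hg hr ht hu hu0 hun ?_ hη hη0
    filter_upwards [hc] with ω ⟨R, hR, h⟩
    exact h.tendsto_sum_gridArea hT hα hδ hαδ hq hq1 hR ht hu hu0 hun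

omit [IsProbabilityMeasure P] in
lemma eLpNorm_two_sq {E : Type*} [NormedAddCommGroup E] (f : Ω → E) :
    eLpNorm f 2 P ^ 2 = ∫⁻ ω, ‖f ω‖ₑ ^ 2 ∂P := by
  have := eLpNorm_nnreal_pow_eq_lintegral (f := f) (μ := P) (p := 2) two_ne_zero
  simpa using this

theorem IsHeatSolution.isSpatialLift_limitLift (hψ : IsHeatSolution P T ξ ψ)
    (hξ : IsWhiteNoise P T ξ) (hT : 0 < T) {α δ q : ℝ} (hα : 0 < α) (hδ : 0 < δ)
    (hαδ : α + δ ≤ 1) (hq : 0 ≤ q) (hq1 : q < 1)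
    (hc : ∀ᵐ ω ∂P, ∃ R, 0 ≤ R ∧ IsControlled T α δ q R fun t x => ψ t x ω) :
    IsSpatialLift P α T ψ fun ω t => limitLift fun x => ψ t x ω where
  path := by
    filter_upwards [hc] with ω ⟨R, hR, h⟩
    exact h.isGeometricPath_limitLift hT hα hδ hαδ hq hq1 hR
  init_eq := ae_of_all _ fun _ _ _ => rfl
  fst_eq := ae_of_all _ fun _ _ _ _ _ _ => rfl
  measurable_snd t ht x y hxy := by
    -- Any partition serves for measurability; the mesh bound 1 merely provides an admissible η.
    obtain ⟨n, u, hu, rfl, rfl, hmesh⟩ := exists_partition hxy.2.1 one_pos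
    have h1 := (hψ.lintegral_limitLift_sub_le hξ hT hα hδ hαδ hq hq1 hc ht hu hxy.1 hxy.2.2
      (fun l hl => (hmesh l hl).le) zero_le_one).1
    have h2 : AEStronglyMeasurable (fun ω => stratonovichSum (fun z => ψ t z ω) n u) P :=
      aestronglyMeasurable_stratonovichSum fun l hl => hψ.aestronglyMeasurable hξ ht
        ⟨hxy.1.trans (hu (Nat.zero_le l)), (hu hl).trans hxy.2.2⟩
    exact (h1.add h2).congr (ae_of_all _ fun ω => sub_add_cancel _ _)
  snd_limit t ht x y hxy ε hε := by
    set K : ℝ≥0∞ := (d * d : ℕ) * gaussMoment 2 ^ 2 with hK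
    have hKt : K ≠ ⊤ := ENNReal.mul_ne_top (ENNReal.natCast_ne_top _)
      (ENNReal.pow_ne_top (gaussMoment_lt_top 2).ne)
    have hlim : Tendsto (fun η : ℝ => K * ENNReal.ofReal (2 * η)) (𝓝[>] 0) (𝓝 0) := by
      have h1 : Tendsto (fun η : ℝ => 2 * η) (𝓝[>] 0) (𝓝 (2 * 0)) :=
        (tendsto_id.const_mul 2).mono_left nhdsWithin_le_nhds
      have h2 := ENNReal.Tendsto.const_mul (a := K) (ENNReal.tendsto_ofReal h1) (Or.inr hKt)
      simpa using h2
    -- The squared L² distance is at most K · 2η, so the mesh is chosen to bring this below ε².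
    obtain ⟨η, hη, hη0⟩ := ((hlim.eventually (gt_mem_nhds
      (ENNReal.pow_pos hε 2))).and self_mem_nhdsWithin).exists
    refine ⟨η, hη0, fun n u hu hu0 hun hmesh => ?_⟩
    subst hu0 hun
    refine (ENNReal.pow_lt_pow_left_iff two_ne_zero).1 ?_
    rw [eLpNorm_two_sq]
    refine lt_of_le_of_lt ?_ hη
    have h1 := (hψ.lintegral_limitLift_sub_le hξ hT hα hδ hαδ hq hq1 hc ht hu hxy.1 hxy.2.2
      (fun l hl => (hmesh l hl).le) (le_of_lt hη0)).2
    refine le_trans (le_of_eq (lintegral_congr fun ω => ?_)) h1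
    rw [← enorm_neg, neg_sub]

end Existence

/-! ### Convergence in `L^p` -/

section Lp

variable {Ω : Type*} [MeasurableSpace Ω] {P : Measure Ω}

/-- By (x + x²)^r ≤ 2^r (1 + x^(2r)); this is why the control R is given a moment of order 2r. -/
lemma lintegral_add_sq_pow_lt_top [IsProbabilityMeasure P] {R : Ω → ℝ} (hR : ∀ ω, 0 ≤ R ω) {r : ℕ}
    (h : ∫⁻ ω, ENNReal.ofReal (R ω) ^ (2 * r) ∂P < ⊤) :
    ∫⁻ ω, ENNReal.ofReal (R ω + R ω ^ 2) ^ r ∂P < ⊤ := by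
  have h1 : ∀ ω, ENNReal.ofReal (R ω + R ω ^ 2) ^ r
      ≤ 2 ^ r * (1 + ENNReal.ofReal (R ω) ^ (2 * r)) := fun ω => by
    have h0 := hR ω
    rw [ENNReal.ofReal_add h0 (by positivity), ENNReal.ofReal_pow h0, pow_mul]
    set x := ENNReal.ofReal (R ω)
    rcases le_total x 1 with hx | hx
    · calc (x + x ^ 2) ^ r ≤ (1 + 1 ^ 2) ^ r := by gcongr
        _ = 2 ^ r * 1 := by norm_num
        _ ≤ _ := by gcongr; exact le_self_add
    · have : x ≤ x ^ 2 := le_self_pow₀ hx two_ne_zero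
      calc (x + x ^ 2) ^ r ≤ (x ^ 2 + x ^ 2) ^ r := by gcongr
        _ = 2 ^ r * (x ^ 2) ^ r := by rw [← two_mul, mul_pow]
        _ ≤ _ := by gcongr; exact le_add_self
  refine (lintegral_mono h1).trans_lt ?_
  rw [lintegral_const_mul' _ _ (by simp), lintegral_add_left measurable_const]
  exact ENNReal.mul_lt_top (by simp) (by simpa using h)

lemma eLpNorm_le_of_le_mul {D G : Ω → ℝ≥0∞} {c : ℝ≥0∞} (hc : c ≠ ⊤) (h : ∀ᵐ ω ∂P, D ω ≤ c * G ω)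
    {r : ℕ} (hr : r ≠ 0) :
    eLpNorm D r P ≤ c * (∫⁻ ω, G ω ^ r ∂P) ^ (1 / (r : ℝ)) := by
  have hr' : (r : ℝ) ≠ 0 := by exact_mod_cast hr
  rw [eLpNorm_eq_lintegral_rpow_enorm_toReal (by exact_mod_cast hr) (by simp)]
  simp only [ENNReal.toReal_natCast, ENNReal.rpow_natCast, enorm_eq_self]
  calc (∫⁻ ω, D ω ^ r ∂P) ^ (1 / (r : ℝ))
      ≤ (∫⁻ ω, (c * G ω) ^ r ∂P) ^ (1 / (r : ℝ)) := by
        refine ENNReal.rpow_le_rpow (lintegral_mono_ae ?_) (by positivity)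
        filter_upwards [h] with ω hω
        gcongr
    _ = (c ^ r * ∫⁻ ω, G ω ^ r ∂P) ^ (1 / (r : ℝ)) := by
        simp_rw [mul_pow]
        rw [lintegral_const_mul' _ _ (ENNReal.pow_ne_top hc)]
    _ = _ := by
        rw [ENNReal.mul_rpow_of_nonneg _ _ (by positivity), ← ENNReal.rpow_natCast,
          ← ENNReal.rpow_mul, mul_one_div_cancel hr', ENNReal.rpow_one]

end Lp

/-! ### Convergence to an arbitrary spatial lift -/

section Convergence

variable {Ω : Type*} [MeasurableSpace Ω] {P : Measure Ω} [IsProbabilityMeasure P] {T : ℝ} {d : ℕ}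
  {ξ : Fin d → Lp ℝ 2 (spaceTime T) → Ω → ℝ} {ψ : ℝ → ℝ → Ω → Vec d} {α : ℝ}
  {Ψ : Ω → ℝ → RoughData d}

omit [IsProbabilityMeasure P] in
lemma IsHeatSolution.isGeometricPath_dyadicLift (hψ : IsHeatSolution P T ξ ψ) (hα : α ≤ 1) :
    ∀ᵐ ω ∂P, ∀ k, IsGeometricPath α T (dyadicLift ψ k ω) := by
  filter_upwards [hψ.continuous] with ω hω k
  exact isGeometricPath_naturalLift_dyadicInterp (ψ := fun t x => ψ t x ω) hα hω k

omit [IsProbabilityMeasure P] in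
lemma IsSpatialLift.aemeasurable_levelDist (hΨ : IsSpatialLift P α T ψ Ψ)
    (hψ : IsHeatSolution P T ξ ψ) (hξ : IsWhiteNoise P T ξ) (hT : 0 < T) (hα : α ≤ 1) (k : ℕ) :
    AEMeasurable (fun ω => levelDist α T (dyadicLift ψ k ω) (Ψ ω)) P := by
  have hm : ∀ t ∈ Icc 0 T, ∀ x ∈ Icc (0 : ℝ) 1, AEStronglyMeasurable (ψ t x) P :=
    fun t ht x hx => hψ.aestronglyMeasurable hξ ht hx
  refine SpatialLift.aemeasurable_levelDist hT ((hψ.isGeometricPath_dyadicLift hα).mono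
    fun ω h => h k) hΨ.path (fun s q => ?_)
    (fun s q => aestronglyMeasurable_snd_dyadicInterp (hm _ (s.time_mem hT)) k q)
    (fun s q => ?_) (fun s q => hΨ.measurable_snd _ (s.time_mem hT) _ _ q.mem_simplex)
  · exact (aestronglyMeasurable_dyadicInterp (hm _ (s.time_mem hT)) k q.2.2).sub
      (aestronglyMeasurable_dyadicInterp (hm _ (s.time_mem hT)) k (q.2.1.le.trans q.2.2))
  · refine ((hm _ (s.time_mem hT) q.right ⟨q.left_nonneg.trans q.left_lt_right.le,
      q.right_le_one⟩).sub (hm _ (s.time_mem hT) q.left ⟨q.left_nonneg,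
        q.left_lt_right.le.trans q.right_le_one⟩)).congr ?_
    filter_upwards [hΨ.fst_eq] with ω h
    exact (h _ (s.time_mem hT) _ _ q.mem_simplex).symm

variable {δ q : ℝ}

theorem IsSpatialLift.tendsto_pathDist (hΨ : IsSpatialLift P α T ψ Ψ) (hψ : IsHeatSolution P T ξ ψ)
    (hξ : IsWhiteNoise P T ξ) (hT : 0 < T) (hα : 0 < α) (hδ : 0 < δ)
    (hαδ : α + δ ≤ 1) (hq : 0 ≤ q) (hq1 : q < 1)
    (hc : ∀ᵐ ω ∂P, ∃ R, 0 ≤ R ∧ IsControlled T α δ q R fun t x => ψ t x ω) :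
    ∀ᵐ ω ∂P, Tendsto (fun k => pathDist α T (dyadicLift ψ k ω) (Ψ ω)) atTop (𝓝 0) := by
  have hΦ := hψ.isSpatialLift_limitLift hξ hT hα hδ hαδ hq hq1 hc
  filter_upwards [hc, hΨ.indistinguishable hT hΦ fun t ht x hx =>
    hψ.aestronglyMeasurable hξ ht hx] with ω ⟨R, hR, h⟩ h2
  refine (h.tendsto_pathDist hT hα hδ hαδ hq hq1 hR).congr fun k => ?_
  exact (pathDist_congr (fun t ht => (h2 t ht).1) fun t ht => (h2 t ht).2).symm

/-- Geometric decay of the moments of the distance to the dyadic lifts. -/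
theorem IsSpatialLift.eLpNorm_levelDist_le (hΨ : IsSpatialLift P α T ψ Ψ)
    (hψ : IsHeatSolution P T ξ ψ) (hξ : IsWhiteNoise P T ξ) (hT : 0 < T) (hα : 0 < α) (hδ : 0 < δ)
    (hαδ : α + δ ≤ 1) (hq : 0 ≤ q) (hq1 : q < 1) {R : Ω → ℝ} (hR : ∀ ω, 0 ≤ R ω)
    (hc : ∀ᵐ ω ∂P, IsControlled T α δ q (R ω) fun t x => ψ t x ω) {r : ℕ} (hr : r ≠ 0) (k : ℕ) :
    eLpNorm (fun ω => levelDist α T (dyadicLift ψ k ω) (Ψ ω)) r P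
      ≤ 2 * ENNReal.ofReal (|limitConst α δ q| * ((1 / 2 : ℝ) ^ δ) ^ k)
        * (∫⁻ ω, ENNReal.ofReal (R ω + R ω ^ 2) ^ r ∂P) ^ (1 / (r : ℝ)) := by
  have hΦ := hψ.isSpatialLift_limitLift hξ hT hα hδ hαδ hq hq1
    (hc.mono fun ω h => ⟨R ω, hR ω, h⟩)
  refine eLpNorm_le_of_le_mul (ENNReal.mul_ne_top (by simp) ENNReal.ofReal_ne_top) ?_ hr
  filter_upwards [hc, hΨ.indistinguishable hT hΦ fun t ht x hx =>
    hψ.aestronglyMeasurable hξ ht hx] with ω h h2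
  have h0 := hR ω
  rw [levelDist_congr fun t ht => (h2 t ht).2]
  refine (h.levelDist_le hT hα hδ hαδ hq hq1 h0 k).trans ?_
  rw [mul_assoc 2 (ENNReal.ofReal _), ← ENNReal.ofReal_mul (by positivity)]
  gcongr 2 * ENNReal.ofReal ?_
  calc limitConst α δ q * (R ω + R ω ^ 2) * ((1 / 2 : ℝ) ^ δ) ^ k
      ≤ |limitConst α δ q| * (R ω + R ω ^ 2) * ((1 / 2 : ℝ) ^ δ) ^ k := by
        gcongr; exact le_abs_self _
    _ = _ := by ring

end Convergence

end SpatialLift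

end

theorem mainTheorem5 {Ω : Type*} [MeasurableSpace Ω] (P : Measure Ω) [IsProbabilityMeasure P]
    {d : ℕ} (T : ℝ) (hT : 0 < T) (α : ℝ) (hα : 1 / 3 < α) (hα' : α < 1 / 2)
    (ξ : Fin d → Lp ℝ 2 (spaceTime T) → Ω → ℝ) (hξ : IsWhiteNoise P T ξ)
    (ψ : ℝ → ℝ → Ω → Vec d) (hψ : IsHeatSolution P T ξ ψ) :
    (∃ Ψ : Ω → ℝ → RoughData d, IsSpatialLift P α T ψ Ψ) ∧
    ∀ Ψ : Ω → ℝ → RoughData d, IsSpatialLift P α T ψ Ψ →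
      (∀ᵐ ω ∂P, (∀ k, IsGeometricPath α T (dyadicLift ψ k ω)) ∧
        Tendsto (fun k => pathDist α T (dyadicLift ψ k ω) (Ψ ω)) atTop (𝓝 0)) ∧
      ∀ p : ℝ, 1 < p →
        (∀ k, MemLp (fun ω => levelDist α T (dyadicLift ψ k ω) (Ψ ω)) (ENNReal.ofReal p) P) ∧
        Tendsto (fun k => eLpNorm (fun ω => levelDist α T (dyadicLift ψ k ω) (Ψ ω))
          (ENNReal.ofReal p) P) atTop (𝓝 0) := by
  -- δ is a quarter of the gap between α and 1/2. One δ becomes the rate of convergence in k,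
  -- through the exponent α + δ; the rest pays for the interpolation in time and for the summation
  -- of moments. The lower bound on α gives δ ≤ 1/24.
  obtain ⟨δ, hδα⟩ : ∃ δ : ℝ, α = 1 / 2 - 4 * δ := ⟨(1 / 2 - α) / 4, by ring⟩
  have hδ : 0 < δ := by linarith
  have hδ1 : δ ≤ 1 / 24 := by linarith
  have hα0 : 0 < α := by linarith
  have hα1 : α ≤ 1 := by linarith
  have hαδ : α + δ ≤ 1 := by linarith
  have hq : 0 ≤ (1 / 2 : ℝ) ^ (δ / 16) := by positivity
  have hq1 : (1 / 2 : ℝ) ^ (δ / 16) < 1 := half_rpow_lt_one (by positivity)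
  have hR := fun (r : ℕ) (hr : 16 ≤ δ * r) => hψ.exists_isControlled hξ hT hδ hδ1 hδα hr
  -- One order r meets both demands: r ≥ 16/δ makes the moments summable, and r ≥ p lets the L^r
  -- norm dominate the L^p norm on a probability space.
  have hlarge : ∀ p : ℝ, ∃ r : ℕ, 16 ≤ δ * r ∧ p ≤ r := fun p => by
    obtain ⟨r, hr⟩ := exists_nat_ge (max (16 / δ) p)
    exact ⟨r, (div_le_iff₀' hδ).1 ((le_max_left _ _).trans hr), (le_max_right _ _).trans hr⟩
  have hc : ∀ᵐ ω ∂P, ∃ R, 0 ≤ R ∧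
      IsControlled T α δ ((1 / 2 : ℝ) ^ (δ / 16)) R fun t x => ψ t x ω := by
    obtain ⟨r, hr, -⟩ := hlarge 0
    obtain ⟨R, hR0, -, h⟩ := hR r hr
    exact h.mono fun ω h => ⟨R ω, hR0 ω, h⟩
  refine ⟨⟨_, hψ.isSpatialLift_limitLift hξ hT hα0 hδ hαδ hq hq1 hc⟩, fun Ψ hΨ => ⟨?_, ?_⟩⟩
  · filter_upwards [hψ.isGeometricPath_dyadicLift hα1,
      hΨ.tendsto_pathDist hψ hξ hT hα0 hδ hαδ hq hq1 hc] with ω h1 h2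
    exact ⟨h1, h2⟩
  · intro p hp
    obtain ⟨r, hr, hpr⟩ := hlarge p
    obtain ⟨R, hR0, hRr, hRc⟩ := hR r hr
    have hr0 : r ≠ 0 := by rintro rfl; norm_num at hpr; linarith
    have hm := fun k => (hΨ.aemeasurable_levelDist hψ hξ hT hα1 k).aestronglyMeasurable
    set M : ℝ≥0∞ := (∫⁻ ω, ENNReal.ofReal (R ω + R ω ^ 2) ^ r ∂P) ^ (1 / (r : ℝ))
    have hM : M ≠ ⊤ := (ENNReal.rpow_lt_top_of_nonneg (by positivity)
      (lintegral_add_sq_pow_lt_top hR0 hRr).ne).ne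
    have hle : ∀ k, eLpNorm (fun ω => levelDist α T (dyadicLift ψ k ω) (Ψ ω))
        (ENNReal.ofReal p) P
        ≤ 2 * ENNReal.ofReal (|limitConst α δ ((1 / 2 : ℝ) ^ (δ / 16))| * ((1 / 2 : ℝ) ^ δ) ^ k)
          * M := fun k => by
      refine (eLpNorm_le_eLpNorm_of_exponent_le ?_ (hm k)).trans
        (hΨ.eLpNorm_levelDist_le hψ hξ hT hα0 hδ hαδ hq hq1 hR0 hRc hr0 k)
      exact (ENNReal.ofReal_le_ofReal hpr).trans_eq (ENNReal.ofReal_natCast r)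
    refine ⟨fun k => ⟨hm k, (hle k).trans_lt (ENNReal.mul_lt_top
      (ENNReal.mul_lt_top (by simp) ENNReal.ofReal_lt_top) hM.lt_top)⟩, ?_⟩
    refine tendsto_of_tendsto_of_tendsto_of_le_of_le tendsto_const_nhds ?_ (fun _ => zero_le) hle
    have h1 := (tendsto_pow_atTop_nhds_zero_of_lt_one (r := (1 / 2 : ℝ) ^ δ) (by positivity)
      (half_rpow_lt_one hδ)).const_mul |limitConst α δ ((1 / 2 : ℝ) ^ (δ / 16))|
    have h2 := ENNReal.Tendsto.mul_const (b := M) (ENNReal.Tendsto.const_mul (a := 2)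
      (ENNReal.tendsto_ofReal h1) (Or.inr (by simp))) (Or.inr hM)
    simpa using h2
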